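/- A \emph{grammar} $G=\langle\Xi,\mathcal A,\Delta\rangle$ has finite disjoint sets $\Xi$ of nonterminals and $\mathcal A$ of terminals and a finite set $\Delta\subseteq\Xi\times(\mathcal A\cup\Xi)^*$ of productions; its size is $|G|=\sum_{(X,w)\in\Delta}(|w|+1)$. We assume that the right-hand side of every production contains at most two occurrences of terminals and at most two occurrences of nonterminals. The control word of a step sequence is the word in $\Delta^*$ of the productions applied. A step sequence is \emph{$k$-index} if no word before or after one of its steps contains more than $k$ occurrences of nonterminals; it is \emph{depth-first} if each step rewrites a nonterminal occurrence whose first appearance in the sequence is latest among all nonterminal occurrences of the current word. For $X\in\Xi$, let $L_X(G)$ be the set of words in $\mathcal A^*$ derivable from $X$, $L_X^{(k)}(G)$ the set of those with a $k$-index derivation, $\hat L_X(\Gamma,G)$ (for $\Gamma\subseteq\Delta^*$) the set of those with a derivation whose control word is in $\Gamma$, and $\Gamma_X^{\mathbf{df}(k)}$ the set of control words of $k$-index depth-first derivations of words in $\mathcal A^*$ from $X$. A \emph{bounded expression} over an alphabet is an expression $w_1^*\cdots w_m^*$ with nonempty words $w_i$; it also denotes its language. \textbf{Theorem.} There are a constant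 $c$ and two fixed algorithms $P$ and $Q$ with the following property. Let $G=\langle\Xi,\mathcal A,\Delta\rangle$ be a grammar as above, let $X\in\Xi$, and let $\widetilde{\mathbf b}=a_1^*\cdots a_d^*$, with pairwise distinct $a_1,\dots,a_d\in\mathcal A$, be a minimal strict letter-bounded expression for $L_X(G)$, i.e. $L_X(G)\subseteq\widetilde{\mathbf b}$ and this inclusion fails whenever some $a_i^*$ is deleted from $\widetilde{\mathbf b}$. Let $k>0$, and put $n=\max(2,|G|)$. Then, for every listing of $\Delta$ given to the algorithms, there is a finite set $\mathcal S$ of bounded expressions over $\Delta$ such that $$L_X^{(k)}(G)\subseteq \hat L_X\Big(\bigcup\mathcal S\cap\Gamma_X^{\mathbf{df}(k+1)},\,G\Big).$$ Moreover, on input $(G,X,\widetilde{\mathbf b},k)$ the algorithm $P$ outputs a list of all elements of $\mathcal S$ in time at most $n^{ck+d}$ (so $\mathcal S$ is constructible in time $|G|^{\mathcal O(k)+d}$). On input $(G,X,\widetilde{\mathbf b},k,\sigma)$, where $\sigma\in\Delta^*$ has length at most $d$, the algorithm $Q$ outputs an element of $\mathcal S$ in time at most $n^{ck}$, and every element of $\mathcal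 S$ is the output of $Q$ for some such $\sigma$ (so each element of $\mathcal S$ is constructible in time $|G|^{\mathcal O(k)}$). Algorithms are first-order recursive programs on binary trees whose leaves are empty or carry atoms; the symbols of $\Xi\cup\mathcal A$ are the atoms (tagged as terminal or nonterminal), words and sets are given as lists, and $k$ is given in unary. The elementary operations, each of unit cost, are variable access, pairing, projection, test for emptiness, test of two atoms for equality, binding and function call. The running time is the number of elementary operations plus the size of the output. -/

import Mathlib

universe u v

/-! ### Bounded expressions -/

/-- A bounded expression `w₁* ⋯ w_d*` over the alphabet `α`, given by its list of
nonempty words. -/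
structure BoundedExpr (α : Type u) where
  words : List (List α)
  nonempty : ∀ w ∈ words, w ≠ []

/-- The language of `w₁* ⋯ w_d*`. -/
def BoundedExpr.lang {α : Type u} (b : BoundedExpr α) : Language α :=
  (b.words.map fun w => KStar.kstar ({w} : Language α)).prod

/-- The letter-bounded expression `a₁* ⋯ a_d*`. -/
def letterExpr {α : Type u} (a : List α) : BoundedExpr α where
  words := a.map fun x => [x]
  nonempty := by
    intro w hw
    obtain ⟨x, -, rfl⟩ := List.mem_map.1 hw
    simp

/-- `a₁* ⋯ a_d*` is a minimal strict letter-bounded expression for `L`: the letters are distinct,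
`L ⊆ a₁* ⋯ a_d*`, and this inclusion fails after the deletion of any `a_i*`. -/
def IsMinimalStrict {α : Type u} (a : List α) (L : Language α) : Prop :=
  a.Nodup ∧ L ≤ (letterExpr a).lang ∧
    ∀ i < a.length, ¬ L ≤ (letterExpr (a.eraseIdx i)).lang

/-! ### Grammars and step sequences -/

/-- A production `(X, w)` with `X` a nonterminal in `N` and `w` a word over `T` and `N`. -/
abbrev Production (N : Type u) (T : Type v) := ContextFreeRule T N

/-- A grammar with nonterminals `N`, terminals `T` and a finite set of productions
(there is no distinguished initial nonterminal). -/
structure Grammar (N : Type u) (T : Type v) where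
  productions : Finset (Production N T)

/-- Is the symbol a nonterminal? -/
def isNonterminal {N : Type u} {T : Type v} : Symbol T N → Bool
  | .terminal _ => false
  | .nonterminal _ => true

/-- The number of occurrences of nonterminals in a word. -/
def nonterminalCount {N : Type u} {T : Type v} (w : List (Symbol T N)) : ℕ :=
  w.countP fun x => isNonterminal x

/-- The number of occurrences of terminals in a word. -/
def terminalCount {N : Type u} {T : Type v} (w : List (Symbol T N)) : ℕ :=
  w.countP fun x => !isNonterminal x

/-- Replace the entry at position `j` (counted from `0`) by the list `r`. -/
def replaceAt {α : Type u} (l : List α) (j : ℕ) (r : List α) : List α :=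
  l.take j ++ r ++ l.drop (j + 1)

/-- The word `w_m` reached from `u = w_0` after the first `m` of the steps `s`, where a step
`(p, j)` applies the production `p` at position `j`. -/
def wordAt {N : Type u} {T : Type v} (u : List (Symbol T N)) (s : List (Production N T × ℕ)) :
    ℕ → List (Symbol T N)
  | 0 => u
  | m + 1 =>
    match s[m]? with
    | some (p, j) => replaceAt (wordAt u s m) j p.output
    | none => wordAt u s m

/-- The list `f_m(0), f_m(1), …`, where `f_m(i)` is the index `ℓ` of the first word `w_ℓ` of the
step sequence in which the occurrence at position `i` of `w_m` appears. -/
def birthAt {N : Type u} {T : Type v} (u : List (Symbol T N)) (s : List (Production N T × ℕ)) :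
    ℕ → List ℕ
  | 0 => List.replicate u.length 0
  | m + 1 =>
    match s[m]? with
    | some (p, j) => replaceAt (birthAt u s m) j (List.replicate p.output.length (m + 1))
    | none => birthAt u s m

/-- The sequence of steps is `k`-index: no word before or after a step has more than `k`
occurrences of nonterminals. -/
def IsIndexBounded {N : Type u} {T : Type v} (k : ℕ) (u : List (Symbol T N))
    (s : List (Production N T × ℕ)) : Prop :=
  ∀ m < s.length, nonterminalCount (wordAt u s m) ≤ k ∧ nonterminalCount (wordAt u s (m + 1)) ≤ k

/-- The sequence of steps is depth-first: each step rewrites a nonterminal occurrence whose index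
of first appearance is maximal among all nonterminal occurrences in the current word. -/
def IsDepthFirst {N : Type u} {T : Type v} (u : List (Symbol T N))
    (s : List (Production N T × ℕ)) : Prop :=
  ∀ m p j, s[m]? = some (p, j) → ∀ (i : ℕ) (Y : N), (wordAt u s m)[i]? = some (Symbol.nonterminal Y) →
    ((birthAt u s m)[i]?).getD 0 ≤ ((birthAt u s m)[j]?).getD 0

namespace Grammar

variable {N : Type u} {T : Type v}

/-- The size `|G| = ∑ (|w| + 1)`, the sum being over the productions `(X, w)`. -/
def size (G : Grammar N T) : ℕ := ∑ p ∈ G.productions, (p.output.length + 1)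

/-- `s` is a step sequence of `G` from `u` to `w`; its control word is `s.map Prod.fst`. -/
def IsStepSeq (G : Grammar N T) (u : List (Symbol T N)) (s : List (Production N T × ℕ))
    (w : List (Symbol T N)) : Prop :=
  (∀ m p j, s[m]? = some (p, j) →
    p ∈ G.productions ∧ (wordAt u s m)[j]? = some (Symbol.nonterminal p.input)) ∧
  wordAt u s s.length = w

/-- `s` is a derivation of the terminal word `w` from the nonterminal `X`. -/
def IsDerivation (G : Grammar N T) (X : N) (s : List (Production N T × ℕ)) (w : List T) : Prop :=
  G.IsStepSeq [Symbol.nonterminal X] s (w.map Symbol.terminal)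

/-- The language `L_X(G)`. -/
def language (G : Grammar N T) (X : N) : Language T :=
  {w | ∃ s, G.IsDerivation X s w}

/-- The `k`-index language `L_X^{(k)}(G)`. -/
def indexLanguage (G : Grammar N T) (k : ℕ) (X : N) : Language T :=
  {w | ∃ s, G.IsDerivation X s w ∧ IsIndexBounded k [Symbol.nonterminal X] s}

/-- The `k`-index depth-first control set `Γ_X^{df(k)}(G)`. -/
def dfControlSet (G : Grammar N T) (k : ℕ) (X : N) : Set (List (Production N T)) :=
  {γ | ∃ s w, s.map Prod.fst = γ ∧ G.IsDerivation X s w ∧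
    IsIndexBounded k [Symbol.nonterminal X] s ∧ IsDepthFirst [Symbol.nonterminal X] s}

/-- The language `L̂_X(Γ, G)` of the words that have a derivation with control word in `Γ`. -/
def controlledLanguage (G : Grammar N T) (X : N) (Γ : Set (List (Production N T))) : Language T :=
  {w | ∃ s, s.map Prod.fst ∈ Γ ∧ G.IsDerivation X s w}

end Grammar

/-! ### The machine model

First-order recursive programs on binary trees with atoms at the leaves (a first-order fragment of
Lisp).  The elementary operations are the construction of a pair, the two projections, the test
for `nil` and the test whether two values are the same atom; a program can handle atoms in no other
way.  Each operation, variable access, branching, binding and function call costs one step; the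
size of the final result is added to the number of steps, since values are shared in memory but
the result has to be written out. -/

/-- Binary trees with atoms from `α`: the data of the machine. -/
inductive ATree (α : Type u) : Type u
  | nil : ATree α
  | atom (a : α) : ATree α
  | pair (l r : ATree α) : ATree α

namespace ATree

variable {α : Type u}

/-- The number of nodes and leaves. -/
def size : ATree α → ℕ
  | nil => 1
  | atom _ => 1
  | pair l r => l.size + r.size + 1

/-- First component (`nil` if there is none). -/
def fst : ATree α → ATree α
  | pair l _ => l
  | _ => nil

/-- Second component (`nil` if there is none). -/
def snd : ATree α → ATree α
  | pair _ r => r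
  | _ => nil

/-- The value used for "true"; "false" is `nil`. -/
def tt : ATree α := pair nil nil

end ATree

/-- Expressions of the programming language.  `var i` is the variable with de Bruijn index `i`. -/
inductive PExpr : Type
  | var (i : ℕ) : PExpr
  | nil : PExpr
  | pair (e₁ e₂ : PExpr) : PExpr
  | fst (e : PExpr) : PExpr
  | snd (e : PExpr) : PExpr
  | eqAtom (e₁ e₂ : PExpr) : PExpr
  | ifNil (e e₁ e₂ : PExpr) : PExpr
  | bind (e₁ e₂ : PExpr) : PExpr
  | call (f : ℕ) (e : PExpr) : PExpr

/-- A program is a finite list of bodies of (mutually recursive) functions of one argument. -/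
abbrev Program := List PExpr

/-- `Eval P env e x t`: in the program `P`, with `env` the values of the variables, the evaluation
of `e` terminates with the value `x` after `t` steps. -/
inductive Eval {α : Type u} (P : Program) : List (ATree α) → PExpr → ATree α → ℕ → Prop
  | var {env i x} (h : env[i]? = some x) : Eval P env (.var i) x 1
  | nil {env} : Eval P env .nil ATree.nil 1
  | pair {env e₁ e₂ x₁ x₂ t₁ t₂} (h₁ : Eval P env e₁ x₁ t₁) (h₂ : Eval P env e₂ x₂ t₂) :
      Eval P env (.pair e₁ e₂) (ATree.pair x₁ x₂) (t₁ + t₂ + 1)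
  | fst {env e x t} (h : Eval P env e x t) : Eval P env (.fst e) x.fst (t + 1)
  | snd {env e x t} (h : Eval P env e x t) : Eval P env (.snd e) x.snd (t + 1)
  | eqAtom_true {env e₁ e₂ a t₁ t₂} (h₁ : Eval P env e₁ (ATree.atom a) t₁)
      (h₂ : Eval P env e₂ (ATree.atom a) t₂) :
      Eval P env (.eqAtom e₁ e₂) ATree.tt (t₁ + t₂ + 1)
  | eqAtom_false {env e₁ e₂ x₁ x₂ t₁ t₂} (h₁ : Eval P env e₁ x₁ t₁) (h₂ : Eval P env e₂ x₂ t₂)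
      (h : ¬ ∃ a, x₁ = ATree.atom a ∧ x₂ = ATree.atom a) :
      Eval P env (.eqAtom e₁ e₂) ATree.nil (t₁ + t₂ + 1)
  | ifNil_nil {env e e₁ e₂ y t t₁} (h : Eval P env e ATree.nil t) (h₁ : Eval P env e₁ y t₁) :
      Eval P env (.ifNil e e₁ e₂) y (t + t₁ + 1)
  | ifNil_else {env e e₁ e₂ x y t t₂} (h : Eval P env e x t) (hx : x ≠ ATree.nil)
      (h₂ : Eval P env e₂ y t₂) :
      Eval P env (.ifNil e e₁ e₂) y (t + t₂ + 1)
  | bind {env e₁ e₂ x y t₁ t₂} (h₁ : Eval P env e₁ x t₁) (h₂ : Eval P (x :: env) e₂ y t₂) :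
      Eval P env (.bind e₁ e₂) y (t₁ + t₂ + 1)
  | call {env f e body x y t₁ t₂} (h₁ : Eval P env e x t₁) (hf : P[f]? = some body)
      (h₂ : Eval P [x] body y t₂) :
      Eval P env (.call f e) y (t₁ + t₂ + 1)

/-- On input `x`, the program `P` (started with its function number `0`) terminates with output
`y`, and its running time, including the time for writing out `y`, is at most `B`. -/
def Program.OutputsWithin {α : Type u} (P : Program) (x y : ATree α) (B : ℕ) : Prop :=
  ∃ t, Eval P [x] (.call 0 (.var 0)) y t ∧ t + y.size ≤ B

/-! ### Encodings

The symbols of a grammar are the atoms. -/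

section Encoding

variable {N : Type u} {T : Type v}

/-- Encoding of a list, given the encoding of its entries. -/
def encList {α : Type u} {β : Type v} (enc : β → ATree α) : List β → ATree α
  | [] => .nil
  | x :: l => .pair (enc x) (encList enc l)

/-- A symbol is an atom, tagged with its kind (terminal or nonterminal). -/
def encSymbol (x : Symbol T N) : ATree (Symbol T N) :=
  .pair (if isNonterminal x then .tt else .nil) (.atom x)

def encProduction (p : Production N T) : ATree (Symbol T N) :=
  .pair (encSymbol (.nonterminal p.input)) (encList encSymbol p.output)

def encBoundedExpr (b : BoundedExpr (Production N T)) : ATree (Symbol T N) :=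
  encList (encList encProduction) b.words

/-- Numbers are encoded in unary. -/
def encNat (k : ℕ) : ATree (Symbol T N) :=
  encList (fun _ : Unit => .nil) (List.replicate k ())

/-- The input: a list of the productions of the grammar, the nonterminal `X`, the letters
`a₁, …, a_d`, and the number `k`. -/
def encInput (ps : List (Production N T)) (X : N) (a : List T) (k : ℕ) : ATree (Symbol T N) :=
  .pair (encList encProduction ps)
    (.pair (encSymbol (.nonterminal X))
      (.pair (encList (fun x => encSymbol (.terminal x)) a) (encNat k)))

end Encoding

/-!
# Bounded control sets for index-bounded derivations of letter-bounded grammars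

One bounded expression over the productions suffices: the set of expressions is a singleton. It
depends on the listed productions, the nonterminal and the index bound `k` only, and neither on the letters
`a₁, …, a_d` nor on the word `σ` that the second algorithm receives.

*Depth-first order.* When a derivation of index `k` produces two nonterminals, then one of the two
is rewritten into terminals completely while the other still has a nonterminal descendant, so the
former has a derivation of index `k - 1`. Expanding it first gives a depth-first derivation of index
`k` of the same word (`BoundedDer.exists_trav`). In depth-first order the pending nonterminals form a stack of height at
most `k`. The control words obtained this way are runs of a finite automaton whose states are the
stacks (`Trav.run`), and conversely each of its runs from `X` to the empty stack is the control word
of a depth-first derivation (`Run.exists_derivation`).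

*Only letter counts matter.* A word of `a₁* ⋯ a_d*` is determined by its letter counts
(`eq_of_perm_of_mem_lang_letterExpr`). All words derived from `X` are of this form. So a control word
may be replaced by any other one that labels a run with the same ends and produces the same terminals
up to order, and the same word is derived.

*Two letters at a time.* The yield of every subtree is sorted. As long as one of the two subtrees of a
node contains both the first and the last letter of the current interval of letters, everything
outside of it consists of these two letters; otherwise the two subtrees span shorter intervals with
at most one common letter. Hence the control word is a concatenation of at most `10 d + 2` pieces, each
of which produces at most two different letters (`Trav.cuttable`).

*Bounded replacement.* Let `V` be the number of stacks. A run can be decomposed, up to the order of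
its steps, into a run of at most `V²` steps and cycles of at most `V` steps at states of this run
(`LabeledPath.exists_skeleton`). Each cycle may be replaced by a representative with the same state
and the same counts of two given letters. These counts are at most `2 V`, as each production produces
at most two terminals, so a polynomial number of representatives is enough. If `B` is the product of
`w*` over all representatives and all single productions `w`, then each piece can be replaced by a
word in `B^(V² + 1)` (`Run.exists_mem_pow`), and the control word by one in `B` raised to a power that
is polynomial in `V` and the size of the grammar, as `d` is less than the number of symbols by
minimality. This power of `B` is the bounded expression `controlExpr`
(`indexLanguage_le_controlledLanguage`).

*Computing it.* The representatives are found by dynamic programming on the length of the run: the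
table keeps one control word for each pair of letters, pair of stacks and pair of counts, and is
extended by one production `V` times (`table_sound`, `table_complete`). As `V ≤ n^(2k)`, all lists
involved are polynomial in `n^k`. The program is written as a sequence of recursions on lists, and
its cost is bounded by a power of `m = n^(10k)` (`computes_controlWords`, `computes_controlExpr`).
-/

/-! ### From index-bounded derivations to depth-first traversals -/

section Traversal

variable {N : Type u} {T : Type v}

/-- A derivation of `w` from `u` in `n` steps, all of whose words have at most `k` occurrences
of nonterminals. -/
def BoundedDer (G : Grammar N T) (k : ℕ) :
    ℕ → List (Symbol T N) → List (Symbol T N) → Prop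
  | 0, u, w => nonterminalCount u ≤ k ∧ u = w
  | n + 1, u, w => nonterminalCount u ≤ k ∧ ∃ A B p, p ∈ G.productions ∧
      u = A ++ Symbol.nonterminal p.input :: B ∧ BoundedDer G k n (A ++ p.output ++ B) w

/-- `Trav G k X w γ`: some derivation tree with root `X` and yield `w` has a depth-first traversal
with control word `γ` during which at most `k` nonterminals are present.  Of two nonterminals
produced together either may be expanded first, while the other one waits. -/
inductive Trav (G : Grammar N T) : ℕ → N → List T → List (Production N T) → Prop
  | leaf {k p} {u : List T} (hp : p ∈ G.productions) (ho : p.output = u.map Symbol.terminal) :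
      Trav G (k + 1) p.input u [p]
  | one {k p Y γ} {u w v : List T} (hp : p ∈ G.productions)
      (ho : p.output = u.map Symbol.terminal ++ Symbol.nonterminal Y :: v.map Symbol.terminal)
      (h : Trav G k Y w γ) : Trav G k p.input (u ++ w ++ v) (p :: γ)
  | leftFirst {k p Y Z γ δ} {u y v z x : List T} (hp : p ∈ G.productions)
      (ho : p.output = u.map Symbol.terminal ++ Symbol.nonterminal Y :: v.map Symbol.terminal ++
        Symbol.nonterminal Z :: x.map Symbol.terminal)
      (hY : Trav G k Y y γ) (hZ : Trav G (k + 1) Z z δ) :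
      Trav G (k + 1) p.input (u ++ y ++ v ++ z ++ x) (p :: (γ ++ δ))
  | rightFirst {k p Y Z γ δ} {u y v z x : List T} (hp : p ∈ G.productions)
      (ho : p.output = u.map Symbol.terminal ++ Symbol.nonterminal Y :: v.map Symbol.terminal ++
        Symbol.nonterminal Z :: x.map Symbol.terminal)
      (hY : Trav G (k + 1) Y y γ) (hZ : Trav G k Z z δ) :
      Trav G (k + 1) p.input (u ++ y ++ v ++ z ++ x) (p :: (δ ++ γ))

@[simp] lemma nonterminalCount_append (u v : List (Symbol T N)) :
    nonterminalCount (u ++ v) = nonterminalCount u + nonterminalCount v := by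
  simp [nonterminalCount]

@[simp] lemma nonterminalCount_nil : nonterminalCount ([] : List (Symbol T N)) = 0 := rfl

@[simp] lemma nonterminalCount_cons_nonterminal (X : N) (u : List (Symbol T N)) :
    nonterminalCount (Symbol.nonterminal X :: u) = nonterminalCount u + 1 := by
  simp [nonterminalCount, isNonterminal]

@[simp] lemma nonterminalCount_cons_terminal (x : T) (u : List (Symbol T N)) :
    nonterminalCount (Symbol.terminal x :: u) = nonterminalCount u := by
  simp [nonterminalCount, isNonterminal]

@[simp] lemma nonterminalCount_map_terminal (w : List T) :
    nonterminalCount (w.map Symbol.terminal : List (Symbol T N)) = 0 := by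
  induction w with
  | nil => rfl
  | cons x w ih => simpa using ih

lemma exists_map_terminal_of_nonterminalCount_eq_zero :
    ∀ {u : List (Symbol T N)}, nonterminalCount u = 0 → ∃ w : List T, u = w.map Symbol.terminal
  | [], _ => ⟨[], rfl⟩
  | .terminal x :: u, h => by
    obtain ⟨w, rfl⟩ := exists_map_terminal_of_nonterminalCount_eq_zero (u := u) (by simpa using h)
    exact ⟨x :: w, rfl⟩
  | .nonterminal X :: u, h => by simp at h

/-- Splitting a word at its first nonterminal. -/
lemma exists_split_of_nonterminalCount_pos :
    ∀ {u : List (Symbol T N)}, 0 < nonterminalCount u →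
      ∃ (w : List T) (Y : N) (v : List (Symbol T N)),
        u = w.map Symbol.terminal ++ Symbol.nonterminal Y :: v
  | [], h => by simp at h
  | .terminal x :: u, h => by
    obtain ⟨w, Y, v, rfl⟩ := exists_split_of_nonterminalCount_pos (u := u) (by simpa using h)
    exact ⟨x :: w, Y, v, rfl⟩
  | .nonterminal X :: u, _ => ⟨[], X, u, rfl⟩

lemma BoundedDer.count_le {G : Grammar N T} {k n : ℕ} {u w : List (Symbol T N)}
    (h : BoundedDer G k n u w) : nonterminalCount u ≤ k := by
  cases n <;> exact h.1

lemma BoundedDer.of_map_terminal {G : Grammar N T} {k n : ℕ} {u : List T}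
    {w : List (Symbol T N)} (h : BoundedDer G k n (u.map Symbol.terminal) w) :
    n = 0 ∧ w = u.map Symbol.terminal := by
  cases n with
  | zero => exact ⟨rfl, h.2.symm⟩
  | succ n =>
    obtain ⟨-, A, B, p, -, e, -⟩ := h
    have := congrArg nonterminalCount e
    simp at this

/-- A derivation from a concatenation splits into derivations from the two parts.  If both parts
contain nonterminals, then one of the two loses its last nonterminal while the other part still
has one, so the derivation from the former part saves one nonterminal. -/
lemma BoundedDer.split {G : Grammar N T} {k : ℕ} {w : List T} :
    ∀ {n : ℕ} {A B : List (Symbol T N)}, BoundedDer G k n (A ++ B) (w.map Symbol.terminal) →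
      ∃ (w₁ w₂ : List T) (n₁ n₂ : ℕ), w = w₁ ++ w₂ ∧ n₁ + n₂ = n ∧
        BoundedDer G k n₁ A (w₁.map Symbol.terminal) ∧
        BoundedDer G k n₂ B (w₂.map Symbol.terminal) ∧
        (0 < nonterminalCount A → 0 < nonterminalCount B →
          BoundedDer G (k - 1) n₁ A (w₁.map Symbol.terminal) ∨
          BoundedDer G (k - 1) n₂ B (w₂.map Symbol.terminal)) := by
  intro n
  induction n with
  | zero =>
    rintro A B ⟨h, e⟩
    obtain ⟨w₁, w₂, rfl, rfl, rfl⟩ := List.append_eq_map_iff.1 e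
    exact ⟨w₁, w₂, 0, 0, rfl, rfl, ⟨by simp, rfl⟩, ⟨by simp, rfl⟩, by simp⟩
  | succ n ih =>
    rintro A B ⟨h, C, D, p, hp, e, hd⟩
    rw [nonterminalCount_append] at h
    rcases List.append_eq_append_iff.1 e with ⟨E, rfl, rfl⟩ | ⟨E, rfl, e'⟩
    · -- the rewritten occurrence lies in `B`
      have hd' : BoundedDer G k n (A ++ (E ++ p.output ++ D)) (w.map Symbol.terminal) := by
        simpa using hd
      obtain ⟨w₁, w₂, n₁, n₂, rfl, hn, h₁, h₂, h₃⟩ := ih hd'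
      refine ⟨w₁, w₂, n₁, n₂ + 1, rfl, by omega, h₁,
        ⟨by omega, E, D, p, hp, rfl, h₂⟩, fun hA _ => ?_⟩
      by_cases hB : 0 < nonterminalCount (E ++ p.output ++ D)
      · rcases h₃ hA hB with h' | h'
        · exact .inl h'
        · exact .inr ⟨by omega, E, D, p, hp, rfl, h'⟩
      · obtain ⟨v, hv⟩ := exists_map_terminal_of_nonterminalCount_eq_zero
          (Nat.eq_zero_of_not_pos hB)
        rw [hv] at h₂
        obtain ⟨rfl, hw⟩ := h₂.of_map_terminal
        refine .inr ⟨by omega, E, D, p, hp, rfl, ?_⟩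
        rw [hv, hw]
        exact ⟨by simp, rfl⟩
    · rcases E with _ | ⟨x, E⟩
      · simp only [List.nil_append] at e'
        subst e'
        have hd' : BoundedDer G k n (C ++ (p.output ++ D)) (w.map Symbol.terminal) := by
          simpa using hd
        simp only [List.append_nil] at h ⊢
        obtain ⟨w₁, w₂, n₁, n₂, rfl, hn, h₁, h₂, h₃⟩ := ih hd'
        refine ⟨w₁, w₂, n₁, n₂ + 1, rfl, by omega, h₁,
          ⟨by omega, [], D, p, hp, rfl, by simpa using h₂⟩, fun hA _ => ?_⟩
        by_cases hB : 0 < nonterminalCount (p.output ++ D)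
        · rcases h₃ hA hB with h' | h'
          · exact .inl h'
          · exact .inr ⟨by omega, [], D, p, hp, rfl, by simpa using h'⟩
        · obtain ⟨v, hv⟩ := exists_map_terminal_of_nonterminalCount_eq_zero
            (Nat.eq_zero_of_not_pos hB)
          rw [hv] at h₂
          obtain ⟨rfl, hw⟩ := h₂.of_map_terminal
          refine .inr ⟨by omega, [], D, p, hp, rfl, ?_⟩
          rw [List.nil_append, hv, hw]
          exact ⟨by simp, rfl⟩
      · simp only [List.cons_append, List.cons.injEq] at e'
        obtain ⟨rfl, rfl⟩ := e'
        have hd' : BoundedDer G k n ((C ++ p.output ++ E) ++ B) (w.map Symbol.terminal) := by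
          simpa using hd
        obtain ⟨w₁, w₂, n₁, n₂, rfl, hn, h₁, h₂, h₃⟩ := ih hd'
        refine ⟨w₁, w₂, n₁ + 1, n₂, rfl, by omega,
          ⟨by omega, C, E, p, hp, rfl, h₁⟩, h₂, fun _ hB => ?_⟩
        by_cases hA : 0 < nonterminalCount (C ++ p.output ++ E)
        · rcases h₃ hA hB with h' | h'
          · exact .inl ⟨by omega, C, E, p, hp, rfl, h'⟩
          · exact .inr h'
        · obtain ⟨v, hv⟩ := exists_map_terminal_of_nonterminalCount_eq_zero
            (Nat.eq_zero_of_not_pos hA)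
          rw [hv] at h₁
          obtain ⟨rfl, hw⟩ := h₁.of_map_terminal
          refine .inl ⟨by omega, C, E, p, hp, rfl, ?_⟩
          rw [hv, hw]
          exact ⟨by simp, rfl⟩

/-- Terminals around a single nonterminal do not take part in a derivation. -/
lemma BoundedDer.of_context {G : Grammar N T} {k n : ℕ} {u v w : List T} {Y : N}
    (h : BoundedDer G k n (u.map Symbol.terminal ++ Symbol.nonterminal Y :: v.map Symbol.terminal)
      (w.map Symbol.terminal)) :
    ∃ y : List T, w = u ++ y ++ v ∧
      BoundedDer G k n [Symbol.nonterminal Y] (y.map Symbol.terminal) := by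
  obtain ⟨w₁, w₂, n₁, n₂, rfl, hn, h₁, h₂, -⟩ := h.split
  obtain ⟨rfl, e₁⟩ := h₁.of_map_terminal
  have h₂' : BoundedDer G k n₂ ([Symbol.nonterminal Y] ++ v.map Symbol.terminal)
    (w₂.map Symbol.terminal) := h₂
  obtain ⟨w₃, w₄, n₃, n₄, rfl, hn', h₃, h₄, -⟩ := h₂'.split
  obtain ⟨rfl, e₄⟩ := h₄.of_map_terminal
  have inj : Function.Injective (Symbol.terminal : T → Symbol T N) := fun _ _ h => by simpa using h
  obtain rfl := List.map_injective_iff.2 inj e₁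
  obtain rfl := List.map_injective_iff.2 inj e₄
  obtain rfl : n₃ = n := by omega
  exact ⟨w₃, by simp, h₃⟩

/-- A `k`-index derivation can be rearranged into a `k`-index depth-first one: whenever two
nonterminals are produced together, one of the two subtrees has a derivation of smaller index, and
this one is traversed first. -/
theorem BoundedDer.exists_trav {G : Grammar N T}
    (hG : ∀ p ∈ G.productions, nonterminalCount p.output ≤ 2) :
    ∀ {n k : ℕ} {X : N} {w : List T},
      BoundedDer G k n [Symbol.nonterminal X] (w.map Symbol.terminal) → ∃ γ, Trav G k X w γ := by
  intro n
  induction n using Nat.strong_induction_on with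
  | _ n ih =>
    intro k X w h
    cases n with
    | zero =>
      have := congrArg nonterminalCount h.2
      simp at this
    | succ n =>
    obtain ⟨hk, A, B, p, hp, e, hd⟩ := h
    have hl := congrArg List.length e
    simp only [List.length_cons, List.length_nil, List.length_append] at hl
    obtain rfl : A = [] := List.eq_nil_of_length_eq_zero (by omega)
    obtain rfl : B = [] := List.eq_nil_of_length_eq_zero (by omega)
    obtain rfl : X = p.input := by simpa using e
    have hk1 : 1 ≤ k := by simpa using hk
    obtain ⟨k, rfl⟩ : ∃ k', k = k' + 1 := ⟨k - 1, by omega⟩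
    simp only [List.nil_append, List.append_nil] at hd
    have inj : Function.Injective (Symbol.terminal : T → Symbol T N) :=
      fun _ _ h => by simpa using h
    rcases Nat.eq_zero_or_pos (nonterminalCount p.output) with h0 | h0
    · obtain ⟨v, hv⟩ := exists_map_terminal_of_nonterminalCount_eq_zero h0
      rw [hv] at hd
      obtain ⟨-, e⟩ := hd.of_map_terminal
      obtain rfl := List.map_injective_iff.2 inj e
      exact ⟨_, .leaf hp hv⟩
    obtain ⟨u, Y, v, ho⟩ := exists_split_of_nonterminalCount_pos h0
    have h2 := hG p hp
    rw [ho] at h2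
    simp only [nonterminalCount_append, nonterminalCount_map_terminal,
      nonterminalCount_cons_nonterminal] at h2
    rcases Nat.eq_zero_or_pos (nonterminalCount v) with h0' | h0'
    · obtain ⟨v, rfl⟩ := exists_map_terminal_of_nonterminalCount_eq_zero h0'
      rw [ho] at hd
      obtain ⟨y, rfl, hy⟩ := hd.of_context
      obtain ⟨γ, hγ⟩ := ih n (by omega) hy
      exact ⟨_, .one hp ho hγ⟩
    obtain ⟨v, Z, x, rfl⟩ := exists_split_of_nonterminalCount_pos h0'
    simp only [nonterminalCount_append, nonterminalCount_map_terminal,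
      nonterminalCount_cons_nonterminal] at h2
    obtain ⟨x, rfl⟩ := exists_map_terminal_of_nonterminalCount_eq_zero
      (show nonterminalCount x = 0 by omega)
    have ho' : p.output =
        (u.map Symbol.terminal ++ Symbol.nonterminal Y :: v.map Symbol.terminal) ++
        ([].map Symbol.terminal ++ Symbol.nonterminal Z :: x.map Symbol.terminal) := by
      simpa using ho
    rw [ho'] at hd
    obtain ⟨w₁, w₂, n₁, n₂, rfl, hn, h₁, h₂, h₃⟩ := hd.split
    rcases h₃ (by simp) (by simp) with h' | h'
    · obtain ⟨y, rfl, hy⟩ := h'.of_context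
      obtain ⟨z, rfl, hz⟩ := h₂.of_context
      obtain ⟨γ, hγ⟩ := ih n₁ (by omega) hy
      obtain ⟨δ, hδ⟩ := ih n₂ (by omega) hz
      exact ⟨_, by simpa using Trav.leftFirst hp (by simpa using ho) hγ hδ⟩
    · obtain ⟨y, rfl, hy⟩ := h₁.of_context
      obtain ⟨z, rfl, hz⟩ := h'.of_context
      obtain ⟨γ, hγ⟩ := ih n₁ (by omega) hy
      obtain ⟨δ, hδ⟩ := ih n₂ (by omega) hz
      exact ⟨_, by simpa using Trav.rightFirst hp (by simpa using ho) hγ hδ⟩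

lemma wordAt_cons (u : List (Symbol T N)) (p : Production N T) (j : ℕ)
    (s : List (Production N T × ℕ)) (m : ℕ) :
    wordAt u ((p, j) :: s) (m + 1) = wordAt (replaceAt u j p.output) s m := by
  induction m with
  | zero => rfl
  | succ m ih =>
    rw [wordAt.eq_2 _ _ (m + 1), ih, wordAt.eq_2 _ _ m]
    simp

lemma BoundedDer.of_isStepSeq {G : Grammar N T} {k : ℕ} {w : List (Symbol T N)} :
    ∀ {s : List (Production N T × ℕ)} {u : List (Symbol T N)}, G.IsStepSeq u s w →
      (∀ m ≤ s.length, nonterminalCount (wordAt u s m) ≤ k) → BoundedDer G k s.length u w := by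
  intro s
  induction s with
  | nil =>
    intro u h hk
    exact ⟨hk 0 le_rfl, h.2⟩
  | cons x s ih =>
    obtain ⟨p, j⟩ := x
    intro u h hk
    obtain ⟨hp, hj⟩ := h.1 0 p j rfl
    change u[j]? = _ at hj
    obtain ⟨hj', hj''⟩ := List.getElem?_eq_some_iff.1 hj
    refine ⟨hk 0 (Nat.zero_le _), u.take j, u.drop (j + 1), p, hp, ?_, ih ⟨?_, ?_⟩ ?_⟩
    · rw [← hj'', List.getElem_cons_drop, List.take_append_drop]
    · intro m q i hm
      have := h.1 (m + 1) q i (by simpa using hm)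
      rwa [wordAt_cons] at this
    · have := h.2
      rwa [List.length_cons, wordAt_cons] at this
    · intro m hm
      have := hk (m + 1) (by simpa using hm)
      rwa [wordAt_cons] at this

/-- Every word of the `k`-index language is the yield of a traversal.  The index bound speaks of the
words before and after steps; since a nonterminal is no terminal word, there is at least one step,
so that it covers all words of the derivation. -/
theorem Grammar.exists_trav_of_mem_indexLanguage {G : Grammar N T}
    (hG : ∀ p ∈ G.productions, nonterminalCount p.output ≤ 2) {k : ℕ} {X : N} {w : List T}
    (hw : w ∈ G.indexLanguage k X) : ∃ γ, Trav G k X w γ := by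
  obtain ⟨s, hs, hk⟩ := hw
  have hs0 : s ≠ [] := by
    rintro rfl
    have := congrArg nonterminalCount hs.2
    simp [wordAt] at this
  have hpos := List.length_pos_iff.2 hs0
  refine (BoundedDer.of_isStepSeq hs fun m hm => ?_).exists_trav hG
  rcases hm.lt_or_eq with h | rfl
  · exact (hk m h).1
  · have := (hk (s.length - 1) (by omega)).2
    rwa [Nat.sub_add_cancel hpos] at this

end Traversal

/-! ### Runs of automata -/

section Runs

variable {Q Δ : Type*}

/-- `γ` is the label of a path from `q` to `r` in the automaton with transition relation `δ`. -/
def Run (δ : Q → Δ → Q → Prop) : Q → List Δ → Q → Prop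
  | q, [], r => q = r
  | q, p :: γ, r => ∃ s, δ q p s ∧ Run δ s γ r

lemma Run.append_iff {δ : Q → Δ → Q → Prop} {γ₁ γ₂ : List Δ} :
    ∀ {q r : Q}, Run δ q (γ₁ ++ γ₂) r ↔ ∃ s, Run δ q γ₁ s ∧ Run δ s γ₂ r := by
  induction γ₁ with
  | nil => simp [Run]
  | cons p γ₁ ih =>
    intro q r
    simp only [List.cons_append, Run, ih]
    grind

lemma Run.append {δ : Q → Δ → Q → Prop} {γ₁ γ₂ : List Δ} {q s r : Q}
    (h₁ : Run δ q γ₁ s) (h₂ : Run δ s γ₂ r) : Run δ q (γ₁ ++ γ₂) r :=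
  Run.append_iff.2 ⟨s, h₁, h₂⟩

lemma Run.mono {δ δ' : Q → Δ → Q → Prop} :
    ∀ {γ : List Δ} {q r : Q}, (∀ q r, ∀ p ∈ γ, δ q p r → δ' q p r) → Run δ q γ r → Run δ' q γ r
  | [], _, _, _, hr => hr
  | p :: _, _, _, h, ⟨s, hs, hr⟩ =>
    ⟨s, h _ _ p (by simp) hs, Run.mono (fun q r p hp => h q r p (List.mem_cons_of_mem _ hp)) hr⟩

end Runs

/-! ### The stack automaton of depth-first derivations -/

section Stack

variable {N : Type u} {T : Type v}

/-- The nonterminals of a word, in order. -/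
def nonterminals (w : List (Symbol T N)) : List (Symbol T N) :=
  w.filter fun x => isNonterminal x

/-- The terminals of a word, in order. -/
def terminals (w : List (Symbol T N)) : List T :=
  w.filterMap fun x => match x with
    | .terminal t => some t
    | .nonterminal _ => none

@[simp] lemma terminals_nil : terminals ([] : List (Symbol T N)) = [] := rfl

@[simp] lemma terminals_cons_terminal (x : T) (w : List (Symbol T N)) :
    terminals (.terminal x :: w) = x :: terminals w := by
  simp [terminals]

@[simp] lemma terminals_cons_nonterminal (x : N) (w : List (Symbol T N)) :
    terminals (.nonterminal x :: w) = terminals w := by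
  simp [terminals]

@[simp] lemma terminals_append (w w' : List (Symbol T N)) :
    terminals (w ++ w') = terminals w ++ terminals w' := by
  simp [terminals]

@[simp] lemma terminals_map_terminal (w : List T) :
    terminals (w.map Symbol.terminal : List (Symbol T N)) = w := by
  induction w with
  | nil => rfl
  | cons x w ih => simpa using ih

lemma mem_terminals {w : List (Symbol T N)} {x : T} :
    x ∈ terminals w ↔ Symbol.terminal x ∈ w := by
  induction w with
  | nil => simp
  | cons y w ih => cases y <;> simp [ih]

lemma length_terminals (w : List (Symbol T N)) : (terminals w).length = terminalCount w := by
  induction w with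
  | nil => rfl
  | cons y w ih =>
    cases y <;> simp_all [terminalCount, isNonterminal]

/-- The terminals produced by the productions of a control word. -/
def effect (γ : List (Production N T)) : List T := γ.flatMap fun p => terminals p.output

@[simp] lemma effect_nil : effect ([] : List (Production N T)) = [] := rfl

@[simp] lemma effect_cons (p : Production N T) (γ : List (Production N T)) :
    effect (p :: γ) = terminals p.output ++ effect γ := rfl

@[simp] lemma effect_append (γ δ : List (Production N T)) :
    effect (γ ++ δ) = effect γ ++ effect δ := by
  simp [effect]

/-- The stack automaton: a state is the list of the nonterminals still to be expanded, a step
expands the first one and puts the new nonterminals, in one of two orders, in front of the rest. -/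
def StackStep (S : List (Symbol T N)) (p : Production N T) (S' : List (Symbol T N)) : Prop :=
  ∃ S₀, S = .nonterminal p.input :: S₀ ∧
    (S' = nonterminals p.output ++ S₀ ∨ S' = (nonterminals p.output).reverse ++ S₀)

/-- The stack automaton of the grammar `G` restricted to stacks of height at most `k`. -/
def BoundedStackStep (G : Grammar N T) (k : ℕ) (S : List (Symbol T N)) (p : Production N T)
    (S' : List (Symbol T N)) : Prop :=
  p ∈ G.productions ∧ StackStep S p S' ∧ S.length ≤ k ∧ S'.length ≤ k

lemma Trav.one_le {G : Grammar N T} {k : ℕ} {X : N} {w : List T} {γ : List (Production N T)}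
    (h : Trav G k X w γ) : 1 ≤ k := by
  induction h <;> omega

lemma Trav.mem_productions {G : Grammar N T} {k : ℕ} {X : N} {w : List T}
    {γ : List (Production N T)} (h : Trav G k X w γ) : ∀ p ∈ γ, p ∈ G.productions := by
  induction h <;> grind

lemma Trav.effect_perm {G : Grammar N T} {k : ℕ} {X : N} {w : List T}
    {γ : List (Production N T)} (h : Trav G k X w γ) : (effect γ).Perm w := by
  classical
  induction h with
  | leaf hp ho => simp [ho]
  | one hp ho h ih =>
    rw [List.perm_iff_count] at *
    intro x
    have := ih x
    simp only [effect_cons, ho, terminals_append, terminals_cons_nonterminal,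
      terminals_map_terminal, List.count_append]
    omega
  | leftFirst hp ho h h' ih ih' =>
    rw [List.perm_iff_count] at *
    intro x
    have := ih x
    have := ih' x
    simp only [effect_cons, effect_append, ho, terminals_append, terminals_cons_nonterminal,
      terminals_map_terminal, List.count_append]
    omega
  | rightFirst hp ho h h' ih ih' =>
    rw [List.perm_iff_count] at *
    intro x
    have := ih x
    have := ih' x
    simp only [effect_cons, effect_append, ho, terminals_append, terminals_cons_nonterminal,
      terminals_map_terminal, List.count_append]
    omega

@[simp] lemma nonterminals_append (w w' : List (Symbol T N)) :
    nonterminals (w ++ w') = nonterminals w ++ nonterminals w' := by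
  simp [nonterminals]

@[simp] lemma nonterminals_map_terminal (w : List T) :
    nonterminals (w.map Symbol.terminal : List (Symbol T N)) = [] := by
  simp [nonterminals, isNonterminal]

@[simp] lemma nonterminals_cons_nonterminal (x : N) (w : List (Symbol T N)) :
    nonterminals (.nonterminal x :: w) = .nonterminal x :: nonterminals w := by
  simp [nonterminals, isNonterminal]

/-- A traversal is a run of the stack automaton, above any stack of waiting nonterminals. -/
lemma Trav.run {G : Grammar N T} {k : ℕ} {X : N} {w : List T} {γ : List (Production N T)}
    (h : Trav G k X w γ) : ∀ {l : ℕ} {S : List (Symbol T N)}, k + S.length ≤ l →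
      Run (BoundedStackStep G l) (.nonterminal X :: S) γ S := by
  induction h with
  | @leaf k p u hp ho =>
    intro l S hl
    exact ⟨S, ⟨hp, ⟨S, rfl, .inl (by simp [ho])⟩, by simp only [List.length_cons]; omega,
      by omega⟩, rfl⟩
  | @one k p Y γ u w v hp ho h ih =>
    intro l S hl
    have := h.one_le
    exact ⟨.nonterminal Y :: S, ⟨hp, ⟨S, rfl, .inl (by simp [ho])⟩,
      by simp only [List.length_cons]; omega, by simp only [List.length_cons]; omega⟩, ih hl⟩
  | @leftFirst k p Y Z γ δ u y v z x hp ho h h' ih ih' =>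
    intro l S hl
    have := h.one_le
    refine ⟨.nonterminal Y :: .nonterminal Z :: S, ⟨hp, ⟨S, rfl, .inl (by simp [ho])⟩,
      by simp only [List.length_cons]; omega, by simp only [List.length_cons]; omega⟩,
      Run.append (ih ?_) (ih' hl)⟩
    simp only [List.length_cons]; omega
  | @rightFirst k p Y Z γ δ u y v z x hp ho h h' ih ih' =>
    intro l S hl
    have := h'.one_le
    refine ⟨.nonterminal Z :: .nonterminal Y :: S, ⟨hp, ⟨S, rfl, .inr (by simp [ho])⟩,
      by simp only [List.length_cons]; omega, by simp only [List.length_cons]; omega⟩,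
      Run.append (ih' ?_) (ih hl)⟩
    simp only [List.length_cons]; omega

lemma wordAt_append (u : List (Symbol T N)) (s t : List (Production N T × ℕ)) :
    ∀ {m : ℕ}, m ≤ s.length → wordAt u (s ++ t) m = wordAt u s m
  | 0, _ => rfl
  | m + 1, h => by
    rw [wordAt.eq_2 _ _ m, wordAt.eq_2 u s m, wordAt_append u s t (by omega),
      List.getElem?_append_left (by omega)]

lemma birthAt_append (u : List (Symbol T N)) (s t : List (Production N T × ℕ)) :
    ∀ {m : ℕ}, m ≤ s.length → birthAt u (s ++ t) m = birthAt u s m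
  | 0, _ => rfl
  | m + 1, h => by
    rw [birthAt.eq_2 _ _ m, birthAt.eq_2 u s m, birthAt_append u s t (by omega),
      List.getElem?_append_left (by omega)]

lemma replaceAt_append_cons {α : Type*} (A B r : List α) (x : α) :
    replaceAt (A ++ x :: B) A.length r = A ++ r ++ B := by
  simp [replaceAt]

/-- The occurrences of nonterminals in the last word of a step sequence, with their indices of
first appearance. -/
def bornNonterminals (u : List (Symbol T N)) (s : List (Production N T × ℕ)) :
    List (Symbol T N × ℕ) :=
  ((wordAt u s s.length).zip (birthAt u s s.length)).filter fun x => isNonterminal x.1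

/-- A depth-first step sequence that has arrived at the stack `S`: up to order, the stack holds
the nonterminal occurrences of the current word, and these lie on the stack in the order of their
first appearances, the latest on top. -/
structure Realizes (G : Grammar N T) (k : ℕ) (X : N) (s : List (Production N T × ℕ))
    (S : List (Symbol T N)) : Prop where
  valid : ∀ m p j, s[m]? = some (p, j) → p ∈ G.productions ∧
    (wordAt [.nonterminal X] s m)[j]? = some (.nonterminal p.input)
  index : IsIndexBounded k [.nonterminal X] s
  depthFirst : IsDepthFirst [.nonterminal X] s
  length_eq : (birthAt [.nonterminal X] s s.length).length =
    (wordAt [.nonterminal X] s s.length).length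
  stack : ∃ L : List (Symbol T N × ℕ), L.map Prod.fst = S ∧
    L.Pairwise (fun x y => y.2 ≤ x.2) ∧ (∀ x ∈ L, x.2 ≤ s.length) ∧
    (bornNonterminals [.nonterminal X] s).Perm L
  effect_perm : (terminals (wordAt [.nonterminal X] s s.length)).Perm (effect (s.map Prod.fst))

lemma filter_zip_map_fst {α β : Type*} (f : α → Bool) :
    ∀ {l : List α} {l' : List β}, l'.length = l.length →
      ((l.zip l').filter fun x => f x.1).map Prod.fst = l.filter f
  | [], _, _ => by simp
  | a :: l, b :: l', h => by
    have := filter_zip_map_fst f (l := l) (l' := l') (by simpa using h)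
    by_cases ha : f a <;> simp [ha, this]
  | a :: l, [], h => by simp at h

lemma length_bornNonterminals {u : List (Symbol T N)} {s : List (Production N T × ℕ)}
    (h : (birthAt u s s.length).length = (wordAt u s s.length).length) :
    (bornNonterminals u s).length = nonterminalCount (wordAt u s s.length) := by
  rw [nonterminalCount, List.countP_eq_length_filter,
    ← filter_zip_map_fst (fun x => isNonterminal x) h, List.length_map, bornNonterminals]

lemma Realizes.nonterminalCount_eq {G : Grammar N T} {k : ℕ} {X : N}
    {s : List (Production N T × ℕ)} {S : List (Symbol T N)} (h : Realizes G k X s S) :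
    nonterminalCount (wordAt [.nonterminal X] s s.length) = S.length := by
  obtain ⟨L, rfl, -, -, hL⟩ := h.stack
  rw [List.length_map, ← hL.length_eq, length_bornNonterminals h.length_eq]

lemma filter_zip_replicate (w : List (Symbol T N)) (b : ℕ) :
    ((w.zip (List.replicate w.length b)).filter fun x => isNonterminal x.1) =
      (nonterminals w).map fun x => (x, b) := by
  induction w with
  | nil => rfl
  | cons x w ih =>
    cases x <;> simp_all [nonterminals, isNonterminal, List.replicate_succ]

lemma Realizes.step {G : Grammar N T} {k : ℕ} {X : N} {s : List (Production N T × ℕ)}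
    {S S' : List (Symbol T N)} {p : Production N T} (h : Realizes G k X s S)
    (hp : BoundedStackStep G k S p S') : ∃ j, Realizes G k X (s ++ [(p, j)]) S' := by
  obtain ⟨hpG, ⟨S₀, rfl, hS'⟩, hk, hk'⟩ := hp
  have hcount := h.nonterminalCount_eq
  obtain ⟨L, hLS, hsort, hle, hperm⟩ := h.stack
  obtain ⟨⟨x, b⟩, L, rfl, hx, rfl⟩ := List.map_eq_cons_iff.1 hLS
  simp only at hx
  subst hx
  set u : List (Symbol T N) := [.nonterminal X] with hu
  set W := wordAt u s s.length with hW
  set F := birthAt u s s.length with hF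
  have hlen : F.length = W.length := h.length_eq
  -- the position of the top of the stack in the current word
  have hmem : ((Symbol.nonterminal p.input : Symbol T N), b) ∈ W.zip F :=
    List.mem_of_mem_filter (hperm.mem_iff.2 (List.mem_cons_self))
  obtain ⟨j, hj, hjx⟩ := List.mem_iff_getElem.1 hmem
  rw [List.length_zip] at hj
  rw [List.getElem_zip, Prod.mk.injEq] at hjx
  obtain ⟨hjW, hjF⟩ := hjx
  obtain ⟨A, B, hA, hWAB⟩ : ∃ A B, A.length = j ∧ W = A ++ Symbol.nonterminal p.input :: B :=
    ⟨W.take j, W.drop (j + 1), by simp; omega, by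
      rw [← hjW, List.getElem_cons_drop, List.take_append_drop]⟩
  obtain ⟨FA, FB, hFA, hFAB⟩ : ∃ FA FB, FA.length = j ∧ F = FA ++ b :: FB :=
    ⟨F.take j, F.drop (j + 1), by simp; omega, by
      conv_rhs => rw [← hjF]
      rw [List.getElem_cons_drop, List.take_append_drop]⟩
  have hFB : FB.length = B.length := by
    rw [hWAB, hFAB] at hlen
    simp only [List.length_append, List.length_cons] at hlen
    omega
  have hlast : (s ++ [(p, j)]).length = s.length + 1 := by simp
  have hW' : wordAt u (s ++ [(p, j)]) (s.length + 1) = A ++ p.output ++ B := by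
    rw [wordAt.eq_2, wordAt_append _ _ _ le_rfl, ← hW, hWAB]
    simp [← hA, replaceAt_append_cons]
  have hF' : birthAt u (s ++ [(p, j)]) (s.length + 1) =
      FA ++ List.replicate p.output.length (s.length + 1) ++ FB := by
    rw [birthAt.eq_2, birthAt_append _ _ _ le_rfl, ← hF, hFAB]
    simp [← hFA, replaceAt_append_cons]
  have hborn : bornNonterminals u (s ++ [(p, j)]) =
      (A.zip FA).filter (fun x => isNonterminal x.1) ++
      (nonterminals p.output).map (fun x => (x, s.length + 1)) ++
      (B.zip FB).filter (fun x => isNonterminal x.1) := by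
    rw [bornNonterminals, hlast, hW', hF', List.zip_append, List.zip_append, List.filter_append,
      List.filter_append, filter_zip_replicate]
    · omega
    · simp only [List.length_append, List.length_replicate]; omega
  have hborn' : bornNonterminals u s = (A.zip FA).filter (fun x => isNonterminal x.1) ++
      (Symbol.nonterminal p.input, b) :: (B.zip FB).filter (fun x => isNonterminal x.1) := by
    rw [bornNonterminals, ← hW, ← hF, hWAB, hFAB, List.zip_append (by omega), List.filter_append]
    simp [isNonterminal]
  have hrest : ((A.zip FA).filter (fun x => isNonterminal x.1) ++
      (B.zip FB).filter (fun x => isNonterminal x.1)).Perm L := by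
    rw [hborn'] at hperm
    exact List.Perm.cons_inv (List.perm_middle.symm.trans hperm)
  have hnew : ∀ n : List (Symbol T N), n.Perm (nonterminals p.output) →
      ∃ L' : List (Symbol T N × ℕ), L'.map Prod.fst = n ++ L.map Prod.fst ∧
        L'.Pairwise (fun x y => y.2 ≤ x.2) ∧ (∀ x ∈ L', x.2 ≤ (s ++ [(p, j)]).length) ∧
        (bornNonterminals u (s ++ [(p, j)])).Perm L' := by
    intro n hn
    refine ⟨n.map (fun x => (x, s.length + 1)) ++ L, by simp [Function.comp_def], ?_, ?_, ?_⟩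
    · rw [List.pairwise_append]
      refine ⟨?_, (List.pairwise_cons.1 hsort).2, ?_⟩
      · rw [List.pairwise_map]
        exact List.pairwise_of_forall (fun _ _ => le_rfl)
      · intro x hx y hy
        obtain ⟨x, -, rfl⟩ := List.mem_map.1 hx
        have := hle y (List.mem_cons_of_mem _ hy)
        simp only
        omega
    · intro x hx
      rw [hlast]
      rcases List.mem_append.1 hx with hx | hx
      · obtain ⟨x, -, rfl⟩ := List.mem_map.1 hx
        exact le_rfl
      · exact (hle x (List.mem_cons_of_mem _ hx)).trans (Nat.le_succ _)
    · rw [hborn]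
      refine List.Perm.trans ?_ ((hn.map _).symm.append hrest)
      rw [List.append_assoc, ← List.append_assoc, ← List.append_assoc]
      exact List.perm_append_comm.append_right _
  have hstack : ∃ L' : List (Symbol T N × ℕ), L'.map Prod.fst = S' ∧
        L'.Pairwise (fun x y => y.2 ≤ x.2) ∧ (∀ x ∈ L', x.2 ≤ (s ++ [(p, j)]).length) ∧
        (bornNonterminals u (s ++ [(p, j)])).Perm L' := by
    rcases hS' with rfl | rfl
    · exact hnew _ (List.Perm.refl _)
    · exact hnew _ (List.reverse_perm _)
  have hlen' : (birthAt u (s ++ [(p, j)]) (s ++ [(p, j)]).length).length =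
      (wordAt u (s ++ [(p, j)]) (s ++ [(p, j)]).length).length := by
    rw [hlast, hW', hF']
    simp only [List.length_append, List.length_replicate]
    omega
  have hcount' : nonterminalCount (wordAt u (s ++ [(p, j)]) (s.length + 1)) ≤ k := by
    refine le_trans (le_of_eq ?_) hk'
    obtain ⟨L', rfl, -, -, hL'⟩ := hstack
    rw [List.length_map, ← hL'.length_eq, length_bornNonterminals hlen', hlast]
  have hget : ∀ {m q i}, (s ++ [(p, j)])[m]? = some (q, i) →
      (m < s.length ∧ s[m]? = some (q, i)) ∨ (m = s.length ∧ q = p ∧ i = j) := by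
    intro m q i hm
    rcases lt_trichotomy m s.length with hlt | rfl | hgt
    · rw [List.getElem?_append_left hlt] at hm
      exact .inl ⟨hlt, hm⟩
    · simp only [List.getElem?_concat_length, Option.some.injEq, Prod.mk.injEq] at hm
      exact .inr ⟨rfl, hm.1.symm, hm.2.symm⟩
    · rw [List.getElem?_eq_none (by simp; omega)] at hm
      cases hm
  have hWj : W[j]? = some (Symbol.nonterminal p.input) := by
    rw [List.getElem?_eq_getElem (by omega), hjW]
  have hFj : F[j]? = some b := by
    rw [List.getElem?_eq_getElem (by omega), hjF]
  refine ⟨j, ?_, ?_, ?_, hlen', hstack, ?_⟩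
  · intro m q i hm
    rcases hget hm with ⟨hlt, hm⟩ | ⟨rfl, rfl, rfl⟩
    · rw [wordAt_append _ _ _ hlt.le]
      exact h.valid m q i hm
    · rw [wordAt_append _ _ _ le_rfl]
      exact ⟨hpG, hWj⟩
  · intro m hm
    rw [hlast] at hm
    rcases Nat.lt_succ_iff_lt_or_eq.1 hm with hlt | rfl
    · rw [wordAt_append _ _ _ hlt.le, wordAt_append _ _ _ (by omega)]
      exact h.index m hlt
    · refine ⟨?_, hcount'⟩
      rw [wordAt_append _ _ _ le_rfl]
      exact hcount.le.trans hk
  · intro m q i hm i' Y hY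
    rcases hget hm with ⟨hlt, hm⟩ | ⟨rfl, rfl, rfl⟩
    · rw [wordAt_append _ _ _ hlt.le] at hY
      rw [birthAt_append _ _ _ hlt.le]
      exact h.depthFirst m q i hm i' Y hY
    · rw [wordAt_append _ _ _ le_rfl, ← hW] at hY
      rw [birthAt_append _ _ _ le_rfl, ← hF, hFj]
      obtain ⟨hi', hY'⟩ := List.getElem?_eq_some_iff.1 hY
      have hi'F : i' < F.length := hlen.symm ▸ hi'
      rw [List.getElem?_eq_getElem hi'F]
      simp only [Option.getD_some]
      have hmem' : ((Symbol.nonterminal Y : Symbol T N), F[i']) ∈ bornNonterminals u s := by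
        refine List.mem_filter.2 ⟨?_, rfl⟩
        rw [List.mem_iff_getElem]
        refine ⟨i', by rw [List.length_zip]; exact lt_min hi' hi'F, ?_⟩
        rw [List.getElem_zip]
        exact Prod.ext hY' rfl
      rcases List.mem_cons.1 (hperm.mem_iff.1 hmem') with e | hL
      · exact (congrArg Prod.snd e).le
      · exact (List.pairwise_cons.1 hsort).1 _ hL
  · rw [hlast, hW', List.map_append, effect_append]
    have he := h.effect_perm
    rw [← hW, hWAB] at he
    simp only [terminals_append, terminals_cons_nonterminal, List.map_cons, List.map_nil,
      effect_cons, effect_nil, List.append_nil, List.append_assoc] at he ⊢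
    exact (List.perm_append_comm.append_left _).trans
      ((List.append_assoc _ _ _).symm ▸ he.append_right _)

lemma Realizes.run {G : Grammar N T} {k : ℕ} {X : N} :
    ∀ {γ : List (Production N T)} {s : List (Production N T × ℕ)} {S S' : List (Symbol T N)},
      Realizes G k X s S → Run (BoundedStackStep G k) S γ S' →
      ∃ s', s'.map Prod.fst = s.map Prod.fst ++ γ ∧ Realizes G k X s' S'
  | [], s, _, _, h, hr => ⟨s, by simp, hr ▸ h⟩
  | p :: γ, s, S, S', h, ⟨S₁, hp, hr⟩ => by
    obtain ⟨j, hj⟩ := h.step hp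
    obtain ⟨s', hs', h'⟩ := hj.run hr
    exact ⟨s', by simp [hs'], h'⟩

/-- A run of the stack automaton from `X` to the empty stack is the control word of a depth-first
derivation of bounded index. -/
theorem Run.exists_derivation {G : Grammar N T} {k : ℕ} {X : N} {γ : List (Production N T)}
    (h : Run (BoundedStackStep G k) [.nonterminal X] γ []) :
    γ ∈ G.dfControlSet k X ∧ ∃ s w, s.map Prod.fst = γ ∧ G.IsDerivation X s w ∧
      w.Perm (effect γ) := by
  have h0 : Realizes G k X [] [.nonterminal X] := by
    refine ⟨by simp, by simp [IsIndexBounded], by simp [IsDepthFirst], rfl,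
      ⟨[(.nonterminal X, 0)], rfl, by simp, by simp, ?_⟩, by simp [wordAt]⟩
    simp [bornNonterminals, wordAt, birthAt, isNonterminal]
  obtain ⟨s, rfl, hs⟩ := h0.run h
  obtain ⟨w, hw⟩ := exists_map_terminal_of_nonterminalCount_eq_zero hs.nonterminalCount_eq
  have hd : G.IsDerivation X s w := ⟨hs.valid, hw⟩
  refine ⟨⟨s, w, rfl, hd, hs.index, hs.depthFirst⟩, s, w, rfl, hd, ?_⟩
  have := hs.effect_perm
  rwa [hw, terminals_map_terminal] at this

lemma Grammar.dfControlSet_mono {G : Grammar N T} {k l : ℕ} (h : k ≤ l) (X : N) :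
    G.dfControlSet k X ⊆ G.dfControlSet l X := by
  rintro γ ⟨s, w, hs, hd, hk, hdf⟩
  exact ⟨s, w, hs, hd, fun m hm => ⟨(hk m hm).1.trans h, (hk m hm).2.trans h⟩, hdf⟩

end Stack

/-! ### Letter-bounded words -/

section LetterBounded

variable {α : Type u}

lemma mem_lang_letterExpr_cons {x : α} {a : List α} {w : List α} :
    w ∈ (letterExpr (x :: a)).lang ↔
      ∃ n w', w = List.replicate n x ++ w' ∧ w' ∈ (letterExpr a).lang := by
  have hstar : ∀ v : List α, v ∈ (KStar.kstar ({[x]} : Language α)) ↔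
      ∃ n, v = List.replicate n x := by
    intro v
    rw [Language.mem_kstar]
    constructor
    · rintro ⟨L, rfl, hL⟩
      refine ⟨L.length, ?_⟩
      induction L with
      | nil => rfl
      | cons l L ih =>
        have h1 : l = [x] := hL l (by simp)
        rw [List.flatten_cons, ih fun y hy => hL y (List.mem_cons_of_mem _ hy), h1]
        rfl
    · rintro ⟨n, rfl⟩
      refine ⟨List.replicate n [x], ?_, fun y hy => List.eq_of_mem_replicate hy⟩
      induction n with
      | zero => rfl
      | succ n ih => rw [List.replicate_succ, List.replicate_succ, List.flatten_cons, ← ih]; rfl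
  have hl : (letterExpr (x :: a)).lang =
      KStar.kstar ({[x]} : Language α) * (letterExpr a).lang := by
    simp [BoundedExpr.lang, letterExpr]
  rw [hl, Language.mem_mul]
  constructor
  · rintro ⟨v, hv, w', hw', rfl⟩
    obtain ⟨n, rfl⟩ := (hstar v).1 hv
    exact ⟨n, w', rfl, hw'⟩
  · rintro ⟨n, w', rfl, hw'⟩
    exact ⟨_, (hstar _).2 ⟨n, rfl⟩, w', hw', rfl⟩

lemma mem_lang_letterExpr_nil {w : List α} : w ∈ (letterExpr ([] : List α)).lang ↔ w = [] := by
  simp [BoundedExpr.lang, letterExpr, Language.mem_one]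

lemma mem_of_mem_lang_letterExpr {a : List α} :
    ∀ {w : List α}, w ∈ (letterExpr a).lang → ∀ x ∈ w, x ∈ a := by
  induction a with
  | nil =>
    intro w hw
    rw [mem_lang_letterExpr_nil] at hw
    simp [hw]
  | cons y a ih =>
    intro w hw x hx
    obtain ⟨n, w', rfl, hw'⟩ := mem_lang_letterExpr_cons.1 hw
    rcases List.mem_append.1 hx with hx | hx
    · rw [List.eq_of_mem_replicate hx]
      exact List.mem_cons_self
    · exact List.mem_cons_of_mem _ (ih hw' x hx)

lemma mem_lang_letterExpr_eraseIdx {a : List α} :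
    ∀ {w : List α} {i : ℕ} (hi : i < a.length), w ∈ (letterExpr a).lang → a[i] ∉ w →
      w ∈ (letterExpr (a.eraseIdx i)).lang := by
  induction a with
  | nil => intro w i hi; simp at hi
  | cons y a ih =>
    intro w i hi hw hn
    obtain ⟨n, w', rfl, hw'⟩ := mem_lang_letterExpr_cons.1 hw
    cases i with
    | zero =>
      cases n with
      | zero => simpa using hw'
      | succ n => simp [List.replicate_succ] at hn
    | succ i =>
      rw [List.eraseIdx_cons_succ, mem_lang_letterExpr_cons]
      refine ⟨n, w', rfl, ih (by simpa using hi) hw' fun h => hn ?_⟩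
      simp only [List.getElem_cons_succ]
      exact List.mem_append_right _ h

/-- Every letter of a minimal strict letter-bounded expression occurs in the language. -/
lemma IsMinimalStrict.exists_mem {a : List α} {L : Language α} (h : IsMinimalStrict a L)
    {x : α} (hx : x ∈ a) : ∃ w ∈ L, x ∈ w := by
  obtain ⟨i, hi, rfl⟩ := List.mem_iff_getElem.1 hx
  by_contra! hn
  exact h.2.2 i hi fun w hw => mem_lang_letterExpr_eraseIdx hi (h.2.1 hw) (hn w hw)

variable [DecidableEq α]

lemma pairwise_of_mem_lang_letterExpr {a : List α} (ha : a.Nodup) :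
    ∀ {w : List α}, w ∈ (letterExpr a).lang →
      w.Pairwise fun x y => a.idxOf x ≤ a.idxOf y := by
  induction a with
  | nil =>
    intro w hw
    rw [mem_lang_letterExpr_nil] at hw
    simp [hw]
  | cons y a ih =>
    intro w hw
    obtain ⟨n, w', rfl, hw'⟩ := mem_lang_letterExpr_cons.1 hw
    obtain ⟨hy, ha⟩ := List.nodup_cons.1 ha
    rw [List.pairwise_append]
    refine ⟨List.pairwise_replicate.2 (.inr le_rfl), ?_, ?_⟩
    · refine (ih ha hw').imp_of_mem fun {x z} hx hz h => ?_
      have hx := mem_of_mem_lang_letterExpr hw' x hx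
      have hz := mem_of_mem_lang_letterExpr hw' z hz
      rw [List.idxOf_cons_ne _ (by grind), List.idxOf_cons_ne _ (by grind)]
      omega
    · intro x hx z _
      rw [List.eq_of_mem_replicate hx, List.idxOf_cons_self]
      exact Nat.zero_le _

/-- A word of a strict letter-bounded language is determined by its letter counts. -/
lemma eq_of_perm_of_mem_lang_letterExpr {a : List α} (ha : a.Nodup) {w w' : List α}
    (hw : w ∈ (letterExpr a).lang) (hw' : w' ∈ (letterExpr a).lang) (h : w.Perm w') : w = w' := by
  refine h.eq_of_pairwise (le := fun x y => a.idxOf x ≤ a.idxOf y) ?_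
    (pairwise_of_mem_lang_letterExpr ha hw) (pairwise_of_mem_lang_letterExpr ha hw')
  intro x y hx hy h₁ h₂
  exact (List.idxOf_inj (mem_of_mem_lang_letterExpr hw x hx)).1 (le_antisymm h₁ h₂)

end LetterBounded

/-! ### Cutting control words into pieces that produce at most two letters -/

section Pieces

variable {N : Type u} {T : Type v}

/-- All terminals produced by the control word `γ` have index `i` or `j`, the indices being given
by `f`. -/
def UsesOnly (f : T → ℕ) (i j : ℕ) (γ : List (Production N T)) : Prop :=
  ∀ x ∈ effect γ, f x = i ∨ f x = j

lemma UsesOnly.append {f : T → ℕ} {i j : ℕ} {γ δ : List (Production N T)}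
    (h : UsesOnly f i j γ) (h' : UsesOnly f i j δ) : UsesOnly f i j (γ ++ δ) := by
  intro x hx
  rw [effect_append] at hx
  rcases List.mem_append.1 hx with hx | hx
  exacts [h x hx, h' x hx]

lemma usesOnly_nil (f : T → ℕ) (i j : ℕ) : UsesOnly f i j ([] : List (Production N T)) := by
  simp [UsesOnly]

lemma exists_usesOnly_singleton (f : T → ℕ) {p : Production N T} (hp : terminalCount p.output ≤ 2) :
    ∃ i j, UsesOnly f i j [p] := by
  rw [← length_terminals] at hp
  unfold UsesOnly
  simp only [effect_cons, effect_nil, List.append_nil]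
  match h : terminals p.output with
  | [] => simp
  | [x] => exact ⟨f x, 0, by simp⟩
  | [x, y] => exact ⟨f x, f y, by simp⟩
  | x :: y :: z :: l => simp [h] at hp

/-- `γ` can be cut into few pieces producing at most two letters each, where the first and the last
piece only produce letters of index `s` or `t`.  The number of the inner pieces is at most
`10 * (t - s) - 5`, which is `0` if `s = t`; the bound is chosen so that it survives the addition of
five pieces at a node whose subtrees span shorter intervals. -/
def Cuttable (f : T → ℕ) (s t : ℕ) (γ : List (Production N T)) : Prop :=
  ∃ (A : List (Production N T)) (Bs : List (List (Production N T))) (A' : List (Production N T)),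
    γ = A ++ Bs.flatten ++ A' ∧ UsesOnly f s t A ∧ UsesOnly f s t A' ∧
    (∀ B ∈ Bs, ∃ i j, UsesOnly f i j B) ∧ Bs.length ≤ 10 * (t - s) - 5

lemma UsesOnly.cuttable {f : T → ℕ} {s t : ℕ} {γ : List (Production N T)}
    (h : UsesOnly f s t γ) : Cuttable f s t γ :=
  ⟨γ, [], [], by simp, h, usesOnly_nil _ _ _, by simp, by simp⟩

lemma Cuttable.append_right {f : T → ℕ} {s t : ℕ} {γ δ : List (Production N T)}
    (h : Cuttable f s t γ) (h' : UsesOnly f s t δ) : Cuttable f s t (γ ++ δ) := by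
  obtain ⟨A, Bs, A', rfl, hA, hA', hB, hl⟩ := h
  exact ⟨A, Bs, A' ++ δ, by simp, hA, hA'.append h', hB, hl⟩

lemma Cuttable.append_left {f : T → ℕ} {s t : ℕ} {γ δ : List (Production N T)}
    (h : Cuttable f s t γ) (h' : UsesOnly f s t δ) : Cuttable f s t (δ ++ γ) := by
  obtain ⟨A, Bs, A', rfl, hA, hA', hB, hl⟩ := h
  exact ⟨δ ++ A, Bs, A', by simp, h'.append hA, hA', hB, hl⟩

/-- A production both of whose subtrees span strictly shorter intervals of letters. -/
lemma Cuttable.pivot {f : T → ℕ} {s t s₁ t₁ s₂ t₂ : ℕ} {p : Production N T}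
    {γ δ : List (Production N T)} (hp : terminalCount p.output ≤ 2)
    (h₁ : Cuttable f s₁ t₁ γ) (h₂ : Cuttable f s₂ t₂ δ) (hl₁ : t₁ - s₁ < t - s)
    (hl₂ : t₂ - s₂ < t - s) (hl : (t₁ - s₁) + (t₂ - s₂) ≤ t - s) :
    Cuttable f s t (p :: (γ ++ δ)) := by
  obtain ⟨A₁, Bs₁, A₁', rfl, hA₁, hA₁', hB₁, hb₁⟩ := h₁
  obtain ⟨A₂, Bs₂, A₂', rfl, hA₂, hA₂', hB₂, hb₂⟩ := h₂
  refine ⟨[], [p] :: A₁ :: Bs₁ ++ A₁' :: A₂ :: Bs₂ ++ [A₂'], [], by simp, usesOnly_nil _ _ _,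
    usesOnly_nil _ _ _, ?_, ?_⟩
  · intro B hB
    simp only [List.cons_append, List.append_assoc, List.mem_cons, List.mem_append,
      List.not_mem_nil, or_false] at hB
    rcases hB with rfl | rfl | hB | rfl | rfl | hB | rfl
    exacts [exists_usesOnly_singleton f hp, ⟨_, _, hA₁⟩, hB₁ B hB, ⟨_, _, hA₁'⟩, ⟨_, _, hA₂⟩,
      hB₂ B hB, ⟨_, _, hA₂'⟩]
  · simp only [List.length_append, List.length_cons, List.length_nil]
    omega

lemma Trav.usesOnly {G : Grammar N T} {k : ℕ} {X : N} {w : List T} {γ : List (Production N T)}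
    (h : Trav G k X w γ) {f : T → ℕ} {i j : ℕ} (hw : ∀ x ∈ w, f x = i ∨ f x = j) :
    UsesOnly f i j γ :=
  fun x hx => hw x (h.effect_perm.mem_iff.1 hx)

/-- If the two subtrees of a node yield sorted words `y`, `z` within `[s, t]` and neither of them
contains letters of both indices `s` and `t`, then they span shorter intervals, which share at
most one index. -/
lemma exists_shorter_intervals {f : T → ℕ} {s t : ℕ} (hst : s < t) {y z : List T}
    (hy : ∀ x ∈ y, s ≤ f x ∧ f x ≤ t) (hz : ∀ x ∈ z, s ≤ f x ∧ f x ≤ t)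
    (hyz : ∀ x ∈ y, ∀ x' ∈ z, f x ≤ f x')
    (hy' : ¬ ((∃ x ∈ y, f x = s) ∧ ∃ x ∈ y, f x = t))
    (hz' : ¬ ((∃ x ∈ z, f x = s) ∧ ∃ x ∈ z, f x = t)) :
    ∃ s₁ t₁ s₂ t₂, (∀ x ∈ y, s₁ ≤ f x ∧ f x ≤ t₁) ∧ (∀ x ∈ z, s₂ ≤ f x ∧ f x ≤ t₂) ∧
      s₁ ≤ t₁ ∧ s₂ ≤ t₂ ∧ t₁ - s₁ < t - s ∧ t₂ - s₂ < t - s ∧ (t₁ - s₁) + (t₂ - s₂) ≤ t - s := by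
  have shrink : ∀ {l : List T}, (∀ x ∈ l, s ≤ f x ∧ f x ≤ t) →
      ¬ ((∃ x ∈ l, f x = s) ∧ ∃ x ∈ l, f x = t) →
      ∃ s' t', (∀ x ∈ l, s' ≤ f x ∧ f x ≤ t') ∧ s' ≤ t' ∧ t' - s' + 1 ≤ t - s := by
    intro l hl hl'
    by_cases h : ∃ x ∈ l, f x = s
    · refine ⟨s, t - 1, fun x hx => ⟨(hl x hx).1, ?_⟩, by omega, by omega⟩
      have := (hl x hx).2
      have : f x ≠ t := fun e => hl' ⟨h, x, hx, e⟩
      omega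
    · refine ⟨s + 1, t, fun x hx => ⟨?_, (hl x hx).2⟩, by omega, by omega⟩
      have := (hl x hx).1
      have : f x ≠ s := fun e => h ⟨x, hx, e⟩
      omega
  by_cases hsplit : ∃ x ∈ y, s < f x
  · by_cases hsplit' : ∃ x ∈ z, f x < t
    · -- any index `r` separating `y` from `z` satisfies `s < r < t`
      obtain ⟨x', hx', h'⟩ := hsplit'
      obtain ⟨x, hx, h⟩ := hsplit
      classical
      obtain ⟨m, hm, hmax⟩ : ∃ m ∈ y, ∀ x ∈ y, f x ≤ f m := by
        obtain ⟨m, hm, hmax⟩ := y.toFinset.exists_max_image f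
          ⟨x, by simpa using hx⟩
        exact ⟨m, by simpa using hm, fun x hx => hmax x (by simpa using hx)⟩
      have := hmax x hx
      have := hyz m hm x' hx'
      exact ⟨s, f m, f m, t, fun x hx => ⟨(hy x hx).1, hmax x hx⟩,
        fun x hx => ⟨hyz m hm x hx, (hz x hx).2⟩, by omega, by omega, by omega, by omega, by omega⟩
    · push Not at hsplit'
      obtain ⟨s', t', h, hle, hlt⟩ := shrink hy hy'
      exact ⟨s', t', t, t, h, fun x hx => ⟨hsplit' x hx, (hz x hx).2⟩, hle, le_rfl, by omega,
        by omega, by omega⟩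
  · push Not at hsplit
    obtain ⟨s', t', h, hle, hlt⟩ := shrink hz hz'
    exact ⟨s, s, s', t', fun x hx => ⟨(hy x hx).1, hsplit x hx⟩, h, le_rfl, hle, by omega,
      by omega, by omega⟩

/-- Traversals of sorted words can be cut into few pieces producing at most two letters each.
As long as some subtree contains the first and the last letter of the interval `[s, t]`, all the
rest of the tree only produces these two letters. -/
theorem Trav.cuttable {G : Grammar N T} (hG : ∀ p ∈ G.productions, terminalCount p.output ≤ 2)
    {f : T → ℕ} {k : ℕ} {X : N} {w : List T} {γ : List (Production N T)} (h : Trav G k X w γ) :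
    ∀ {s t : ℕ}, s ≤ t → (∀ x ∈ w, s ≤ f x ∧ f x ≤ t) →
      (w.Pairwise fun x y => f x ≤ f y) → Cuttable f s t γ := by
  have node : ∀ {p : Production N T} {u y v z x : List T} {γ δ ε : List (Production N T)} {s t : ℕ},
      p ∈ G.productions → terminals p.output = u ++ v ++ x →
      (effect γ).Perm y → (effect δ).Perm z → (ε = γ ++ δ ∨ ε = δ ++ γ) →
      (∀ {s t : ℕ}, s ≤ t → (∀ x ∈ y, s ≤ f x ∧ f x ≤ t) →
        (y.Pairwise fun x y => f x ≤ f y) → Cuttable f s t γ) →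
      (∀ {s t : ℕ}, s ≤ t → (∀ x ∈ z, s ≤ f x ∧ f x ≤ t) →
        (z.Pairwise fun x y => f x ≤ f y) → Cuttable f s t δ) →
      s ≤ t → (∀ a ∈ u ++ y ++ v ++ z ++ x, s ≤ f a ∧ f a ≤ t) →
      ((u ++ y ++ v ++ z ++ x).Pairwise fun x y => f x ≤ f y) → Cuttable f s t (p :: ε) := by
    intro p u y v z x γ δ ε s t hp ho hγ hδ hε ihγ ihδ hst hw hsort
    have hwy : ∀ a ∈ y, s ≤ f a ∧ f a ≤ t := fun a ha => hw a (by simp [ha])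
    have hwz : ∀ a ∈ z, s ≤ f a ∧ f a ≤ t := fun a ha => hw a (by simp [ha])
    have hwu : ∀ a ∈ u, s ≤ f a ∧ f a ≤ t := fun a ha => hw a (by simp [ha])
    have hwv : ∀ a ∈ v, s ≤ f a ∧ f a ≤ t := fun a ha => hw a (by simp [ha])
    have hwx : ∀ a ∈ x, s ≤ f a ∧ f a ≤ t := fun a ha => hw a (by simp [ha])
    simp only [List.pairwise_append, List.mem_append] at hsort
    obtain ⟨⟨⟨⟨-, hy, huy⟩, -, hv⟩, hz, hz'⟩, -, hx⟩ := hsort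
    have usesp : (∀ a ∈ u ++ v ++ x, f a = s ∨ f a = t) → UsesOnly f s t [p] := by
      intro h a ha
      simp only [effect_cons, effect_nil, List.append_nil, ho] at ha
      exact h a ha
    rcases hst.eq_or_lt with rfl | hst
    · refine UsesOnly.cuttable (UsesOnly.append (γ := [p]) (usesp fun a ha => ?_) ?_)
      · simp only [List.mem_append] at ha
        grind
      · have h1 : UsesOnly f s s γ := fun a ha => by
          have := hwy a (hγ.mem_iff.1 ha)
          omega
        have h2 : UsesOnly f s s δ := fun a ha => by
          have := hwz a (hδ.mem_iff.1 ha)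
          omega
        rcases hε with rfl | rfl
        exacts [h1.append h2, h2.append h1]
    by_cases hy' : (∃ a ∈ y, f a = s) ∧ ∃ a ∈ y, f a = t
    · obtain ⟨⟨a₁, ha₁, e₁⟩, a₂, ha₂, e₂⟩ := hy'
      refine Cuttable.append_left (δ := [p]) ?_ (usesp fun a ha => ?_)
      · have h1 := ihγ hst.le hwy hy
        have h2 : UsesOnly f s t δ := fun a ha => by
          have ha := hδ.mem_iff.1 ha
          have := hz' a₂ (by simp [ha₂]) a ha
          have := hwz a ha
          omega
        rcases hε with rfl | rfl
        exacts [h1.append_right h2, h1.append_left h2]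
      · simp only [List.mem_append] at ha
        rcases ha with (ha | ha) | ha
        · have := huy a ha a₁ ha₁
          have := hwu a ha
          omega
        · have := hv a₂ (by simp [ha₂]) a ha
          have := hwv a ha
          omega
        · have := hx a₂ (by simp [ha₂]) a ha
          have := hwx a ha
          omega
    by_cases hz'' : (∃ a ∈ z, f a = s) ∧ ∃ a ∈ z, f a = t
    · obtain ⟨⟨a₁, ha₁, e₁⟩, a₂, ha₂, e₂⟩ := hz''
      refine Cuttable.append_left (δ := [p]) ?_ (usesp fun a ha => ?_)
      · have h1 := ihδ hst.le hwz hz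
        have h2 : UsesOnly f s t γ := fun a ha => by
          have ha := hγ.mem_iff.1 ha
          have := hz' a (by simp [ha]) a₁ ha₁
          have := hwy a ha
          omega
        rcases hε with rfl | rfl
        exacts [h1.append_left h2, h1.append_right h2]
      · simp only [List.mem_append] at ha
        rcases ha with (ha | ha) | ha
        · have := hz' a (by simp [ha]) a₁ ha₁
          have := hwu a ha
          omega
        · have := hz' a (by simp [ha]) a₁ ha₁
          have := hwv a ha
          omega
        · have := hx a₂ (by simp [ha₂]) a ha
          have := hwx a ha
          omega
    obtain ⟨s₁, t₁, s₂, t₂, h₁, h₂, hl₁, hl₂, hd₁, hd₂, hd⟩ := exists_shorter_intervals hst hwy hwz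
      (fun a ha b hb => hz' a (by simp [ha]) b hb) hy' hz''
    rcases hε with rfl | rfl
    · exact (ihγ hl₁ h₁ hy).pivot (hG p hp) (ihδ hl₂ h₂ hz) hd₁ hd₂ hd
    · exact (ihδ hl₂ h₂ hz).pivot (hG p hp) (ihγ hl₁ h₁ hy) hd₂ hd₁ (by omega)
  have nothing : ∀ {s t : ℕ}, s ≤ t → (∀ x ∈ ([] : List T), s ≤ f x ∧ f x ≤ t) →
      (([] : List T).Pairwise fun x y => f x ≤ f y) →
      Cuttable f s t ([] : List (Production N T)) :=
    fun _ _ _ => (usesOnly_nil _ _ _).cuttable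
  induction h with
  | @leaf k p u hp ho =>
    intro s t hst hw hs
    exact node (u := u) (γ := []) (δ := []) (ε := []) (y := []) (z := []) (v := []) (x := []) hp
      (by simp [ho]) (by simp) (by simp) (by simp) nothing nothing hst (by simpa using hw)
      (by simpa using hs)
  | @one k p Y γ u w v hp ho h ih =>
    intro s t hst hw hs
    exact node (u := u) (γ := γ) (δ := []) (ε := γ) (y := w) (z := []) (v := v) (x := []) hp
      (by simp [ho]) h.effect_perm (by simp) (by simp) ih nothing hst (by simpa using hw)
      (by simpa using hs)
  | leftFirst hp ho h h' ih ih' =>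
    intro s t hst hw hs
    exact node hp (by simp [ho]) h.effect_perm h'.effect_perm (.inl rfl) ih ih' hst hw hs
  | rightFirst hp ho h h' ih ih' =>
    intro s t hst hw hs
    exact node hp (by simp [ho]) h.effect_perm h'.effect_perm (.inr rfl) ih ih' hst hw hs

end Pieces

/-! ### Bounded sublanguages of regular languages -/

section BoundedSublanguage

variable {Q Δ : Type*}

/-- `l` is the list of the labels and target states of a path from `q` to `r`. -/
def LabeledPath (δ : Q → Δ → Q → Prop) : Q → List (Δ × Q) → Q → Prop
  | q, [], r => q = r
  | q, x :: l, r => δ q x.1 x.2 ∧ LabeledPath δ x.2 l r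

lemma LabeledPath.append_iff {δ : Q → Δ → Q → Prop} {l₁ l₂ : List (Δ × Q)} :
    ∀ {q r : Q}, LabeledPath δ q (l₁ ++ l₂) r ↔
      ∃ s, LabeledPath δ q l₁ s ∧ LabeledPath δ s l₂ r := by
  induction l₁ with
  | nil => simp [LabeledPath]
  | cons p l₁ ih =>
    intro q r
    simp only [List.cons_append, LabeledPath, ih]
    grind

lemma LabeledPath.append {δ : Q → Δ → Q → Prop} {l₁ l₂ : List (Δ × Q)} {q s r : Q}
    (h₁ : LabeledPath δ q l₁ s) (h₂ : LabeledPath δ s l₂ r) : LabeledPath δ q (l₁ ++ l₂) r :=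
  LabeledPath.append_iff.2 ⟨s, h₁, h₂⟩

lemma LabeledPath.run {δ : Q → Δ → Q → Prop} : ∀ {l : List (Δ × Q)} {q r : Q}, LabeledPath δ q l r →
    Run δ q (l.map Prod.fst) r
  | [], _, _, h => h
  | x :: _, _, _, h => ⟨x.2, h.1, h.2.run⟩

lemma Run.exists_path {δ : Q → Δ → Q → Prop} : ∀ {γ : List Δ} {q r : Q}, Run δ q γ r →
    ∃ l, LabeledPath δ q l r ∧ l.map Prod.fst = γ
  | [], _, _, h => ⟨[], h, rfl⟩
  | p :: _, _, _, ⟨s, hs, h⟩ => by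
    obtain ⟨l, hl, rfl⟩ := Run.exists_path h
    exact ⟨(p, s) :: l, ⟨hs, hl⟩, rfl⟩

lemma LabeledPath.target_mem {δ : Q → Δ → Q → Prop} :
    ∀ {l : List (Δ × Q)} {q r : Q}, LabeledPath δ q l r → r ∈ q :: l.map Prod.snd
  | [], _, _, h => by
    obtain rfl : _ = _ := h
    simp
  | x :: _, _, _, h => List.mem_cons_of_mem _ h.2.target_mem

lemma LabeledPath.mem_of_mem {δ : Q → Δ → Q → Prop} {St : Finset Q}
    (hδ : ∀ q p r, δ q p r → r ∈ St) :
    ∀ {l : List (Δ × Q)} {q r : Q}, LabeledPath δ q l r → ∀ x ∈ l.map Prod.snd, x ∈ St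
  | [], _, _, _ => by simp
  | y :: l, q, r, h => by
    intro x hx
    rcases List.mem_cons.1 hx with rfl | hx
    · exact hδ _ _ _ h.1
    · exact h.2.mem_of_mem hδ x hx

lemma LabeledPath.exists_prefix_of_mem {δ : Q → Δ → Q → Prop} {l : List (Δ × Q)} {q r s : Q}
    (h : LabeledPath δ q l r) (hs : s ∈ l.map Prod.snd) :
    ∃ α η, l = α ++ η ∧ α ≠ [] ∧ s ∈ α.map Prod.snd ∧ LabeledPath δ q α s ∧ LabeledPath δ s η r := by
  obtain ⟨⟨p, s⟩, hx, rfl⟩ := List.mem_map.1 hs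
  obtain ⟨α, η, rfl⟩ := List.append_of_mem hx
  obtain ⟨t, ht, ht'⟩ := LabeledPath.append_iff.1 h
  exact ⟨α ++ [(p, s)], η, by simp, by simp, by simp, ht.append ⟨ht'.1, rfl⟩, ht'.2⟩

/-- A path that visits a state twice contains a cycle. -/
lemma LabeledPath.exists_cycle {δ : Q → Δ → Q → Prop} :
    ∀ {l : List (Δ × Q)} {q r : Q}, LabeledPath δ q l r → ¬ (q :: l.map Prod.snd).Nodup →
      ∃ α β η s, l = α ++ β ++ η ∧ β ≠ [] ∧ LabeledPath δ q α s ∧ LabeledPath δ s β s ∧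
        LabeledPath δ s η r
  | [], _, _, _, h => by simp at h
  | x :: l, q, r, h, hn => by
    by_cases hq : q ∈ (x :: l).map Prod.snd
    · obtain ⟨β, η, e, hβ, -, h₁, h₂⟩ := h.exists_prefix_of_mem hq
      exact ⟨[], β, η, q, e, hβ, rfl, h₁, h₂⟩
    · have hn' : ¬ (x.2 :: l.map Prod.snd).Nodup := fun h' => hn (List.nodup_cons.2 ⟨hq, h'⟩)
      obtain ⟨α, β, η, s, rfl, hβ, h₁, h₂, h₃⟩ := h.2.exists_cycle hn'
      exact ⟨x :: α, β, η, s, rfl, hβ, ⟨h.1, h₁⟩, h₂, h₃⟩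

/-- A long path contains a short cycle whose states all occur earlier on the path (or in the set
`F` of states that count as seen): among any `|St|` consecutive steps either some state is new,
or a state is repeated. -/
lemma LabeledPath.exists_removable [DecidableEq Q] {δ : Q → Δ → Q → Prop} {St : Finset Q}
    (hδ : ∀ q p r, δ q p r → r ∈ St) :
    ∀ {n : ℕ} {F : Finset Q} {l : List (Δ × Q)} {q r : Q}, F ⊆ St → q ∈ F →
      St.card ≤ F.card + n → LabeledPath δ q l r →
      l.length ≤ (n + 1) * St.card ∨
      ∃ α β η s, l = α ++ β ++ η ∧ β ≠ [] ∧ β.length ≤ St.card ∧ LabeledPath δ q α s ∧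
        LabeledPath δ s β s ∧ LabeledPath δ s η r ∧ ∀ x ∈ β.map Prod.snd, x ∈ F ∨ x ∈ α.map Prod.snd := by
  intro n
  induction n with
  | zero =>
    intro F l q r hF hq hn h
    obtain rfl : F = St := Finset.eq_of_subset_of_card_le hF (by simpa using hn)
    rcases le_or_gt l.length F.card with hl | hl
    · exact .inl (by simpa using hl)
    right
    rw [← List.take_append_drop F.card l] at h
    obtain ⟨t, h₁, h₂⟩ := LabeledPath.append_iff.1 h
    have hnd : ¬ (q :: (l.take F.card).map Prod.snd).Nodup := by
      intro hnd
      have := Finset.card_le_card (s := (q :: (l.take F.card).map Prod.snd).toFinset) (t := F) ?_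
      · rw [List.toFinset_card_of_nodup hnd] at this
        simp at this
        omega
      · intro x hx
        rcases List.mem_cons.1 (List.mem_toFinset.1 hx) with rfl | hx
        exacts [hq, h₁.mem_of_mem hδ x hx]
    obtain ⟨α, β, η, s, e, hβ, hα', hβ', hη'⟩ := h₁.exists_cycle hnd
    refine ⟨α, β, η ++ l.drop F.card, s, ?_, hβ, ?_, hα', hβ', hη'.append h₂,
      fun x hx => .inl (hβ'.mem_of_mem hδ x hx)⟩
    · rw [← List.append_assoc, ← e, List.take_append_drop]
    · have := congrArg List.length e
      simp at this
      omega
  | succ n ih =>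
    intro F l q r hF hq hn h
    rcases le_or_gt l.length St.card with hl | hl
    · exact .inl (hl.trans (Nat.le_mul_of_pos_left _ (by omega)))
    have htake : (l.take St.card).length = St.card := by simp; omega
    have h' := h
    rw [← List.take_append_drop St.card l] at h'
    obtain ⟨t, h₁, h₂⟩ := LabeledPath.append_iff.1 h'
    by_cases hall : ∀ x ∈ (l.take St.card).map Prod.snd, x ∈ F
    · right
      have hnd : ¬ (q :: (l.take St.card).map Prod.snd).Nodup := by
        intro hnd
        have := Finset.card_le_card (s := (q :: (l.take St.card).map Prod.snd).toFinset) (t := St) ?_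
        · rw [List.toFinset_card_of_nodup hnd, List.length_cons, List.length_map, htake] at this
          omega
        · intro x hx
          rcases List.mem_cons.1 (List.mem_toFinset.1 hx) with rfl | hx
          exacts [hF hq, hF (hall x hx)]
      obtain ⟨α, β, η, s, e, hβ, hα', hβ', hη'⟩ := h₁.exists_cycle hnd
      refine ⟨α, β, η ++ l.drop St.card, s, ?_, hβ, ?_, hα', hβ', hη'.append h₂,
        fun x hx => .inl (hall x ?_)⟩
      · rw [← List.append_assoc, ← e, List.take_append_drop]
      · have := congrArg List.length e
        simp at this
        omega
      · rw [e]
        simp only [List.map_append, List.mem_append]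
        exact .inl (.inr hx)
    · push Not at hall
      obtain ⟨x, hx, hxF⟩ := hall
      obtain ⟨α₀, η₀, e, -, hxα, hα₀, hη₀⟩ := h₁.exists_prefix_of_mem hx
      have hxSt : x ∈ St := h₁.mem_of_mem hδ x hx
      have hl' : l = α₀ ++ (η₀ ++ l.drop St.card) := by
        rw [← List.append_assoc, ← e, List.take_append_drop]
      have hα₀l : α₀.length ≤ St.card := by
        have := congrArg List.length e
        rw [htake, List.length_append] at this
        omega
      rcases ih (F := insert x F) (Finset.insert_subset hxSt hF) (Finset.mem_insert_self _ _)
        (by rw [Finset.card_insert_of_notMem hxF]; omega) (hη₀.append h₂) with hlen | hcyc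
      · left
        rw [hl', List.length_append]
        linarith [add_mul (n + 1) 1 St.card]
      · right
        obtain ⟨α, β, η, s, e', hβ, hβl, hα', hβ', hη', hmem⟩ := hcyc
        refine ⟨α₀ ++ α, β, η, s, ?_, hβ, hβl, hα₀.append hα', hβ', hη', fun y hy => ?_⟩
        · conv_lhs => rw [hl', e']
          simp
        · rcases hmem y hy with hy | hy
          · rcases Finset.mem_insert.1 hy with rfl | hy
            · exact .inr (by simp only [List.map_append, List.mem_append]; exact .inl hxα)
            · exact .inl hy
          · exact .inr (by simp only [List.map_append, List.mem_append]; exact .inr hy)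

variable {M : Type*} [AddCommMonoid M]

/-- The sum of the weights `e` of the letters of a word. -/
def weight (e : Δ → M) (γ : List Δ) : M := (γ.map e).sum

@[simp] lemma weight_nil (e : Δ → M) : weight e [] = 0 := rfl

@[simp] lemma weight_cons (e : Δ → M) (p : Δ) (γ : List Δ) :
    weight e (p :: γ) = e p + weight e γ := by
  simp [weight]

@[simp] lemma weight_append (e : Δ → M) (γ γ' : List Δ) :
    weight e (γ ++ γ') = weight e γ + weight e γ' := by
  simp [weight]

/-- Every path is, up to the order of its steps, a short path together with short cycles at
states of this short path. -/
lemma LabeledPath.exists_skeleton [DecidableEq Q] {δ : Q → Δ → Q → Prop} {St : Finset Q}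
    (hδ : ∀ q p r, δ q p r → r ∈ St) (e : Δ → M) :
    ∀ {n : ℕ} {l : List (Δ × Q)} {q r : Q}, l.length = n → q ∈ St → LabeledPath δ q l r →
      ∃ (σ : List (Δ × Q)) (D : List (Q × List (Δ × Q))),
        LabeledPath δ q σ r ∧ σ.length ≤ St.card * St.card ∧
        (∀ d ∈ D, d.1 ∈ q :: σ.map Prod.snd ∧ LabeledPath δ d.1 d.2 d.1 ∧ d.2.length ≤ St.card) ∧
        (∀ x ∈ l.map Prod.snd, x ∈ q :: σ.map Prod.snd) ∧
        weight e (l.map Prod.fst) =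
          weight e (σ.map Prod.fst) + (D.map fun d => weight e (d.2.map Prod.fst)).sum := by
  intro n
  induction n using Nat.strong_induction_on with
  | _ n ih =>
    intro l q r hn hq h
    have hcard : 0 < St.card := Finset.card_pos.2 ⟨q, hq⟩
    rcases h.exists_removable hδ (F := {q}) (n := St.card - 1) (by simpa using hq) (by simp)
      (by simp; omega) with hl | ⟨α, β, η, s, rfl, hβ, hβl, hα', hβ', hη', hmem⟩
    · rw [Nat.sub_add_cancel hcard] at hl
      exact ⟨l, [], h, hl, by simp, fun x hx => List.mem_cons_of_mem _ hx, by simp⟩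
    · have := List.length_pos_iff.2 hβ
      simp only [List.length_append] at hn
      obtain ⟨σ, D, hσ, hσl, hD, hvis, hw⟩ := ih (α.length + η.length) (by omega)
        (l := α ++ η) (by simp) hq (hα'.append hη')
      have hvis' : ∀ x ∈ q :: α.map Prod.snd, x ∈ q :: σ.map Prod.snd := by
        intro x hx
        rcases List.mem_cons.1 hx with rfl | hx
        · exact List.mem_cons_self
        · exact hvis x (by simp only [List.map_append, List.mem_append]; exact .inl hx)
      refine ⟨σ, (s, β) :: D, hσ, hσl, ?_, ?_, ?_⟩
      · intro d hd
        rcases List.mem_cons.1 hd with rfl | hd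
        · exact ⟨hvis' _ hα'.target_mem, hβ', hβl⟩
        · exact hD d hd
      · intro x hx
        simp only [List.map_append, List.mem_append] at hx
        rcases hx with (hx | hx) | hx
        · exact hvis' x (List.mem_cons_of_mem _ hx)
        · rcases hmem x hx with hx | hx
          · rw [Finset.mem_singleton.1 hx]
            exact List.mem_cons_self
          · exact hvis' x (List.mem_cons_of_mem _ hx)
        · exact hvis x (by simp only [List.map_append, List.mem_append]; exact .inr hx)
      · simp only [List.map_append, weight_append, List.map_cons, List.sum_cons] at hw ⊢
        rw [add_right_comm, hw]
        abel

/-- The language `w₁* ⋯ w_m*`, where empty words are allowed. -/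
def starProd (ws : List (List Δ)) : Language Δ :=
  (ws.map fun w => KStar.kstar ({w} : Language Δ)).prod

lemma starProd_append (ws ws' : List (List Δ)) :
    starProd (ws ++ ws') = starProd ws * starProd ws' := by
  simp [starProd]

lemma nil_mem_starProd (ws : List (List Δ)) : [] ∈ starProd ws := by
  induction ws with
  | nil => exact Language.nil_mem_one
  | cons w ws ih => exact Language.mem_mul.2 ⟨[], Language.nil_mem_kstar _, [], ih, rfl⟩

lemma flatten_replicate_mem_kstar (w : List Δ) (n : ℕ) :
    (List.replicate n w).flatten ∈ KStar.kstar ({w} : Language Δ) :=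
  Language.mem_kstar.2 ⟨_, rfl, fun _ hy => List.eq_of_mem_replicate hy⟩

lemma mem_starProd_of_mem {ws : List (List Δ)} {w : List Δ} (h : w ∈ ws) : w ∈ starProd ws := by
  induction ws with
  | nil => simp at h
  | cons v ws ih =>
    rcases List.mem_cons.1 h with rfl | h
    · exact Language.mem_mul.2 ⟨w, by simpa using flatten_replicate_mem_kstar w 1, [],
        nil_mem_starProd _, by simp⟩
    · exact Language.mem_mul.2 ⟨[], Language.nil_mem_kstar _, w, ih h, rfl⟩

lemma starProd_filter_ne_nil (ws : List (List Δ)) :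
    starProd (ws.filter fun w => !w.isEmpty) = starProd ws := by
  induction ws with
  | nil => rfl
  | cons w ws ih =>
    cases w with
    | nil =>
      have h1 : KStar.kstar ({[]} : Language Δ) = 1 := by
        have : ({[]} : Language Δ) = 1 := rfl
        rw [this, kstar_one]
      simp only [List.isEmpty_nil, Bool.not_true, Bool.false_eq_true, not_false_eq_true,
        List.filter_cons_of_neg, ih]
      simp [starProd, h1]
    | cons p w =>
      simp only [List.isEmpty_cons, Bool.not_false, List.filter_cons_of_pos]
      simp only [starProd, List.map_cons, List.prod_cons] at ih ⊢
      rw [ih]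

/-- Cycles at a common state can be arranged into a word of `w₁* ⋯ w_m*`. -/
lemma exists_mem_starProd {δ : Q → Δ → Q → Prop} (e : Δ → M) {q : Q} :
    ∀ {ws D : List (List Δ)}, (∀ w ∈ D, w ∈ ws ∧ Run δ q w q) →
      ∃ v ∈ starProd ws, Run δ q v q ∧ weight e v = (D.map (weight e)).sum := by
  classical
  intro ws
  induction ws with
  | nil =>
    intro D hD
    obtain rfl : D = [] := List.eq_nil_iff_forall_not_mem.2 fun w hw => by simpa using (hD w hw).1
    exact ⟨[], nil_mem_starProd _, rfl, rfl⟩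
  | cons w ws ih =>
    intro D hD
    obtain ⟨v, hv, hrun, hwt⟩ := ih (D := D.filter (· ≠ w)) fun x hx => by
      simp only [ne_eq, decide_not, List.mem_filter, Bool.not_eq_eq_eq_not, Bool.not_true,
        decide_eq_false_iff_not] at hx
      obtain ⟨hx, hne⟩ := hx
      exact ⟨(List.mem_cons.1 (hD x hx).1).resolve_left hne, (hD x hx).2⟩
    have hrep : D.filter (· = w) = List.replicate (D.filter (· = w)).length w :=
      List.eq_replicate_of_mem fun x hx => by simpa using (List.mem_filter.1 hx).2
    refine ⟨(D.filter (· = w)).flatten ++ v, Language.mem_mul.2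
      ⟨_, ?_, v, hv, rfl⟩, Run.append ?_ hrun, ?_⟩
    · rw [hrep]
      exact flatten_replicate_mem_kstar w _
    · have : ∀ L : List (List Δ), (∀ x ∈ L, Run δ q x q) → Run δ q L.flatten q := by
        intro L
        induction L with
        | nil => exact fun _ => rfl
        | cons x L ihL =>
          intro h
          exact (h x (by simp)).append (ihL fun y hy => h y (List.mem_cons_of_mem _ hy))
      exact this _ fun x hx => (hD x (List.mem_filter.1 hx).1).2
    · have hflat : ∀ L : List (List Δ), weight e L.flatten = (L.map (weight e)).sum := by
        intro L
        induction L with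
        | nil => rfl
        | cons x L ihL => simp [ihL]
      have hperm : (D.filter (· = w) ++ D.filter (· ≠ w)).Perm D := by
        have := List.filter_append_perm (fun x => decide (x = w)) D
        simpa using this
      rw [weight_append, hwt, hflat, ← List.sum_append, ← List.map_append]
      exact (hperm.map _).sum_eq

/-- Inserting cycles into a path: every step of the path takes one block, which consists of the
cycles at the current state and the label of the step. -/
lemma LabeledPath.exists_mem_pow {δ : Q → Δ → Q → Prop} {ps : List Δ}
    (hps : ∀ q p r, δ q p r → p ∈ ps)
    (e : Δ → M) {W : List (List Δ)} :
    ∀ {σ : List (Δ × Q)} {q r : Q} {D : List (Q × List Δ)}, LabeledPath δ q σ r →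
      (∀ d ∈ D, d.1 ∈ q :: σ.map Prod.snd ∧ d.2 ∈ W ∧ Run δ d.1 d.2 d.1) →
      ∃ γ ∈ (starProd (W ++ ps.map fun p => [p])) ^ (σ.length + 1), Run δ q γ r ∧
        weight e γ = weight e (σ.map Prod.fst) + (D.map fun d => weight e d.2).sum := by
  classical
  intro σ
  induction σ with
  | nil =>
    intro q r D h hD
    obtain rfl : q = r := h
    obtain ⟨v, hv, hrun, hwt⟩ := exists_mem_starProd (δ := δ) e (q := q) (ws := W)
      (D := D.map Prod.snd) fun w hw => by
        obtain ⟨d, hd, rfl⟩ := List.mem_map.1 hw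
        obtain ⟨h1, h2, h3⟩ := hD d hd
        obtain h1 : d.1 = q := by simpa using h1
        exact ⟨h2, h1 ▸ h3⟩
    refine ⟨v, ?_, hrun, by rw [hwt, List.map_map]; simp [Function.comp_def]⟩
    rw [List.length_nil, zero_add, pow_one, starProd_append]
    exact Language.mem_mul.2 ⟨v, hv, [], nil_mem_starProd _, by simp⟩
  | cons x σ ih =>
    intro q r D h hD
    obtain ⟨v, hv, hrun, hwt⟩ := exists_mem_starProd (δ := δ) e (q := q) (ws := W)
      (D := (D.filter fun d => d.1 = q).map Prod.snd) fun w hw => by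
        obtain ⟨d, hd, rfl⟩ := List.mem_map.1 hw
        obtain ⟨hd, h1⟩ := List.mem_filter.1 hd
        obtain ⟨-, h2, h3⟩ := hD d hd
        obtain h1 : d.1 = q := by simpa using h1
        exact ⟨h2, h1 ▸ h3⟩
    obtain ⟨γ, hγ, hrun', hwt'⟩ := ih (D := D.filter fun d => ¬ d.1 = q) h.2 fun d hd => by
      obtain ⟨hd, h1⟩ := List.mem_filter.1 hd
      obtain ⟨h2, h3⟩ := hD d hd
      exact ⟨(List.mem_cons.1 h2).resolve_left (by simpa using h1), h3⟩
    have hperm : (D.filter (fun d => d.1 = q) ++ D.filter (fun d => ¬ d.1 = q)).Perm D := by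
      have := List.filter_append_perm (fun d : Q × List Δ => decide (d.1 = q)) D
      simpa using this
    refine ⟨(v ++ [x.1]) ++ γ, ?_, Run.append (hrun.append ⟨x.2, h.1, rfl⟩) hrun', ?_⟩
    · rw [List.length_cons, pow_succ']
      refine Language.mem_mul.2 ⟨v ++ [x.1], ?_, γ, hγ, rfl⟩
      rw [starProd_append]
      exact Language.mem_mul.2 ⟨v, hv, [x.1], mem_starProd_of_mem
        (List.mem_map.2 ⟨x.1, hps _ _ _ h.1, rfl⟩), rfl⟩
    · rw [← (hperm.map fun d => weight e d.2).sum_eq]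
      simp only [weight_append, weight_cons, weight_nil, hwt, hwt', List.map_append,
        List.sum_append, List.map_cons, List.map_map, Function.comp_def]
      abel

lemma mem_pow_of_le {L : Language Δ} (hL : [] ∈ L) {m n : ℕ} (h : m ≤ n) {γ : List Δ}
    (hγ : γ ∈ L ^ m) : γ ∈ L ^ n := by
  induction h with
  | refl => exact hγ
  | step _ ih =>
    rw [pow_succ]
    exact Language.mem_mul.2 ⟨γ, ih, [], hL, by simp⟩

/-- Let `W` contain, for each closed path with at most `|St|` steps, the label of a closed path at
the same state with the same weight.  Then each run can be replaced, without changing its ends and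
its weight, by one with a label in a fixed bounded language. -/
theorem Run.exists_mem_pow [DecidableEq Q] {δ : Q → Δ → Q → Prop} {St : Finset Q}
    (hδ : ∀ q p r, δ q p r → r ∈ St) {ps : List Δ} (hps : ∀ q p r, δ q p r → p ∈ ps)
    (e : Δ → M) {W : List (List Δ)}
    (hW : ∀ q ∈ St, ∀ γ : List Δ, γ.length ≤ St.card → Run δ q γ q →
      ∃ w ∈ W, Run δ q w q ∧ weight e w = weight e γ)
    {q r : Q} (hq : q ∈ St) {γ : List Δ} (h : Run δ q γ r) :
    ∃ γ' ∈ (starProd (W ++ ps.map fun p => [p])) ^ (St.card * St.card + 1),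
      Run δ q γ' r ∧ weight e γ' = weight e γ := by
  obtain ⟨l, hl, rfl⟩ := h.exists_path
  obtain ⟨σ, D, hσ, hσl, hD, -, hw⟩ := hl.exists_skeleton hδ e rfl hq
  have hSt : ∀ d ∈ D, d.1 ∈ St := fun d hd => by
    rcases List.mem_cons.1 (hD d hd).1 with h | h
    · exact h ▸ hq
    · exact hσ.mem_of_mem hδ _ h
  have hrep : ∀ d ∈ D, ∃ w ∈ W, Run δ d.1 w d.1 ∧ weight e w = weight e (d.2.map Prod.fst) :=
    fun d hd => hW d.1 (hSt d hd) _ (by simpa using (hD d hd).2.2) (hD d hd).2.1.run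
  have hD' : ∃ D' : List (Q × List Δ),
      (∀ d ∈ D', d.1 ∈ q :: σ.map Prod.snd ∧ d.2 ∈ W ∧ Run δ d.1 d.2 d.1) ∧
      (D'.map fun d => weight e d.2).sum =
        (D.map fun d => weight e (d.2.map Prod.fst)).sum := by
    choose! f hf using hrep
    refine ⟨D.map fun d => (d.1, f d), ?_, ?_⟩
    · intro d' hd'
      obtain ⟨d, hd, rfl⟩ := List.mem_map.1 hd'
      exact ⟨(hD d hd).1, (hf d hd).1, (hf d hd).2.1⟩
    · rw [List.map_map]
      exact congrArg List.sum (List.map_congr_left fun d hd => (hf d hd).2.2)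
  obtain ⟨D', hD', hsum⟩ := hD'
  obtain ⟨γ', hγ', hrun, hwt⟩ := hσ.exists_mem_pow hps e hD'
  exact ⟨γ', mem_pow_of_le (nil_mem_starProd _) (by omega) hγ', hrun, by rw [hwt, hsum, hw]⟩

end BoundedSublanguage

/-! ### The bounded expression -/

section Construction

variable {N : Type u} {T : Type v}

/-- The symbols occurring in the productions `ps`, and the nonterminal `X`. -/
def symbolList (ps : List (Production N T)) (X : N) : List (Symbol T N) :=
  (ps.flatMap fun p => Symbol.nonterminal p.input :: p.output) ++ [Symbol.nonterminal X]

/-- The words of length at most `k` over the symbols in `sy`. -/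
def stackList (sy : List (Symbol T N)) : ℕ → List (List (Symbol T N))
  | 0 => [[]]
  | k + 1 => [] :: (sy ×ˢ stackList sy k).map fun x => x.1 :: x.2

/-- The numbers from `2 * n` down to `0`. -/
def numberList : ℕ → List ℕ
  | 0 => [0]
  | n + 1 => (2 * n + 2) :: (2 * n + 1) :: numberList n

/-- A key `(b, c, S₀, S, x, y)` asks for a control word whose productions produce no terminals
other than `b` and `c`, leading from the stack `S₀` to the stack `S` and producing `x` times
`b` and `y` times `c`. -/
abbrev Key (N : Type u) (T : Type v) :=
  Symbol T N × Symbol T N × List (Symbol T N) × List (Symbol T N) × ℕ × ℕ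

/-- A key together with a control word that it asks for. -/
abbrev Entry (N : Type u) (T : Type v) := Key N T × List (Production N T)

/-- All keys with symbols in `sy` and stacks in `st`, the numbers being at most `2 * |st|`. -/
def keyList (sy : List (Symbol T N)) (st : List (List (Symbol T N))) : List (Key N T) :=
  sy ×ˢ (sy ×ˢ (st ×ˢ (st ×ˢ (numberList st.length ×ˢ numberList st.length))))

/-- The entries for the empty control word. -/
def initialTable (sy : List (Symbol T N)) (st : List (List (Symbol T N))) : List (Entry N T) :=
  (sy ×ˢ (sy ×ˢ st)).map fun x => ((x.1, x.2.1, x.2.2, x.2.2, 0, 0), [])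

variable [DecidableEq N] [DecidableEq T]

/-- All terminals in `u` are `b` or `c`. -/
def allowed (b c : Symbol T N) (u : List (Symbol T N)) : Bool :=
  u.all fun s => isNonterminal s || s = b || s = c

/-- The entry obtained from `e` by applying `p` and passing to the stack `S`. -/
def extendTo (e : Entry N T) (p : Production N T) (S : List (Symbol T N)) : Entry N T :=
  ((e.1.1, e.1.2.1, e.1.2.2.1, S, p.output.count e.1.1 + e.1.2.2.2.2.1,
    p.output.count e.1.2.1 + e.1.2.2.2.2.2), e.2 ++ [p])

/-- The extensions of an entry by a production: two, one for each order of the new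
nonterminals, or none if the production cannot be applied. -/
def extensions (e : Entry N T) (p : Production N T) : List (Entry N T) :=
  match e.1.2.2.2.1 with
  | [] => []
  | s :: S =>
    if s = .nonterminal p.input then
      if allowed e.1.1 e.1.2.1 p.output then
        [extendTo e p (nonterminals p.output ++ S),
          extendTo e p ((nonterminals p.output).reverse ++ S)]
      else []
    else []

/-- The entries of the table `C` and their extensions. -/
def candidates (ps : List (Production N T)) (C : List (Entry N T)) : List (Entry N T) :=
  C.flatMap fun e => e :: ps.flatMap (extensions e)

/-- One entry for every key for which `C` has an entry. -/
def select (C : List (Entry N T)) (K : List (Key N T)) : List (Entry N T) :=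
  K.flatMap fun κ => (C.find? fun e => e.1 = κ).toList

/-- The table after `i` rounds of extending and selecting. -/
def table (ps : List (Production N T)) (sy : List (Symbol T N))
    (st : List (List (Symbol T N))) : ℕ → List (Entry N T)
  | 0 => initialTable sy st
  | i + 1 => select (candidates ps (table ps sy st i)) (keyList sy st)

/-- The words of one block of the bounded expression: the control words in the table, and the
single productions. -/
def blockWords (ps : List (Production N T)) (C : List (Entry N T)) : List (List (Production N T)) :=
  (C.map Prod.snd).filter (fun w => !w.isEmpty) ++ ps.map fun p => [p]

/-- The words of the bounded expression: the block, repeated once for each key. -/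
def controlWords (ps : List (Production N T)) (X : N) (k : ℕ) : List (List (Production N T)) :=
  let sy := symbolList ps X
  let st := stackList sy k
  (keyList sy st).flatMap fun _ => blockWords ps (table ps sy st st.length)

/-- The bounded expression, for the stack height `k`. -/
def controlExpr (ps : List (Production N T)) (X : N) (k : ℕ) : BoundedExpr (Production N T) where
  words := controlWords ps X k
  nonempty := by
    intro w hw
    simp only [controlWords, blockWords, List.mem_flatMap, List.mem_append, List.mem_filter,
      List.mem_map] at hw
    obtain ⟨-, -, ⟨-, h⟩ | ⟨p, -, rfl⟩⟩ := hw
    · rintro rfl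
      simp at h
    · simp

end Construction

/-! ### Correctness of the construction -/

section Lists

variable {N : Type u} {T : Type v}

lemma mem_symbolList {ps : List (Production N T)} {X : N} {p : Production N T} (hp : p ∈ ps) :
    ∀ x ∈ p.output, x ∈ symbolList ps X := by
  intro x hx
  simp only [symbolList, List.mem_append, List.mem_flatMap, List.mem_cons]
  exact .inl ⟨p, hp, .inr hx⟩

lemma nonterminal_mem_symbolList (ps : List (Production N T)) (X : N) :
    Symbol.nonterminal X ∈ symbolList ps X := by
  simp [symbolList]

lemma mem_stackList {sy : List (Symbol T N)} : ∀ {k : ℕ} {S : List (Symbol T N)},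
    S ∈ stackList sy k ↔ (∀ x ∈ S, x ∈ sy) ∧ S.length ≤ k
  | 0, S => by
    simp only [stackList, List.mem_singleton, Nat.le_zero, List.length_eq_zero_iff]
    exact ⟨fun h => ⟨by simp [h], h⟩, fun h => h.2⟩
  | k + 1, S => by
    cases S with
    | nil => simp [stackList]
    | cons s S =>
      simp only [stackList, List.mem_cons, List.mem_map, Prod.exists, List.mem_product,
        mem_stackList (k := k), List.length_cons, reduceCtorEq, false_or, List.cons.injEq]
      constructor
      · rintro ⟨x, S', ⟨hx, hS', hl⟩, rfl, rfl⟩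
        exact ⟨fun y hy => hy.elim (fun e => e ▸ hx) (hS' y), by omega⟩
      · rintro ⟨h, hl⟩
        exact ⟨s, S, ⟨h s (.inl rfl), fun y hy => h y (.inr hy), by omega⟩, rfl, rfl⟩

lemma length_stackList_le {sy : List (Symbol T N)} :
    ∀ k : ℕ, (stackList sy k).length ≤ (sy.length + 1) ^ k
  | 0 => by simp [stackList]
  | k + 1 => by
    have := length_stackList_le (sy := sy) k
    simp only [stackList, List.length_cons, List.length_map, List.length_product]
    rw [pow_succ, mul_comm]
    have h1 : 1 ≤ (sy.length + 1) ^ k := Nat.one_le_pow _ _ (by omega)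
    nlinarith

lemma length_lt_length_stackList {sy : List (Symbol T N)} {k : ℕ} (hk : 0 < k) :
    sy.length < (stackList sy k).length := by
  obtain ⟨k, rfl⟩ := Nat.exists_eq_succ_of_ne_zero hk.ne'
  have : 1 ≤ (stackList sy k).length := by
    refine List.length_pos_iff.2 (List.ne_nil_of_mem (a := []) (mem_stackList.2 (by simp)))
  simp only [stackList, List.length_cons, List.length_map, List.length_product]
  nlinarith

lemma mem_numberList {n i : ℕ} : i ∈ numberList n ↔ i ≤ 2 * n := by
  induction n with
  | zero => simp [numberList]
  | succ n ih =>
    simp only [numberList, List.mem_cons, ih]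
    omega

lemma length_numberList (n : ℕ) : (numberList n).length = 2 * n + 1 := by
  induction n with
  | zero => rfl
  | succ n ih => simp only [numberList, List.length_cons, ih]; ring

lemma mem_keyList {sy : List (Symbol T N)} {st : List (List (Symbol T N))} {b c : Symbol T N}
    {S₀ S : List (Symbol T N)} {x y : ℕ} :
    (b, c, S₀, S, x, y) ∈ keyList sy st ↔
      b ∈ sy ∧ c ∈ sy ∧ S₀ ∈ st ∧ S ∈ st ∧ x ≤ 2 * st.length ∧ y ≤ 2 * st.length := by
  simp [keyList, List.mem_product, mem_numberList]

lemma length_keyList (sy : List (Symbol T N)) (st : List (List (Symbol T N))) :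
    (keyList sy st).length = sy.length * (sy.length * (st.length * (st.length *
      ((2 * st.length + 1) * (2 * st.length + 1))))) := by
  simp [keyList, List.length_product, length_numberList]

end Lists

section Correctness

variable {N : Type u} {T : Type v} [DecidableEq N] [DecidableEq T]

/-- The part of the stack automaton with stacks in `st` and productions producing no terminals
other than `b` and `c`. -/
def TwoLetterStep (ps : List (Production N T)) (st : List (List (Symbol T N))) (b c : Symbol T N)
    (S : List (Symbol T N)) (p : Production N T) (S' : List (Symbol T N)) : Prop :=
  p ∈ ps ∧ StackStep S p S' ∧ allowed b c p.output ∧ S ∈ st ∧ S' ∈ st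

/-- How often a production produces `b` and `c`. -/
def twoCounts (b c : Symbol T N) (p : Production N T) : ℕ × ℕ :=
  (p.output.count b, p.output.count c)

/-- The control word of the entry is what its key asks for. -/
def Entry.IsSound (ps : List (Production N T)) (st : List (List (Symbol T N)))
    (e : Entry N T) : Prop :=
  Run (TwoLetterStep ps st e.1.1 e.1.2.1) e.1.2.2.1 e.2 e.1.2.2.2.1 ∧
    weight (twoCounts e.1.1 e.1.2.1) e.2 = e.1.2.2.2.2

lemma mem_extensions {e e' : Entry N T} {p : Production N T} :
    e' ∈ extensions e p ↔ ∃ S', StackStep e.1.2.2.2.1 p S' ∧ allowed e.1.1 e.1.2.1 p.output ∧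
      e' = extendTo e p S' := by
  unfold extensions StackStep
  split
  · rename_i h
    simp [h]
  · rename_i s S h
    rw [h]
    split_ifs with h1 h2
    · simp [h1, h2]
    · simp [h2]
    · simp [h1]

lemma mem_select {C : List (Entry N T)} {K : List (Key N T)} {e : Entry N T}
    (h : e ∈ select C K) : e ∈ C ∧ e.1 ∈ K := by
  simp only [select, List.mem_flatMap, Option.mem_toList] at h
  obtain ⟨κ, hκ, h⟩ := h
  have := List.find?_some h
  simp only [decide_eq_true_eq] at this
  exact ⟨List.mem_of_find?_eq_some h, this ▸ hκ⟩

lemma exists_mem_select {C : List (Entry N T)} {K : List (Key N T)} {e : Entry N T}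
    (h : e ∈ C) (hK : e.1 ∈ K) : ∃ w, (e.1, w) ∈ select C K := by
  obtain ⟨e', he'⟩ : ∃ e', C.find? (fun x => x.1 = e.1) = some e' := by
    rw [← Option.isSome_iff_exists, List.find?_isSome]
    exact ⟨e, h, by simp⟩
  have h1 : e'.1 = e.1 := by simpa using List.find?_some he'
  refine ⟨e'.2, ?_⟩
  rw [← h1]
  simp only [select, List.mem_flatMap, Option.mem_toList]
  exact ⟨e.1, hK, he'⟩

/-- All entries of the table are sound and have keys in the list. -/
lemma table_sound {ps : List (Production N T)} {sy : List (Symbol T N)}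
    {st : List (List (Symbol T N))} :
    ∀ {i : ℕ} {e : Entry N T}, e ∈ table ps sy st i →
      e.1 ∈ keyList sy st ∧ e.IsSound ps st := by
  intro i
  induction i with
  | zero =>
    intro e he
    simp only [table, initialTable, List.mem_map, Prod.exists, List.mem_product] at he
    obtain ⟨b, c, S, ⟨hb, hc, hS⟩, rfl⟩ := he
    exact ⟨mem_keyList.2 ⟨hb, hc, hS, hS, by omega, by omega⟩, rfl, rfl⟩
  | succ i ih =>
    intro e he
    obtain ⟨he, hk⟩ := mem_select he
    refine ⟨hk, ?_⟩
    simp only [candidates, List.mem_flatMap, List.mem_cons] at he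
    obtain ⟨e₀, he₀, rfl | ⟨p, hp, he⟩⟩ := he
    · exact (ih he₀).2
    · obtain ⟨S', hS', ha, rfl⟩ := mem_extensions.1 he
      obtain ⟨hk₀, hr, hw⟩ := ih he₀
      obtain ⟨⟨b, c, S₀, S, x, y⟩, w⟩ := e₀
      simp only [extendTo, mem_keyList] at hk hk₀ hS' ha hr hw ⊢
      refine ⟨Run.append hr ⟨S', ⟨hp, hS', ha, hk₀.2.2.2.1, hk.2.2.2.1⟩, rfl⟩, ?_⟩
      simp only [weight_append, hw, weight_cons, weight_nil, twoCounts, add_zero]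
      simp [add_comm]

lemma count_le_two {u : List (Symbol T N)} (h : terminalCount u ≤ 2 ∧ nonterminalCount u ≤ 2)
    (b : Symbol T N) : u.count b ≤ 2 := by
  cases b with
  | terminal b =>
    refine le_trans (List.countP_mono_left fun x _ hx => ?_) h.1
    obtain rfl : x = _ := by simpa using hx
    rfl
  | nonterminal b =>
    refine le_trans (List.countP_mono_left fun x _ hx => ?_) h.2
    obtain rfl : x = _ := by simpa using hx
    rfl

lemma weight_twoCounts_le {ps : List (Production N T)}
    (hps : ∀ p ∈ ps, terminalCount p.output ≤ 2 ∧ nonterminalCount p.output ≤ 2)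
    (b c : Symbol T N) : ∀ {γ : List (Production N T)}, (∀ p ∈ γ, p ∈ ps) →
      (weight (twoCounts b c) γ).1 ≤ 2 * γ.length ∧ (weight (twoCounts b c) γ).2 ≤ 2 * γ.length
  | [], _ => by simp
  | p :: γ, h => by
    have h1 := weight_twoCounts_le hps b c (γ := γ) fun q hq => h q (List.mem_cons_of_mem _ hq)
    have h2 := count_le_two (hps p (h p (by simp))) b
    have h3 := count_le_two (hps p (h p (by simp))) c
    simp only [weight_cons, twoCounts, Prod.fst_add, Prod.snd_add, List.length_cons] at h1 ⊢
    omega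

lemma Run.mem_of_twoLetterStep {ps : List (Production N T)} {st : List (List (Symbol T N))}
    {b c : Symbol T N} : ∀ {γ : List (Production N T)} {S S' : List (Symbol T N)},
      Run (TwoLetterStep ps st b c) S γ S' → ∀ p ∈ γ, p ∈ ps
  | [], _, _, _ => by simp
  | q :: γ, _, _, ⟨_, hs, h⟩ => by
    intro p hp
    rcases List.mem_cons.1 hp with rfl | hp
    exacts [hs.1, h.mem_of_twoLetterStep p hp]

lemma Run.target_mem {ps : List (Production N T)} {st : List (List (Symbol T N))}
    {b c : Symbol T N} : ∀ {γ : List (Production N T)} {S S' : List (Symbol T N)}, S ∈ st →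
      Run (TwoLetterStep ps st b c) S γ S' → S' ∈ st
  | [], _, _, h, hr => hr ▸ h
  | _ :: _, _, _, _, ⟨_, hs, h⟩ => h.target_mem hs.2.2.2.2

/-- After `i` rounds the table has an entry for every key that is met by a control word of length
at most `i`. -/
lemma table_complete {ps : List (Production N T)}
    (hps : ∀ p ∈ ps, terminalCount p.output ≤ 2 ∧ nonterminalCount p.output ≤ 2)
    {sy : List (Symbol T N)} {st : List (List (Symbol T N))} {b c : Symbol T N} (hb : b ∈ sy)
    (hc : c ∈ sy) : ∀ {i : ℕ} {γ : List (Production N T)} {S S' : List (Symbol T N)},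
      i ≤ st.length → γ.length ≤ i → S ∈ st → Run (TwoLetterStep ps st b c) S γ S' →
      ∃ w, ((b, c, S, S', weight (twoCounts b c) γ), w) ∈ table ps sy st i := by
  intro i
  induction i with
  | zero =>
    intro γ S S' _ hγ hS h
    obtain rfl : γ = [] := List.eq_nil_of_length_eq_zero (by omega)
    obtain rfl : S = S' := h
    refine ⟨[], ?_⟩
    simp only [table, initialTable, List.mem_map, Prod.exists, List.mem_product]
    exact ⟨b, c, S, ⟨hb, hc, hS⟩, rfl⟩
  | succ i ih =>
    intro γ S S' hi hγ hS h
    have hK : ((b, c, S, S', weight (twoCounts b c) γ) : Key N T) ∈ keyList sy st := by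
      obtain ⟨h1, h2⟩ := weight_twoCounts_le hps b c h.mem_of_twoLetterStep
      exact mem_keyList.2 ⟨hb, hc, hS, h.target_mem hS, h1.trans (by omega), h2.trans (by omega)⟩
    rcases Nat.lt_or_ge i γ.length with hlt | hge
    · obtain ⟨γ, p, rfl⟩ : ∃ γ' p, γ = γ' ++ [p] := by
        rcases List.eq_nil_or_concat γ with rfl | ⟨γ', p, rfl⟩
        · simp at hlt
        · exact ⟨γ', p, by simp⟩
      obtain ⟨S₁, h₁, S₂, h₂, rfl⟩ := Run.append_iff.1 h
      obtain ⟨w, hw⟩ := ih (by omega) (by simpa using hγ) hS h₁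
      have e : (extendTo ((b, c, S, S₁, weight (twoCounts b c) γ), w) p S₂).1 =
          (b, c, S, S₂, weight (twoCounts b c) (γ ++ [p])) := by
        rw [weight_append, weight_cons, weight_nil, add_zero, add_comm]
        rfl
      have hmem : extendTo ((b, c, S, S₁, weight (twoCounts b c) γ), w) p S₂ ∈
          candidates ps (table ps sy st i) := by
        simp only [candidates, List.mem_flatMap, List.mem_cons]
        exact ⟨_, hw, .inr ⟨p, h₂.1, mem_extensions.2 ⟨S₂, h₂.2.1, h₂.2.2.1, rfl⟩⟩⟩
      obtain ⟨w', hw'⟩ := exists_mem_select (K := keyList sy st) hmem (e ▸ hK)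
      rw [e] at hw'
      exact ⟨w', hw'⟩
    · obtain ⟨w, hw⟩ := ih (by omega) hge hS h
      refine exists_mem_select (K := keyList sy st) (C := candidates ps (table ps sy st i))
        (e := ((b, c, S, S', weight (twoCounts b c) γ), w)) ?_ hK
      simp only [candidates, List.mem_flatMap, List.mem_cons]
      exact ⟨_, hw, .inl rfl⟩

lemma count_terminals (u : List (Symbol T N)) (x : T) :
    (terminals u).count x = u.count (Symbol.terminal x) := by
  induction u with
  | nil => rfl
  | cons y u ih => cases y <;> simp [ih, List.count_cons]

lemma weight_twoCounts {b c : Symbol T N} {γ : List (Production N T)} :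
    (∀ x, b = .terminal x → (weight (twoCounts b c) γ).1 = (effect γ).count x) ∧
    (∀ x, c = .terminal x → (weight (twoCounts b c) γ).2 = (effect γ).count x) := by
  induction γ with
  | nil => simp
  | cons p γ ih =>
    refine ⟨?_, ?_⟩
    · rintro x rfl
      rw [weight_cons, Prod.fst_add, ih.1 x rfl, effect_cons, List.count_append, count_terminals]
      rfl
    · rintro x rfl
      rw [weight_cons, Prod.snd_add, ih.2 x rfl, effect_cons, List.count_append, count_terminals]
      rfl

/-- A control word producing no other terminals than `b` and `c` is determined up to order, as
far as its effect goes, by how often these are produced. -/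
lemma effect_perm_of_weight_eq {b c : Symbol T N} {γ γ' : List (Production N T)}
    (h : ∀ p ∈ γ, allowed b c p.output) (h' : ∀ p ∈ γ', allowed b c p.output)
    (hw : weight (twoCounts b c) γ = weight (twoCounts b c) γ') :
    (effect γ).Perm (effect γ') := by
  have hne : ∀ {γ : List (Production N T)} {x : T}, (∀ p ∈ γ, allowed b c p.output) →
      b ≠ .terminal x → c ≠ .terminal x → (effect γ).count x = 0 := by
    intro γ x h hb hc
    refine List.count_eq_zero.2 fun hx => ?_
    simp only [effect, List.mem_flatMap] at hx
    obtain ⟨p, hp, hx⟩ := hx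
    have := List.all_eq_true.1 (h p hp) _ (mem_terminals.1 hx)
    simp only [isNonterminal, Bool.false_or, Bool.or_eq_true, decide_eq_true_eq] at this
    rcases this with e | e
    exacts [hb e.symm, hc e.symm]
  rw [List.perm_iff_count]
  intro x
  by_cases hb : b = .terminal x
  · rw [← weight_twoCounts.1 x hb, hw, weight_twoCounts.1 x hb]
  by_cases hc : c = .terminal x
  · rw [← weight_twoCounts.2 x hc, hw, weight_twoCounts.2 x hc]
  rw [hne h hb hc, hne h' hb hc]

end Correctness

section Cover

variable {N : Type u} {T : Type v}

lemma BoundedStackStep.mem_stackList {G : Grammar N T} {k : ℕ} {ps : List (Production N T)} {X : N}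
    (hps : ∀ p, p ∈ ps ↔ p ∈ G.productions) {S S' : List (Symbol T N)} {p : Production N T}
    (h : BoundedStackStep G k S p S') (hS : S ∈ stackList (symbolList ps X) k) :
    S' ∈ stackList (symbolList ps X) k := by
  obtain ⟨hp, ⟨S₀, rfl, hS'⟩, -, hk⟩ := h
  rw [_root_.mem_stackList] at hS ⊢
  refine ⟨fun x hx => ?_, hk⟩
  have : x ∈ nonterminals p.output ∨ x ∈ S₀ := by
    rcases hS' with rfl | rfl <;> simpa using hx
  rcases this with hx | hx
  · exact mem_symbolList ((hps p).2 hp) x (List.mem_filter.1 hx).1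
  · exact hS.1 x (List.mem_cons_of_mem _ hx)

lemma Run.mem_stackList {G : Grammar N T} {k : ℕ} {ps : List (Production N T)} {X : N}
    (hps : ∀ p, p ∈ ps ↔ p ∈ G.productions) :
    ∀ {γ : List (Production N T)} {S S' : List (Symbol T N)},
      S ∈ stackList (symbolList ps X) k → Run (BoundedStackStep G k) S γ S' →
      S' ∈ stackList (symbolList ps X) k
  | [], _, _, hS, h => h ▸ hS
  | _ :: _, _, _, hS, ⟨_, hs, h⟩ => h.mem_stackList hps (hs.mem_stackList hps hS)

lemma starProd_flatMap_const {α β : Type*} (l : List α) (ws : List (List β)) :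
    starProd (l.flatMap fun _ => ws) = starProd ws ^ l.length := by
  induction l with
  | nil => rfl
  | cons x l ih => rw [List.flatMap_cons, starProd_append, ih, List.length_cons, pow_succ']

/-- By minimality, all letters of the expression occur in productions of the grammar. -/
lemma IsMinimalStrict.mem_symbolList {G : Grammar N T} {X : N} {a : List T}
    (ha : IsMinimalStrict a (G.language X)) {ps : List (Production N T)}
    (hps : ∀ p, p ∈ ps ↔ p ∈ G.productions) {x : T} (hx : x ∈ a) :
    Symbol.terminal x ∈ symbolList ps X := by
  obtain ⟨w, ⟨s, hs⟩, hxw⟩ := ha.exists_mem hx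
  have key : ∀ m, ∀ y : T, Symbol.terminal y ∈ wordAt [Symbol.nonterminal X] s m →
      Symbol.terminal y ∈ symbolList ps X := by
    intro m
    induction m with
    | zero => simp [wordAt]
    | succ m ih =>
      intro y hy
      rw [wordAt.eq_2] at hy
      cases hm : s[m]? with
      | none =>
        rw [hm] at hy
        exact ih y hy
      | some q =>
        obtain ⟨p, j⟩ := q
        rw [hm] at hy
        simp only [replaceAt, List.mem_append] at hy
        rcases hy with (hy | hy) | hy
        · exact ih y (List.mem_of_mem_take hy)
        · exact _root_.mem_symbolList ((hps p).2 (hs.1 m p j hm).1) _ hy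
        · exact ih y (List.mem_of_mem_drop hy)
  refine key s.length x ?_
  rw [hs.2]
  exact List.mem_map.2 ⟨x, hxw, rfl⟩

lemma IsMinimalStrict.length_lt {G : Grammar N T} {X : N} {a : List T}
    (ha : IsMinimalStrict a (G.language X)) {ps : List (Production N T)}
    (hps : ∀ p, p ∈ ps ↔ p ∈ G.productions) : a.length < (symbolList ps X).length := by
  have hnd : ((Symbol.nonterminal X : Symbol T N) :: a.map Symbol.terminal).Nodup := by
    rw [List.nodup_cons]
    refine ⟨by simp, ha.1.map fun x y h => by simpa using h⟩
  have hsub : ((Symbol.nonterminal X : Symbol T N) :: a.map Symbol.terminal) ⊆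
      symbolList ps X := by
    intro s hs
    rcases List.mem_cons.1 hs with rfl | hs
    · exact nonterminal_mem_symbolList ps X
    · obtain ⟨x, hx, rfl⟩ := List.mem_map.1 hs
      exact ha.mem_symbolList hps hx
  simpa using (hnd.subperm hsub).length_le

/-- The number of keys bounds the number of blocks needed: `10 * d + 2` pieces, each of them with a
skeleton of at most `st.length ^ 2` steps. -/
lemma blocks_le_length_keyList {d : ℕ} {sy : List (Symbol T N)} {st : List (List (Symbol T N))}
    (hd : d < sy.length) (hst : sy.length < st.length) :
    (st.length * st.length + 1) * (10 * d + 2) ≤ (keyList sy st).length := by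
  rw [length_keyList]
  generalize sy.length = s at *
  generalize st.length = V at *
  have h1 : (V * V + 1) * (10 * d + 2) ≤ (2 * (V * V)) * (10 * s) := by
    apply Nat.mul_le_mul
    · nlinarith
    · omega
  have h2 : (2 * (V * V)) * (10 * s) ≤ (V * V * s) * ((2 * V + 1) * (2 * V + 1)) := by
    have : 20 ≤ (2 * V + 1) * (2 * V + 1) := by nlinarith
    calc (2 * (V * V)) * (10 * s) = (V * V * s) * 20 := by ring
      _ ≤ _ := Nat.mul_le_mul_left _ this
  have h3 : (V * V * s) * ((2 * V + 1) * (2 * V + 1)) ≤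
      s * ((V * V * s) * ((2 * V + 1) * (2 * V + 1))) := Nat.le_mul_of_pos_left _ (by omega)
  calc _ ≤ _ := h1
    _ ≤ _ := h2
    _ ≤ _ := h3
    _ = _ := by ring

variable [DecidableEq N] [DecidableEq T]

lemma Run.twoLetterStep {G : Grammar N T} {k : ℕ} {ps : List (Production N T)} {X : N}
    (hps : ∀ p, p ∈ ps ↔ p ∈ G.productions) {b c : Symbol T N} :
    ∀ {γ : List (Production N T)} {S S' : List (Symbol T N)},
      S ∈ stackList (symbolList ps X) k → (∀ p ∈ γ, allowed b c p.output) →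
      Run (BoundedStackStep G k) S γ S' →
      Run (TwoLetterStep ps (stackList (symbolList ps X) k) b c) S γ S'
  | [], _, _, _, _, h => h
  | p :: _, _, _, hS, ha, ⟨_, hs, h⟩ =>
    have hS' := hs.mem_stackList hps hS
    ⟨_, ⟨(hps p).2 hs.1, hs.2.1, ha p (by simp), hS, hS'⟩,
      h.twoLetterStep hps hS' fun q hq => ha q (List.mem_cons_of_mem _ hq)⟩

lemma Run.allowed_of_twoLetterStep {ps : List (Production N T)} {st : List (List (Symbol T N))}
    {b c : Symbol T N} : ∀ {γ : List (Production N T)} {S S' : List (Symbol T N)},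
      Run (TwoLetterStep ps st b c) S γ S' → ∀ p ∈ γ, allowed b c p.output
  | [], _, _, _ => by simp
  | q :: γ, _, _, ⟨_, hs, h⟩ => by
    intro p hp
    rcases List.mem_cons.1 hp with rfl | hp
    exacts [hs.2.2.1, h.allowed_of_twoLetterStep p hp]

/-- The language of one block of the bounded expression. -/
def blockLang (ps : List (Production N T)) (X : N) (k : ℕ) : Language (Production N T) :=
  starProd (blockWords ps (table ps (symbolList ps X) (stackList (symbolList ps X) k)
    (stackList (symbolList ps X) k).length))

/-- A run that produces no terminals other than `b` and `c` can be replaced by one of the same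
effect in a power of the block language. -/
lemma Run.exists_mem_blockLang_pow {G : Grammar N T}
    (hG : ∀ p ∈ G.productions, terminalCount p.output ≤ 2 ∧ nonterminalCount p.output ≤ 2)
    {k : ℕ} {ps : List (Production N T)} {X : N} (hps : ∀ p, p ∈ ps ↔ p ∈ G.productions)
    {b c : Symbol T N} (hb : b ∈ symbolList ps X) (hc : c ∈ symbolList ps X)
    {γ : List (Production N T)} {S S' : List (Symbol T N)}
    (hS : S ∈ stackList (symbolList ps X) k) (ha : ∀ p ∈ γ, allowed b c p.output)
    (h : Run (BoundedStackStep G k) S γ S') :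
    ∃ γ' ∈ blockLang ps X k ^ ((stackList (symbolList ps X) k).length *
        (stackList (symbolList ps X) k).length + 1),
      Run (BoundedStackStep G k) S γ' S' ∧ (effect γ').Perm (effect γ) := by
  set sy := symbolList ps X with hsy
  set st := stackList sy k with hst
  have hcard : st.toFinset.card ≤ st.length := st.toFinset_card_le
  obtain ⟨γ', hγ', hr, hw⟩ := Run.exists_mem_pow (δ := TwoLetterStep ps st b c)
    (St := st.toFinset) (ps := ps) (fun _ _ _ h => by simpa using h.2.2.2.2) (fun _ _ _ h => h.1)
    (twoCounts b c) (W := (table ps sy st st.length).map Prod.snd) (fun S hS δ hδ hrun => by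
      obtain ⟨w, hw⟩ := table_complete (fun p hp => hG p ((hps p).1 hp)) hb hc le_rfl
        (hδ.trans hcard) (by simpa using hS) hrun
      have := (table_sound hw).2
      exact ⟨w, List.mem_map.2 ⟨_, hw, rfl⟩, this.1, this.2⟩)
    (by simpa using hS) (h.twoLetterStep hps hS ha)
  refine ⟨γ', ?_, hr.mono fun S₁ S₂ p _ h => ⟨(hps p).1 h.1, h.2.1,
    (_root_.mem_stackList.1 h.2.2.2.1).2, (_root_.mem_stackList.1 h.2.2.2.2).2⟩,
    effect_perm_of_weight_eq hr.allowed_of_twoLetterStep ha hw⟩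
  have hlang : starProd ((table ps sy st st.length).map Prod.snd ++ ps.map fun p => [p]) =
      blockLang ps X k := by
    rw [blockLang, blockWords, starProd_append, starProd_append, starProd_filter_ne_nil]
  rw [hlang] at hγ'
  exact mem_pow_of_le (nil_mem_starProd _) (by gcongr) hγ'

/-- The pieces of a run are replaced one by one; the ends of each piece stay the same. -/
lemma Run.exists_mem_pow_of_pieces {G : Grammar N T}
    (hG : ∀ p ∈ G.productions, terminalCount p.output ≤ 2 ∧ nonterminalCount p.output ≤ 2)
    {k : ℕ} {ps : List (Production N T)} {X : N} (hps : ∀ p, p ∈ ps ↔ p ∈ G.productions) :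
    ∀ {Bs : List (List (Production N T))} {S S' : List (Symbol T N)},
      S ∈ stackList (symbolList ps X) k →
      (∀ B ∈ Bs, ∃ b ∈ symbolList ps X, ∃ c ∈ symbolList ps X, ∀ p ∈ B, allowed b c p.output) →
      Run (BoundedStackStep G k) S Bs.flatten S' →
      ∃ γ' ∈ blockLang ps X k ^ (((stackList (symbolList ps X) k).length *
          (stackList (symbolList ps X) k).length + 1) * Bs.length),
        Run (BoundedStackStep G k) S γ' S' ∧ (effect γ').Perm (effect Bs.flatten)
  | [], S, S', _, _, h => ⟨[], by simp [Language.mem_one], h, List.Perm.refl _⟩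
  | B :: Bs, S, S', hS, hB, h => by
    obtain ⟨S₁, h₁, h₂⟩ := Run.append_iff.1 h
    obtain ⟨b, hb, c, hc, ha⟩ := hB B (by simp)
    obtain ⟨γ₁, hγ₁, hr₁, he₁⟩ := h₁.exists_mem_blockLang_pow hG hps hb hc hS ha
    obtain ⟨γ₂, hγ₂, hr₂, he₂⟩ := Run.exists_mem_pow_of_pieces hG hps (h₁.mem_stackList hps hS)
      (fun B hB' => hB B (List.mem_cons_of_mem _ hB')) h₂
    refine ⟨γ₁ ++ γ₂, ?_, hr₁.append hr₂, ?_⟩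
    · rw [List.length_cons, Nat.mul_add, mul_one, add_comm _ (_ + 1), pow_add]
      exact Language.mem_mul.2 ⟨γ₁, hγ₁, γ₂, hγ₂, rfl⟩
    · rw [effect_append, List.flatten_cons, effect_append]
      exact he₁.append he₂

/-- The bounded expression `controlExpr ps X k` captures the `k`-index language, with depth-first
control words of index `k`. -/
theorem indexLanguage_le_controlledLanguage {G : Grammar N T}
    (hG : ∀ p ∈ G.productions, terminalCount p.output ≤ 2 ∧ nonterminalCount p.output ≤ 2)
    {X : N} {a : List T} (ha : IsMinimalStrict a (G.language X)) {k : ℕ} (hk : 0 < k)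
    {ps : List (Production N T)} (hps : ∀ p, p ∈ ps ↔ p ∈ G.productions) :
    G.indexLanguage k X ≤
      G.controlledLanguage X ((controlExpr ps X k).lang ∩ G.dfControlSet k X) := by
  intro w hw
  have hwa : w ∈ (letterExpr a).lang := ha.2.1 (by
    obtain ⟨s, hs, -⟩ := hw
    exact ⟨s, hs⟩)
  have hmem := mem_of_mem_lang_letterExpr hwa
  obtain ⟨γ, hγ⟩ := Grammar.exists_trav_of_mem_indexLanguage (fun p hp => (hG p hp).2) hw
  have hrun : Run (BoundedStackStep G k) [.nonterminal X] γ [] := hγ.run (by simp)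
  obtain ⟨A, Bs, A', hγe, hA, hA', hB, hlen⟩ := hγ.cuttable (fun p hp => (hG p hp).1)
    (f := fun x => a.idxOf x) (Nat.zero_le a.length)
    (fun x hx => ⟨Nat.zero_le _, List.idxOf_le_length⟩) (pairwise_of_mem_lang_letterExpr ha.1 hwa)
  have hflat : γ = (A :: Bs ++ [A']).flatten := by simp [hγe]
  -- every index stands for a symbol; if no letter has this index, then `X` serves as a symbol that
  -- is never produced as a terminal
  have hsym : ∀ i : ℕ, ∃ b ∈ symbolList ps X, ∀ x ∈ a, a.idxOf x = i → Symbol.terminal x = b := by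
    intro i
    by_cases hi : i < a.length
    · refine ⟨.terminal a[i], ha.mem_symbolList hps (List.getElem_mem hi), ?_⟩
      rintro x hx rfl
      rw [List.getElem_idxOf]
    · refine ⟨_, nonterminal_mem_symbolList ps X, ?_⟩
      rintro x hx rfl
      exact absurd (List.idxOf_lt_length_iff.2 hx) hi
  have hpieces : ∀ B ∈ A :: Bs ++ [A'], ∃ b ∈ symbolList ps X, ∃ c ∈ symbolList ps X,
      ∀ p ∈ B, allowed b c p.output := by
    intro B hBm
    have huse : ∃ i j, UsesOnly (fun x => a.idxOf x) i j B := by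
      simp only [List.cons_append, List.mem_cons, List.mem_append, List.not_mem_nil,
        or_false] at hBm
      rcases hBm with rfl | hBm | rfl
      exacts [⟨_, _, hA⟩, hB B hBm, ⟨_, _, hA'⟩]
    obtain ⟨i, j, hij⟩ := huse
    obtain ⟨b, hb, hb'⟩ := hsym i
    obtain ⟨c, hc, hc'⟩ := hsym j
    refine ⟨b, hb, c, hc, fun p hp => List.all_eq_true.2 fun s hs => ?_⟩
    cases s with
    | nonterminal Y => simp [isNonterminal]
    | terminal x =>
      have hxB : x ∈ effect B := List.mem_flatMap.2 ⟨p, hp, mem_terminals.2 hs⟩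
      have hxa : x ∈ a := by
        refine hmem x (hγ.effect_perm.mem_iff.1 ?_)
        simp only [effect, List.mem_flatMap] at hxB ⊢
        obtain ⟨q, hq, hx⟩ := hxB
        exact ⟨q, hflat ▸ List.mem_flatten.2 ⟨B, hBm, hq⟩, hx⟩
      rcases hij x hxB with h | h
      · simp [hb' x hxa h]
      · simp [hc' x hxa h]
  rw [hflat] at hrun
  obtain ⟨γ', hγ', hrun', heff⟩ := hrun.exists_mem_pow_of_pieces hG hps
    (_root_.mem_stackList.2 ⟨by simpa using nonterminal_mem_symbolList ps X,
      by simpa using Nat.succ_le_of_lt hk⟩)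
    hpieces
  obtain ⟨hdf, s, w', hs, hd, hw'⟩ := hrun'.exists_derivation
  have hww' : w' = w := by
    refine eq_of_perm_of_mem_lang_letterExpr ha.1 (ha.2.1 ⟨s, hd⟩) hwa
      (hw'.trans (heff.trans ?_))
    rw [← hflat]
    exact hγ.effect_perm
  refine ⟨s, ⟨?_, hs ▸ hdf⟩, hww' ▸ hd⟩
  rw [hs]
  have hlang : (controlExpr ps X k).lang = blockLang ps X k ^
      (keyList (symbolList ps X) (stackList (symbolList ps X) k)).length :=
    starProd_flatMap_const _ _
  rw [hlang]
  refine mem_pow_of_le (nil_mem_starProd _) ?_ hγ'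
  refine le_trans (Nat.mul_le_mul_left _ ?_) (blocks_le_length_keyList (ha.length_lt hps)
    (length_lt_length_stackList hk))
  simp only [List.length_append, List.length_cons, List.length_nil]
  omega

lemma mem_productions_of_mem_controlWords {ps : List (Production N T)} {X : N} {k : ℕ}
    {w : List (Production N T)} (hw : w ∈ controlWords ps X k) : ∀ p ∈ w, p ∈ ps := by
  simp only [controlWords, blockWords, List.mem_flatMap, List.mem_append, List.mem_filter,
    List.mem_map] at hw
  obtain ⟨-, -, ⟨⟨e, he, rfl⟩, -⟩ | ⟨p, hp, rfl⟩⟩ := hw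
  · exact (table_sound he).2.1.mem_of_twoLetterStep
  · simpa using hp

end Cover

/-! ### Programming the machine -/

section Machine

variable {α : Type u} {β γ : Type*}

/-- The evaluation of `e` terminates with value `x` after at most `B` steps. -/
def Runs (P : Program) (env : List (ATree α)) (e : PExpr) (x : ATree α) (B : ℕ) : Prop :=
  ∃ t ≤ B, Eval P env e x t

/-- The evaluation of the body of the function `f` on the argument `x` terminates with value `y`
after at most `B` steps. -/
def Computes (P : Program) (f : ℕ) (x y : ATree α) (B : ℕ) : Prop :=
  ∃ body, P[f]? = some body ∧ Runs P [x] body y B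

variable {P : Program} {env : List (ATree α)} {e e₁ e₂ : PExpr} {x y x₁ x₂ : ATree α}
  {B B₁ B₂ : ℕ}

lemma Runs.mono (h : Runs P env e x B₁) (hB : B₁ ≤ B₂) : Runs P env e x B₂ := by
  obtain ⟨t, ht, h⟩ := h
  exact ⟨t, ht.trans hB, h⟩

lemma Computes.mono {f : ℕ} (h : Computes P f x y B₁) (hB : B₁ ≤ B₂) : Computes P f x y B₂ := by
  obtain ⟨b, hb, h⟩ := h
  exact ⟨b, hb, h.mono hB⟩

lemma Runs.var {i : ℕ} (h : env[i]? = some x) : Runs P env (.var i) x 1 := ⟨1, le_rfl, .var h⟩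

lemma Runs.nil : Runs P env .nil .nil 1 := ⟨1, le_rfl, .nil⟩

lemma Runs.pair (h₁ : Runs P env e₁ x₁ B₁) (h₂ : Runs P env e₂ x₂ B₂) :
    Runs P env (.pair e₁ e₂) (.pair x₁ x₂) (B₁ + B₂ + 1) := by
  obtain ⟨t₁, ht₁, h₁⟩ := h₁
  obtain ⟨t₂, ht₂, h₂⟩ := h₂
  exact ⟨_, by omega, .pair h₁ h₂⟩

lemma Runs.fst' (h : Runs P env e x B) : Runs P env (.fst e) x.fst (B + 1) := by
  obtain ⟨t, ht, h⟩ := h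
  exact ⟨_, by omega, .fst h⟩

lemma Runs.snd' (h : Runs P env e x B) : Runs P env (.snd e) x.snd (B + 1) := by
  obtain ⟨t, ht, h⟩ := h
  exact ⟨_, by omega, .snd h⟩

lemma Runs.fst (h : Runs P env e (.pair x y) B) : Runs P env (.fst e) x (B + 1) := h.fst'

lemma Runs.snd (h : Runs P env e (.pair x y) B) : Runs P env (.snd e) y (B + 1) := h.snd'

lemma Runs.eqAtom [DecidableEq α] {a b : α} (h₁ : Runs P env e₁ (.atom a) B₁)
    (h₂ : Runs P env e₂ (.atom b) B₂) :
    Runs P env (.eqAtom e₁ e₂) (if a = b then .tt else .nil) (B₁ + B₂ + 1) := by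
  obtain ⟨t₁, ht₁, h₁⟩ := h₁
  obtain ⟨t₂, ht₂, h₂⟩ := h₂
  split_ifs with h
  · subst h
    exact ⟨_, by omega, .eqAtom_true h₁ h₂⟩
  · refine ⟨_, by omega, .eqAtom_false h₁ h₂ ?_⟩
    rintro ⟨c, e₁, e₂⟩
    cases e₁
    cases e₂
    exact h rfl

lemma Runs.eqAtom_of_forall_ne (h₁ : Runs P env e₁ x₁ B₁) (h₂ : Runs P env e₂ x₂ B₂)
    (h : ∀ a, x₁ ≠ .atom a) : Runs P env (.eqAtom e₁ e₂) .nil (B₁ + B₂ + 1) := by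
  obtain ⟨t₁, ht₁, h₁⟩ := h₁
  obtain ⟨t₂, ht₂, h₂⟩ := h₂
  exact ⟨_, by omega, .eqAtom_false h₁ h₂ fun ⟨a, ha, _⟩ => h a ha⟩

lemma Runs.ifNil_nil (h : Runs P env e .nil B) (h₁ : Runs P env e₁ y B₁) :
    Runs P env (.ifNil e e₁ e₂) y (B + B₁ + 1) := by
  obtain ⟨t, ht, h⟩ := h
  obtain ⟨t₁, ht₁, h₁⟩ := h₁
  exact ⟨_, by omega, .ifNil_nil h h₁⟩

lemma Runs.ifNil_else (h : Runs P env e x B) (hx : x ≠ .nil) (h₂ : Runs P env e₂ y B₂) :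
    Runs P env (.ifNil e e₁ e₂) y (B + B₂ + 1) := by
  obtain ⟨t, ht, h⟩ := h
  obtain ⟨t₂, ht₂, h₂⟩ := h₂
  exact ⟨_, by omega, .ifNil_else h hx h₂⟩

lemma ATree.tt_ne_nil : (ATree.tt : ATree α) ≠ .nil := by simp [ATree.tt]

/-- Branching on a truth value. -/
lemma Runs.ifNil {c : Prop} [Decidable c] (h : Runs P env e (if c then .tt else .nil) B)
    (h₁ : ¬ c → Runs P env e₁ y B₁) (h₂ : c → Runs P env e₂ y B₂) :
    Runs P env (.ifNil e e₁ e₂) y (B + B₁ + B₂ + 1) := by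
  by_cases hc : c
  · rw [if_pos hc] at h
    exact (h.ifNil_else ATree.tt_ne_nil (h₂ hc)).mono (by omega)
  · rw [if_neg hc] at h
    exact (h.ifNil_nil (h₁ hc)).mono (by omega)

lemma Runs.bind (h₁ : Runs P env e₁ x B₁) (h₂ : Runs P (x :: env) e₂ y B₂) :
    Runs P env (.bind e₁ e₂) y (B₁ + B₂ + 1) := by
  obtain ⟨t₁, ht₁, h₁⟩ := h₁
  obtain ⟨t₂, ht₂, h₂⟩ := h₂
  exact ⟨_, by omega, .bind h₁ h₂⟩

lemma Runs.call {f : ℕ} (h₁ : Runs P env e x B₁) (h₂ : Computes P f x y B₂) :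
    Runs P env (.call f e) y (B₁ + B₂ + 1) := by
  obtain ⟨t₁, ht₁, h₁⟩ := h₁
  obtain ⟨b, hb, t₂, ht₂, h₂⟩ := h₂
  exact ⟨_, by omega, .call h₁ hb h₂⟩

/-! ### Recursion on lists -/

/-- The body of a function, with number `self`, on pairs of a context and a list that recurs on
the list: `base` is its value at the empty list and may use the argument; `step` may use the value
at the tail and the argument, which are the variables `0` and `1`. -/
def foldBody (self : ℕ) (base step : PExpr) : PExpr :=
  .ifNil (.snd (.var 0)) base
    (.bind (.call self (.pair (.fst (.var 0)) (.snd (.snd (.var 0))))) step)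

/-- In the step of a recursion: the value at the tail. -/
def foldAcc : PExpr := .var 0

/-- In the step of a recursion: the context. -/
def foldCtx : PExpr := .fst (.var 1)

/-- In the step of a recursion: the head of the list. -/
def foldHead : PExpr := .fst (.snd (.var 1))

/-- In the base case of a recursion: the context. -/
def baseCtx : PExpr := .fst (.var 0)

variable {a c h t : ATree α}

lemma runs_foldAcc : Runs P [a, .pair c (.pair h t)] foldAcc a 1 := .var rfl

lemma runs_foldCtx : Runs P [a, .pair c (.pair h t)] foldCtx c 2 := (Runs.var rfl).fst

lemma runs_foldHead : Runs P [a, .pair c (.pair h t)] foldHead h 3 := ((Runs.var rfl).snd).fst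

lemma runs_baseCtx : Runs P [.pair c t] baseCtx c 2 := (Runs.var rfl).fst

lemma Computes.fold {self : ℕ} {base step : PExpr} (hf : P[self]? = some (foldBody self base step))
    {enc : β → ATree α} {ctx : ATree α} {R : List β → ATree α} {Bb Bs : ℕ}
    (hb : Runs P [.pair ctx .nil] base (R []) Bb) : ∀ {l : List β},
    (∀ x l', x :: l' <:+ l → Runs P [R l', .pair ctx (.pair (enc x) (encList enc l'))] step
      (R (x :: l')) Bs) →
    Computes P self (.pair ctx (encList enc l)) (R l) (l.length * (Bs + 12) + Bb + 4)
  | [], _ => ⟨_, hf, (Runs.ifNil_nil ((Runs.var rfl).snd) hb).mono (by simp; omega)⟩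
  | x :: l, hs => by
    refine ⟨_, hf, ?_⟩
    have ih := Computes.fold hf hb (l := l) fun y l' hl =>
      hs y l' (hl.trans (List.suffix_cons x l))
    have h1 : Runs P [.pair ctx (encList enc (x :: l))] (.snd (.var 0))
      (.pair (enc x) (encList enc l)) 2 := (Runs.var rfl).snd
    have h2 : Runs P [.pair ctx (encList enc (x :: l))]
        (.pair (.fst (.var 0)) (.snd (.snd (.var 0)))) (.pair ctx (encList enc l)) 6 :=
      ((Runs.var rfl).fst).pair h1.snd
    refine (Runs.ifNil_else h1 (by simp) (Runs.bind (h2.call ih)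
      (hs x l (List.suffix_refl _)))).mono ?_
    simp only [List.length_cons]
    linarith [add_mul l.length 1 (Bs + 12)]

/-- The running times are bounded by powers of a fixed number `m`, which is large compared to the
constants of the single steps. -/
lemma Computes.fold_pow {m : ℕ} (hm : 1024 ≤ m) {self : ℕ} {base step : PExpr}
    (hf : P[self]? = some (foldBody self base step))
    {enc : β → ATree α} {ctx : ATree α} (R : List β → ATree α) {i j : ℕ} {l : List β}
    (hl : l.length ≤ m ^ i) (hb : Runs P [.pair ctx .nil] base (R []) (m ^ j))
    (hs : ∀ x l', x :: l' <:+ l → Runs P [R l', .pair ctx (.pair (enc x) (encList enc l'))] step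
      (R (x :: l')) (m ^ j)) :
    Computes P self (.pair ctx (encList enc l)) (R l) (m ^ (i + j + 1)) := by
  refine (Computes.fold hf hb hs).mono ?_
  have h1 : 1 ≤ m ^ i := Nat.one_le_pow _ _ (by omega)
  have h2 : 1 ≤ m ^ j := Nat.one_le_pow _ _ (by omega)
  have h3 : l.length * (m ^ j + 12) ≤ m ^ i * (13 * m ^ j) := Nat.mul_le_mul hl (by omega)
  have h4 : m ^ j ≤ m ^ i * m ^ j := Nat.le_mul_of_pos_left _ h1
  calc l.length * (m ^ j + 12) + m ^ j + 4 ≤ 18 * (m ^ i * m ^ j) := by linarith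
    _ ≤ m * (m ^ i * m ^ j) := Nat.mul_le_mul_right _ (by omega)
    _ = m ^ (i + j + 1) := by ring

lemma const_mul_pow_le {m : ℕ} (hm : 1024 ≤ m) {c i j : ℕ} (hc : c ≤ 1024) (hij : i < j) :
    c * m ^ i ≤ m ^ j :=
  calc c * m ^ i ≤ m * m ^ i := Nat.mul_le_mul_right _ (hc.trans hm)
    _ = m ^ (i + 1) := by ring
    _ ≤ m ^ j := Nat.pow_le_pow_right (by omega) hij

/-! ### Encodings -/

/-- Encoding of a pair. -/
def encPair (f : β → ATree α) (g : γ → ATree α) (x : β × γ) : ATree α := .pair (f x.1) (g x.2)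

lemma encPair_injective {f : β → ATree α} {g : γ → ATree α} (hf : f.Injective)
    (hg : g.Injective) : (encPair f g).Injective := by
  rintro ⟨a, b⟩ ⟨c, d⟩ h
  simp only [encPair, ATree.pair.injEq] at h
  exact Prod.ext (hf h.1) (hg h.2)

lemma encList_injective {f : β → ATree α} (hf : f.Injective) : (encList f).Injective := by
  intro l
  induction l with
  | nil => rintro (_ | ⟨b, l'⟩) h <;> simp_all [encList]
  | cons a l ih =>
    rintro (_ | ⟨b, l'⟩) h
    · simp [encList] at h
    · simp only [encList, ATree.pair.injEq] at h
      rw [hf h.1, ih h.2]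

lemma size_encList_le {f : β → ATree α} {s : ℕ} : ∀ {l : List β}, (∀ x ∈ l, (f x).size ≤ s) →
    (encList f l).size ≤ l.length * (s + 1) + 1
  | [], _ => by simp [encList, ATree.size]
  | x :: l, h => by
    have h1 := h x (by simp)
    have h2 := size_encList_le (l := l) fun y hy => h y (List.mem_cons_of_mem _ hy)
    simp only [encList, ATree.size, List.length_cons]
    linarith [add_mul l.length 1 (s + 1)]

end Machine

section Library

variable {α : Type u} {β γ : Type*} {P : Program}

/-- Concatenation: the pair of `l₂` and `l₁` is mapped to `l₁ ++ l₂`. -/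
def appendBody (self : ℕ) : PExpr := foldBody self baseCtx (.pair foldHead foldAcc)

lemma computes_append {self : ℕ} (hf : P[self]? = some (appendBody self)) (enc : β → ATree α)
    {l₁ l₂ : List β} : Computes P self (.pair (encList enc l₂) (encList enc l₁))
      (encList enc (l₁ ++ l₂)) (l₁.length * 17 + 6) := by
  refine (Computes.fold hf (R := fun l => encList enc (l ++ l₂)) (Bs := 5) runs_baseCtx
    fun x l' _ => ?_)
  exact (runs_foldHead.pair runs_foldAcc)

/-- Equality of two trees.  The machine has no test for atoms, but a tree is an atom if and only if
`eqAtom` finds it equal to itself. -/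
def eqBody (self : ℕ) : PExpr :=
  .ifNil (.eqAtom (.fst (.var 0)) (.fst (.var 0)))
    (.ifNil (.eqAtom (.snd (.var 0)) (.snd (.var 0)))
      (.ifNil (.fst (.var 0))
        (.ifNil (.snd (.var 0)) (.pair .nil .nil) .nil)
        (.ifNil (.snd (.var 0)) .nil
          (.ifNil (.call self (.pair (.fst (.fst (.var 0))) (.fst (.snd (.var 0))))) .nil
            (.call self (.pair (.snd (.fst (.var 0))) (.snd (.snd (.var 0))))))))
      .nil)
    (.eqAtom (.fst (.var 0)) (.snd (.var 0)))

lemma computes_eq [DecidableEq α] [DecidableEq (ATree α)] {self : ℕ}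
    (hf : P[self]? = some (eqBody self)) : ∀ {x y : ATree α},
      Computes P self (.pair x y) (if x = y then .tt else .nil) (60 * x.size) := by
  intro x
  have hx : ∀ x y : ATree α, Runs P [.pair x y] (.fst (.var 0)) x 2 := fun x y => (Runs.var rfl).fst
  have hy : ∀ x y : ATree α, Runs P [.pair x y] (.snd (.var 0)) y 2 := fun x y => (Runs.var rfl).snd
  have atom_ne : ∀ {x : ATree α}, (∀ a, x ≠ .atom a) → ∀ y,
      Runs P [.pair x y] (.eqAtom (.fst (.var 0)) (.fst (.var 0))) .nil 5 :=
    fun h y => (hx _ y).eqAtom_of_forall_ne (hx _ y) h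
  have atom_ne' : ∀ {y : ATree α}, (∀ a, y ≠ .atom a) → ∀ x,
      Runs P [.pair x y] (.eqAtom (.snd (.var 0)) (.snd (.var 0))) .nil 5 :=
    fun h x => (hy x _).eqAtom_of_forall_ne (hy x _) h
  have atom_eq : ∀ (a : α) x,
      Runs P [.pair x (.atom a)] (.eqAtom (.snd (.var 0)) (.snd (.var 0))) .tt 5 :=
    fun a x => by simpa using (hy x (.atom a)).eqAtom (hy x (.atom a))
  induction x with
  | atom a =>
    intro y
    refine ⟨_, hf, ?_⟩
    have h1 : Runs P [.pair (.atom a) y] (.eqAtom (.fst (.var 0)) (.fst (.var 0))) .tt 5 := by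
      simpa using (hx (.atom a) y).eqAtom (hx (.atom a) y)
    have h2 : Runs P [.pair (.atom a) y] (.eqAtom (.fst (.var 0)) (.snd (.var 0)))
        (if ATree.atom a = y then .tt else .nil) 5 := by
      cases y with
      | atom b => simpa using (hx (.atom a) (.atom b)).eqAtom (hy (.atom a) (.atom b))
      | nil =>
        obtain ⟨t₁, ht₁, h₁⟩ := hx (.atom a) .nil
        obtain ⟨t₂, ht₂, h₂⟩ := hy (.atom a) .nil
        rw [if_neg (by simp)]
        exact ⟨_, by omega, .eqAtom_false h₁ h₂ (by simp)⟩
      | pair c d =>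
        obtain ⟨t₁, ht₁, h₁⟩ := hx (.atom a) (.pair c d)
        obtain ⟨t₂, ht₂, h₂⟩ := hy (.atom a) (.pair c d)
        rw [if_neg (by simp)]
        exact ⟨_, by omega, .eqAtom_false h₁ h₂ (by simp)⟩
    exact (h1.ifNil_else ATree.tt_ne_nil h2).mono (by simp [ATree.size])
  | nil =>
    intro y
    refine ⟨_, hf, ?_⟩
    have h1 := atom_ne (x := .nil) (by simp) y
    cases y with
    | atom b =>
      rw [if_neg (by simp)]
      exact (h1.ifNil_nil ((atom_eq b _).ifNil_else ATree.tt_ne_nil .nil)).mono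
        (by simp [ATree.size])
    | nil =>
      rw [if_pos rfl]
      exact (h1.ifNil_nil ((atom_ne' (by simp) _).ifNil_nil ((hx _ _).ifNil_nil
        ((hy _ _).ifNil_nil (Runs.nil.pair .nil))))).mono (by simp [ATree.size])
    | pair c d =>
      rw [if_neg (by simp)]
      exact (h1.ifNil_nil ((atom_ne' (by simp) _).ifNil_nil ((hx _ _).ifNil_nil
        ((hy _ _).ifNil_else (by simp) .nil)))).mono (by simp [ATree.size])
  | pair a b iha ihb =>
    intro y
    refine ⟨_, hf, ?_⟩
    have h1 := atom_ne (x := .pair a b) (by simp) y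
    cases y with
    | atom b =>
      rw [if_neg (by simp)]
      exact (h1.ifNil_nil ((atom_eq b _).ifNil_else ATree.tt_ne_nil .nil)).mono
        (by simp only [ATree.size]; omega)
    | nil =>
      rw [if_neg (by simp)]
      exact (h1.ifNil_nil ((atom_ne' (by simp) _).ifNil_nil ((hx _ _).ifNil_else (by simp)
        ((hy _ _).ifNil_nil .nil)))).mono (by simp only [ATree.size]; omega)
    | pair c d =>
      have h2 := ((hx (.pair a b) (.pair c d)).fst.pair (hy (.pair a b) (.pair c d)).fst).call
        (iha (y := c))
      have h3 := ((hx (.pair a b) (.pair c d)).snd.pair (hy (.pair a b) (.pair c d)).snd).call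
        (ihb (y := d))
      have h4 := h2.ifNil (e₁ := .nil) (B₁ := 1)
        (y := if ATree.pair a b = .pair c d then (ATree.tt : ATree α) else .nil)
        (fun hac => by rw [if_neg (by simp [hac])]; exact .nil)
        (fun hac => by simpa [hac] using h3)
      exact (h1.ifNil_nil ((atom_ne' (by simp) _).ifNil_nil ((hx _ _).ifNil_else (by simp)
        ((hy _ _).ifNil_else (by simp) h4)))).mono (by simp only [ATree.size]; omega)

/-- The list of the pairs of the context with the elements of a list. -/
def pairWithBody (self : ℕ) : PExpr :=
  foldBody self .nil (.pair (.pair foldCtx foldHead) foldAcc)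

lemma computes_pairWith {self : ℕ} (hf : P[self]? = some (pairWithBody self)) (f : β → ATree α)
    (g : γ → ATree α) {b : β} {l : List γ} :
    Computes P self (.pair (f b) (encList g l)) (encList (encPair f g) (l.map (Prod.mk b)))
      (l.length * 20 + 5) := by
  refine Computes.fold hf (R := fun l => encList (encPair f g) (l.map (Prod.mk b))) (Bs := 8) .nil
    fun x l' _ => ?_
  exact (runs_foldCtx.pair runs_foldHead).pair runs_foldAcc

/-- The product of two lists: the pair of `l₂` and `l₁` is mapped to `l₁ ×ˢ l₂`. -/
def productBody (self append pairWith : ℕ) : PExpr :=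
  foldBody self .nil
    (.call append (.pair foldAcc (.call pairWith (.pair foldHead foldCtx))))

lemma computes_product {self append pairWith : ℕ}
    (hf : P[self]? = some (productBody self append pairWith))
    (ha : P[append]? = some (appendBody append))
    (hp : P[pairWith]? = some (pairWithBody pairWith)) (f : β → ATree α) (g : γ → ATree α)
    {l₁ : List β} {l₂ : List γ} :
    Computes P self (.pair (encList g l₂) (encList f l₁)) (encList (encPair f g) (l₁ ×ˢ l₂))
      (l₁.length * (l₂.length * 37 + 40) + 5) := by
  refine (Computes.fold hf (R := fun l : List β => encList (encPair f g) (l ×ˢ l₂))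
    (Bs := l₂.length * 37 + 25) .nil fun x l' _ => ?_).mono ?_
  · rw [List.product_cons]
    refine ((runs_foldAcc.pair ((runs_foldHead.pair runs_foldCtx).call
      (computes_pairWith hp f g))).call (computes_append ha _)).mono ?_
    rw [List.length_map]
    omega
  · have : l₁.length * (l₂.length * 37 + 25 + 12) ≤ l₁.length * (l₂.length * 37 + 40) :=
      Nat.mul_le_mul_left _ (by omega)
    omega

end Library

/-! ### The program -/

section Programs

/-- Maps the pair of `u` and a list of productions to the list of their symbols, followed
by `u`. -/
def symbolsBody : PExpr := foldBody 5 baseCtx (.call 1 (.pair foldAcc foldHead))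

/-- Maps the pair of a list of symbols and `k` to the list of the words of length at most `k`. -/
def stacksBody : PExpr :=
  foldBody 6 (.pair .nil .nil) (.pair .nil (.call 4 (.pair foldAcc foldCtx)))

/-- Maps a list of length `n` to the numbers from `2 * n` down to `0`. -/
def numbersBody : PExpr :=
  foldBody 7 (.pair .nil .nil)
    (.pair (.pair .nil (.pair .nil (.fst foldAcc))) (.pair (.pair .nil (.fst foldAcc)) foldAcc))

/-- Looks up a key in a table. -/
def findBody : PExpr :=
  foldBody 8 .nil (.ifNil (.call 2 (.pair foldCtx (.fst foldHead))) foldAcc (.pair foldHead .nil))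

/-- Tests whether all terminals of a word are among two given symbols. -/
def allowedBody : PExpr :=
  foldBody 9 (.pair .nil .nil)
    (.ifNil foldAcc .nil
      (.ifNil (.fst foldHead)
        (.ifNil (.call 2 (.pair foldHead (.fst foldCtx))) (.call 2 (.pair foldHead (.snd foldCtx)))
          (.pair .nil .nil))
        (.pair .nil .nil)))

/-- Adds the number of occurrences of a symbol in a word to a number. -/
def countBody : PExpr :=
  foldBody 10 (.snd baseCtx)
    (.ifNil (.call 2 (.pair foldHead (.fst foldCtx))) foldAcc (.pair .nil foldAcc))

/-- Puts the nonterminals of a word in front of a stack. -/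
def nonterminalsBody : PExpr :=
  foldBody 11 baseCtx (.ifNil (.fst foldHead) foldAcc (.pair foldHead foldAcc))

/-- The nonterminals of a word in reverse order. -/
def reverseNonterminalsBody : PExpr :=
  foldBody 12 .nil
    (.ifNil (.fst foldHead) foldAcc (.call 1 (.pair (.pair foldHead .nil) foldAcc)))

/-- The function `extendTo`, on an entry, a production and a stack. -/
def extendToBody : PExpr :=
  let e : PExpr := .fst (.var 0)
  let p : PExpr := .fst (.snd (.var 0))
  let S : PExpr := .snd (.snd (.var 0))
  let b : PExpr := .fst (.fst e)
  let c : PExpr := .fst (.snd (.fst e))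
  let S₀ : PExpr := .fst (.snd (.snd (.fst e)))
  let xy : PExpr := .snd (.snd (.snd (.snd (.fst e))))
  .pair (.pair b (.pair c (.pair S₀ (.pair S (.pair
      (.call 10 (.pair (.pair b (.fst xy)) (.snd p)))
      (.call 10 (.pair (.pair c (.snd xy)) (.snd p))))))))
    (.call 1 (.pair (.pair p .nil) (.snd e)))

/-- The function `extensions`, on an entry and a production. -/
def extensionsBody : PExpr :=
  let e : PExpr := .fst (.var 0)
  let p : PExpr := .snd (.var 0)
  let b : PExpr := .fst (.fst e)
  let c : PExpr := .fst (.snd (.fst e))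
  let S : PExpr := .fst (.snd (.snd (.snd (.fst e))))
  .ifNil S .nil
    (.ifNil (.call 2 (.pair (.fst S) (.fst p))) .nil
      (.ifNil (.call 9 (.pair (.pair b c) (.snd p))) .nil
        (.pair (.call 13 (.pair e (.pair p (.call 11 (.pair (.snd S) (.snd p))))))
          (.pair (.call 13 (.pair e (.pair p
            (.call 1 (.pair (.snd S) (.call 12 (.pair .nil (.snd p))))))))
          .nil))))

/-- The extensions of an entry by all productions of a list. -/
def allExtensionsBody : PExpr :=
  foldBody 15 .nil (.call 1 (.pair foldAcc (.call 14 (.pair foldCtx foldHead))))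

/-- The function `candidates`. -/
def candidatesBody : PExpr :=
  foldBody 16 .nil
    (.call 1 (.pair foldAcc (.pair foldHead (.call 15 (.pair foldHead foldCtx)))))

/-- The function `select`. -/
def selectBody : PExpr :=
  foldBody 17 .nil (.call 1 (.pair foldAcc (.call 8 (.pair foldHead foldCtx))))

/-- The function `table`, on the productions, the keys, the initial table and the stacks. -/
def tableBody : PExpr :=
  foldBody 18 (.snd (.snd baseCtx))
    (.call 17 (.pair (.call 16 (.pair (.fst foldCtx) foldAcc)) (.fst (.snd foldCtx))))

/-- The initial table, from the list of the triples of two symbols and a stack. -/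
def initialBody : PExpr :=
  let b : PExpr := .fst foldHead
  let c : PExpr := .fst (.snd foldHead)
  let S : PExpr := .snd (.snd foldHead)
  foldBody 19 .nil
    (.pair (.pair (.pair b (.pair c (.pair S (.pair S (.pair .nil .nil))))) .nil) foldAcc)

/-- Puts the nonempty control words of a table in front of a list. -/
def wordsBody : PExpr :=
  foldBody 20 baseCtx (.ifNil (.snd foldHead) foldAcc (.pair (.snd foldHead) foldAcc))

/-- The productions as words of length one. -/
def singlesBody : PExpr := foldBody 21 .nil (.pair (.pair foldHead .nil) foldAcc)

/-- Repeats a list once for each element of another list. -/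
def repeatBody : PExpr := foldBody 22 .nil (.call 1 (.pair foldAcc foldCtx))

/-- The list `controlWords`, from the input.  The bindings hold, in this order, the symbols, the
stacks, the numbers, the keys, the initial table, the final table and the words of a block; each
binding shifts the indices of the earlier variables by one. -/
def controlWordsBody : PExpr :=
  .bind (.call 5 (.pair (.pair (.fst (.snd (.var 0))) .nil) (.fst (.var 0))))
  (.bind (.call 6 (.pair (.var 0) (.snd (.snd (.snd (.var 1))))))
  (.bind (.call 7 (.pair .nil (.var 0)))
  (.bind (.call 4 (.pair (.call 4 (.pair (.call 4 (.pair (.call 4 (.pair (.call 4 (.pair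
    (.var 0) (.var 0))) (.var 1))) (.var 1))) (.var 2))) (.var 2)))
  (.bind (.call 19 (.pair .nil
    (.call 4 (.pair (.call 4 (.pair (.var 2) (.var 3))) (.var 3)))))
  (.bind (.call 18 (.pair (.pair (.fst (.var 5)) (.pair (.var 1) (.var 0))) (.var 3)))
  (.bind (.call 20 (.pair (.call 21 (.pair .nil (.fst (.var 6)))) (.var 0)))
  (.call 22 (.pair (.var 0) (.var 3)))))))))

/-- The program with main function `main`, followed by the functions above. -/
def withLibrary (main : PExpr) : Program :=
  [main, appendBody 1, eqBody 2, pairWithBody 3, productBody 4 1 3, symbolsBody, stacksBody,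
    numbersBody, findBody, allowedBody, countBody, nonterminalsBody, reverseNonterminalsBody,
    extendToBody, extensionsBody, allExtensionsBody, candidatesBody, selectBody, tableBody,
    initialBody, wordsBody, singlesBody, repeatBody, controlWordsBody]

end Programs

section Encodings

variable {N : Type u} {T : Type v}

/-- Encoding of a word of symbols. -/
def encStack : List (Symbol T N) → ATree (Symbol T N) := encList encSymbol

/-- Encoding of a control word. -/
def encWord : List (Production N T) → ATree (Symbol T N) := encList encProduction

/-- Encoding of a key. -/
def encKey : Key N T → ATree (Symbol T N) :=
  encPair encSymbol (encPair encSymbol (encPair encStack (encPair encStack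
    (encPair encNat encNat))))

/-- Encoding of an entry. -/
def encEntry : Entry N T → ATree (Symbol T N) := encPair encKey encWord

lemma encSymbol_injective :
    Function.Injective (encSymbol : Symbol T N → ATree (Symbol T N)) := by
  intro x y h
  simp only [encSymbol, ATree.pair.injEq, ATree.atom.injEq] at h
  exact h.2

lemma encNat_injective : Function.Injective (encNat : ℕ → ATree (Symbol T N)) := by
  intro i
  induction i with
  | zero =>
    rintro (_ | j) h
    · rfl
    · simp [encNat, encList, List.replicate_succ] at h
  | succ i ih =>
    rintro (_ | j) h
    · simp [encNat, encList, List.replicate_succ] at h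
    · simp only [encNat, encList, List.replicate_succ, ATree.pair.injEq, true_and] at h
      rw [ih h]

lemma encKey_injective : Function.Injective (encKey : Key N T → ATree (Symbol T N)) :=
  encPair_injective encSymbol_injective (encPair_injective encSymbol_injective
    (encPair_injective (encList_injective encSymbol_injective)
      (encPair_injective (encList_injective encSymbol_injective)
        (encPair_injective encNat_injective encNat_injective))))

lemma size_encSymbol_le (x : Symbol T N) : (encSymbol x).size ≤ 5 := by
  cases x <;> simp [encSymbol, isNonterminal, ATree.size, ATree.tt]

lemma size_encStack_le (S : List (Symbol T N)) : (encStack S).size ≤ S.length * 6 + 1 :=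
  size_encList_le fun x _ => size_encSymbol_le x

lemma size_encNat (i : ℕ) : (encNat i : ATree (Symbol T N)).size = 2 * i + 1 := by
  induction i with
  | zero => rfl
  | succ i ih =>
    have : (encNat (i + 1) : ATree (Symbol T N)) = .pair .nil (encNat i) := rfl
    rw [this]
    simp only [ATree.size, ih]
    ring

lemma size_encProduction_le (p : Production N T) :
    (encProduction p).size ≤ p.output.length * 6 + 7 := by
  have h1 := size_encSymbol_le (.nonterminal p.input : Symbol T N)
  have h2 := size_encStack_le p.output
  unfold encStack at h2
  simp only [encProduction, ATree.size]
  omega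

lemma encList_map {α : Type*} {β γ : Type*} (f : γ → ATree α) (g : β → γ) (l : List β) :
    encList f (l.map g) = encList (fun x => f (g x)) l := by
  induction l with
  | nil => rfl
  | cons x l ih => simp [encList, ih]

lemma computes_eq_of_injective {α : Type*} {β : Type*} [DecidableEq β] {P : Program} {self : ℕ}
    (hf : P[self]? = some (eqBody self)) {f : β → ATree α} (h : f.Injective) (x y : β) :
    Computes P self (.pair (f x) (f y)) (if x = y then .tt else .nil) (60 * (f x).size) := by
  classical
  have := computes_eq hf (x := f x) (y := f y)
  simpa only [h.eq_iff] using this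

end Encodings

/-! ### Correctness and running time of the program -/

section ProgramCorrectness

variable {N : Type u} {T : Type v} {main : PExpr} {m : ℕ}

/-- The sizes of all lists are measured against a number `m ≥ 1024` and all running times are bounded
by powers of `m`; raising the exponent absorbs constants. -/
lemma const_le_pow (hm : 1024 ≤ m) {c j : ℕ} (hc : c ≤ 1024) (hj : 0 < j) : c ≤ m ^ j := by
  simpa using const_mul_pow_le hm hc hj

lemma computes_symbols (hm : 1024 ≤ m) (X : N) {ps : List (Production N T)} (hps : ps.length ≤ m)
    (hout : ∀ p ∈ ps, p.output.length < m) :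
    Computes (withLibrary main) 5
      (.pair (encStack [Symbol.nonterminal X]) (encList encProduction ps))
      (encStack (symbolList ps X)) (m ^ 4) := by
  refine Computes.fold_pow hm rfl (fun l => encStack (symbolList l X)) (i := 1) (j := 2)
    (by simpa using hps) (runs_baseCtx.mono (const_le_pow hm (by norm_num) (by norm_num)))
    fun p l hl => ?_
  have e : symbolList (p :: l) X = (.nonterminal p.input :: p.output) ++ symbolList l X := by
    simp [symbolList]
  rw [e]
  refine ((runs_foldAcc.pair runs_foldHead).call
    (computes_append (P := withLibrary main) (self := 1)
      (l₁ := .nonterminal p.input :: p.output) rfl encSymbol)).mono ?_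
  have h1 := hout p (hl.subset (by simp))
  have h2 := const_mul_pow_le hm (c := 1024) (i := 1) (j := 2) le_rfl (by norm_num)
  rw [pow_one] at h2
  simp only [List.length_cons]
  omega

lemma computes_stacks (hm : 1024 ≤ m) {sy : List (Symbol T N)} {k : ℕ} (hk : k ≤ m)
    (hsy : sy.length ≤ m) (hst : ∀ j ≤ k, (stackList sy j).length ≤ m) :
    Computes (withLibrary main) 6 (.pair (encStack sy) (encNat k))
      (encList encStack (stackList sy k)) (m ^ 5) := by
  have := Computes.fold_pow (P := withLibrary main) hm (self := 6) rfl
    (enc := fun _ : Unit => (.nil : ATree (Symbol T N))) (ctx := encStack sy)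
    (fun l => encList encStack (stackList sy l.length)) (i := 1) (j := 3)
    (l := List.replicate k ()) (by simpa using hk)
    ((Runs.nil.pair .nil).mono (const_le_pow hm (by norm_num) (by norm_num))) ?_
  · rw [List.length_replicate] at this
    exact this
  intro _ l hl
  have e : encList encStack (stackList sy (l.length + 1)) =
      .pair .nil (encList (encPair encSymbol encStack) (sy ×ˢ stackList sy l.length)) := by
    rw [stackList, encList, encList_map]
    rfl
  have hl' : l.length ≤ k := by
    have := hl.length_le
    simp only [List.length_cons, List.length_replicate] at this
    omega
  have h0 := hst _ hl'
  rw [List.length_cons, e]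
  refine (Runs.nil.pair ((runs_foldAcc.pair runs_foldCtx).call
    (computes_product (self := 4) (append := 1) (pairWith := 3) rfl rfl rfl _ _))).mono ?_
  have h1 : sy.length * ((stackList sy l.length).length * 37 + 40) ≤ m * (m * 37 + 40) := by
    gcongr
  have h2 := const_mul_pow_le hm (c := 100) (i := 2) (j := 3) (by norm_num) (by norm_num)
  have h3 : m * (m * 37 + 40) = 37 * m ^ 2 + 40 * m := by ring
  have h4 := const_mul_pow_le hm (c := 1024) (i := 1) (j := 2) (by norm_num) (by norm_num)
  rw [pow_one] at h4
  omega

lemma numberList_eq_cons (n : ℕ) : ∃ l, numberList n = 2 * n :: l := by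
  cases n
  exacts [⟨[], rfl⟩, ⟨_, rfl⟩]

lemma computes_numbers (hm : 1024 ≤ m) {st : List (List (Symbol T N))} (hst : st.length ≤ m) :
    Computes (withLibrary main) 7 (.pair .nil (encList encStack st))
      (encList encNat (numberList st.length)) (m ^ 3) := by
  refine Computes.fold_pow hm rfl (fun l => encList encNat (numberList l.length)) (i := 1) (j := 1)
    (by simpa using hst) ((Runs.nil.pair .nil).mono (const_le_pow hm (by norm_num) (by norm_num)))
    fun S l _ => ?_
  obtain ⟨l', hl'⟩ := numberList_eq_cons l.length
  have e : (encList encNat (numberList (S :: l).length) : ATree (Symbol T N)) =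
      .pair (.pair .nil (.pair .nil (encNat (2 * l.length))))
        (.pair (.pair .nil (encNat (2 * l.length))) (encList encNat (numberList l.length))) := rfl
  rw [e, hl']
  refine ((Runs.nil.pair (Runs.nil.pair runs_foldAcc.fst)).pair
    ((Runs.nil.pair runs_foldAcc.fst).pair runs_foldAcc)).mono
      (const_le_pow hm (by norm_num) (by norm_num))

lemma computes_initial (hm : 1024 ≤ m) {sy : List (Symbol T N)} {st : List (List (Symbol T N))}
    (hsy : sy.length ≤ m) (hst : st.length ≤ m) :
    Computes (withLibrary main) 19
      (.pair .nil (encList (encPair encSymbol (encPair encSymbol encStack)) (sy ×ˢ (sy ×ˢ st))))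
      (encList encEntry (initialTable sy st)) (m ^ 5) := by
  have hlen : (sy ×ˢ (sy ×ˢ st)).length ≤ m ^ 3 := by
    simp only [List.length_product]
    calc sy.length * (sy.length * st.length) ≤ m * (m * m) := by gcongr
      _ = m ^ 3 := by ring
  refine Computes.fold_pow (P := withLibrary main) hm (self := 19) rfl
    (fun l : List (Symbol T N × Symbol T N × List (Symbol T N)) => encList encEntry
      (l.map fun x => ((x.1, x.2.1, x.2.2, x.2.2, 0, 0), []))) (i := 3) (j := 1) hlen
    (Runs.nil.mono (const_le_pow hm (by norm_num) (by norm_num))) fun x l _ => ?_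
  obtain ⟨b, c, S⟩ := x
  have hhead : Runs (withLibrary main)
      [encList encEntry (l.map fun x => ((x.1, x.2.1, x.2.2, x.2.2, 0, 0), [])),
        .pair .nil (.pair (encPair encSymbol (encPair encSymbol encStack) (b, c, S))
          (encList (encPair encSymbol (encPair encSymbol encStack)) l))] foldHead
      (.pair (encSymbol b) (.pair (encSymbol c) (encStack S))) 3 := runs_foldHead
  exact (((hhead.fst.pair (hhead.snd.fst.pair (hhead.snd.snd.pair (hhead.snd.snd.pair
    (Runs.nil.pair .nil))))).pair .nil).pair runs_foldAcc).mono
      (const_le_pow hm (by norm_num) (by norm_num))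

lemma computes_words (hm : 1024 ≤ m) {ws : List (List (Production N T))} {C : List (Entry N T)}
    (hC : C.length ≤ m ^ 6) :
    Computes (withLibrary main) 20 (.pair (encList encWord ws) (encList encEntry C))
      (encList encWord ((C.map Prod.snd).filter (fun w => !w.isEmpty) ++ ws)) (m ^ 8) := by
  refine Computes.fold_pow hm rfl (fun l : List (Entry N T) => encList encWord
    ((l.map Prod.snd).filter (fun w => !w.isEmpty) ++ ws)) (i := 6) (j := 1) hC
    (runs_baseCtx.mono (const_le_pow hm (by norm_num) (by norm_num))) fun e l _ => ?_
  obtain ⟨κ, w⟩ := e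
  have hhead : Runs (withLibrary main)
      [encList encWord ((l.map Prod.snd).filter (fun w => !w.isEmpty) ++ ws),
        .pair (encList encWord ws) (.pair (encEntry (κ, w)) (encList encEntry l))] foldHead
      (.pair (encKey κ) (encWord w)) 3 := runs_foldHead
  cases w with
  | nil =>
    exact (hhead.snd.ifNil_nil runs_foldAcc).mono (const_le_pow hm (by norm_num) (by norm_num))
  | cons p w =>
    exact (hhead.snd.ifNil_else (by simp [encWord, encList])
      (hhead.snd.pair runs_foldAcc)).mono (const_le_pow hm (by norm_num) (by norm_num))

lemma computes_singles (hm : 1024 ≤ m) {ps : List (Production N T)} (hps : ps.length ≤ m) :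
    Computes (withLibrary main) 21 (.pair .nil (encList encProduction ps))
      (encList encWord (ps.map fun p => [p])) (m ^ 3) := by
  refine Computes.fold_pow hm rfl (fun l : List (Production N T) => encList encWord
    (l.map fun p => [p])) (i := 1) (j := 1) (by simpa using hps)
    (Runs.nil.mono (const_le_pow hm (by norm_num) (by norm_num))) fun p l _ => ?_
  exact ((runs_foldHead.pair .nil).pair runs_foldAcc).mono
    (const_le_pow hm (by norm_num) (by norm_num))

lemma computes_repeat (hm : 1024 ≤ m) {ws : List (List (Production N T))} (hws : ws.length ≤ m ^ 7)
    {K : List (Key N T)} (hK : K.length ≤ m ^ 6) :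
    Computes (withLibrary main) 22 (.pair (encList encWord ws) (encList encKey K))
      (encList encWord (K.flatMap fun _ => ws)) (m ^ 15) := by
  refine Computes.fold_pow hm rfl (fun l : List (Key N T) => encList encWord
    (l.flatMap fun _ => ws)) (i := 6) (j := 8) hK
    (Runs.nil.mono (const_le_pow hm (by norm_num) (by norm_num))) fun p l _ => ?_
  refine ((runs_foldAcc.pair runs_foldCtx).call
    (computes_append (self := 1) rfl encWord)).mono ?_
  have h2 := const_mul_pow_le hm (c := 100) (i := 7) (j := 8) (by norm_num) (by norm_num)
  have h3 := const_le_pow hm (c := 1024) (j := 7) (by norm_num) (by norm_num)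
  omega

lemma nonterminals_cons (x : Symbol T N) (u : List (Symbol T N)) :
    nonterminals (x :: u) =
      if isNonterminal x = true then x :: nonterminals u else nonterminals u := by
  simp only [nonterminals, List.filter_cons]

lemma computes_nonterminals (hm : 1024 ≤ m) (S : List (Symbol T N)) {u : List (Symbol T N)}
    (hu : u.length ≤ m) :
    Computes (withLibrary main) 11 (.pair (encStack S) (encStack u))
      (encStack (nonterminals u ++ S)) (m ^ 3) := by
  refine Computes.fold_pow hm rfl (fun l => encStack (nonterminals l ++ S)) (i := 1)
    (j := 1) (by simpa using hu)
    (runs_baseCtx.mono (const_le_pow hm (j := 1) (by norm_num) (by norm_num))) fun x l _ => ?_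
  have hhead := runs_foldHead (P := withLibrary main)
    (a := encStack (nonterminals l ++ S)) (c := encStack S)
    (h := encSymbol x) (t := encStack l)
  have htag : Runs (withLibrary main) _ _ (if isNonterminal x = true then .tt else .nil) _ :=
    Runs.fst (y := .atom x) hhead
  refine (htag.ifNil (B₁ := 1) (B₂ := 5) (fun h => ?_) (fun h => ?_)).mono
    (const_le_pow hm (by norm_num) (by norm_num))
  · have e : nonterminals (x :: l) = nonterminals l := by rw [nonterminals_cons, if_neg h]
    rw [e]
    exact runs_foldAcc
  · have e : nonterminals (x :: l) = x :: nonterminals l := by rw [nonterminals_cons, if_pos h]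
    rw [e]
    exact hhead.pair runs_foldAcc

lemma computes_reverseNonterminals (hm : 1024 ≤ m) {u : List (Symbol T N)}
    (hu : u.length ≤ m) :
    Computes (withLibrary main) 12 (.pair .nil (encStack u))
      (encStack (nonterminals u).reverse) (m ^ 4) := by
  refine Computes.fold_pow hm rfl (fun l => encStack (nonterminals l).reverse) (i := 1)
    (j := 2) (by simpa using hu)
    (Runs.nil.mono (const_le_pow hm (by norm_num) (by norm_num))) fun x l hl => ?_
  have hhead := runs_foldHead (P := withLibrary main)
    (a := encStack (nonterminals l).reverse) (c := .nil)
    (h := encSymbol x) (t := encStack l)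
  have htag : Runs (withLibrary main) _ _ (if isNonterminal x = true then .tt else .nil) _ :=
    Runs.fst (y := .atom x) hhead
  have hlen : (nonterminals l).reverse.length ≤ m := by
    have h1 := hl.length_le
    have h2 : (nonterminals l).length ≤ l.length := List.length_filter_le _ _
    rw [List.length_reverse]
    simp only [List.length_cons] at h1
    omega
  have h2 := const_mul_pow_le hm (c := 100) (i := 1) (j := 2) (by norm_num) (by norm_num)
  rw [pow_one] at h2
  refine (htag.ifNil (B₁ := 1) (B₂ := 17 * m + 30) (fun h => ?_) (fun h => ?_)).mono
    (by omega)
  · have e : nonterminals (x :: l) = nonterminals l := by rw [nonterminals_cons, if_neg h]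
    rw [e]
    exact runs_foldAcc
  · have e : nonterminals (x :: l) = x :: nonterminals l := by rw [nonterminals_cons, if_pos h]
    rw [e, List.reverse_cons]
    refine (((hhead.pair .nil).pair runs_foldAcc).call
      (computes_append (self := 1) (l₂ := [x]) rfl encSymbol)).mono (by omega)

variable [DecidableEq N] [DecidableEq T]

set_option synthInstance.maxSize 1000 in
lemma computes_find (hm : 1024 ≤ m) {κ : Key N T} (hκ : (encKey κ).size ≤ m ^ 2)
    {C : List (Entry N T)} (hC : C.length ≤ m ^ 7) :
    Computes (withLibrary main) 8 (.pair (encKey κ) (encList encEntry C))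
      (encList encEntry (C.find? fun e => e.1 = κ).toList) (m ^ 11) := by
  refine Computes.fold_pow (P := withLibrary main) hm (self := 8) rfl
    (fun l => encList encEntry (l.find? fun e => e.1 = κ).toList) (i := 7) (j := 3) hC
    (Runs.nil.mono (const_le_pow hm (by norm_num) (by norm_num))) fun e l _ => ?_
  have h1 := ((runs_foldCtx (P := withLibrary main)
    (a := encList encEntry (l.find? fun e => e.1 = κ).toList) (c := encKey κ)
    (t := encList encEntry l)).pair (runs_foldHead (h := encEntry e)).fst).call
      (computes_eq_of_injective (self := 2) rfl encKey_injective κ e.1)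
  refine (h1.ifNil (fun h => ?_) (fun h => ?_)).mono (B₁ := _ + 1 + 5 + 1) ?_
  · rw [List.find?_cons_of_neg (by simpa using Ne.symm h)]
    exact runs_foldAcc
  · rw [List.find?_cons_of_pos (by simpa using h.symm)]
    exact runs_foldHead.pair .nil
  · have h2 := const_mul_pow_le hm (c := 100) (i := 2) (j := 3) (by norm_num) (by norm_num)
    have h3 := const_le_pow hm (c := 1024) (j := 2) (by norm_num) (by norm_num)
    omega

lemma computes_allowed (hm : 1024 ≤ m) (b c : Symbol T N) {u : List (Symbol T N)}
    (hu : u.length ≤ m) :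
    Computes (withLibrary main) 9 (.pair (.pair (encSymbol b) (encSymbol c)) (encStack u))
      (if allowed b c u = true then .tt else .nil) (m ^ 3) := by
  refine Computes.fold_pow hm rfl (fun l => if allowed b c l = true then .tt else .nil) (i := 1)
    (j := 1) (by simpa using hu)
    ((Runs.nil.pair .nil).mono (const_le_pow hm (by norm_num) (by norm_num))) fun x l _ => ?_
  have hacc := runs_foldAcc (P := withLibrary main)
    (a := if allowed b c l = true then .tt else .nil) (c := .pair (encSymbol b) (encSymbol c))
    (h := encSymbol x) (t := encStack l)
  have hhead := runs_foldHead (P := withLibrary main)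
    (a := if allowed b c l = true then .tt else .nil) (c := .pair (encSymbol b) (encSymbol c))
    (h := encSymbol x) (t := encStack l)
  have hctx := runs_foldCtx (P := withLibrary main)
    (a := if allowed b c l = true then .tt else .nil) (c := .pair (encSymbol b) (encSymbol c))
    (h := encSymbol x) (t := encStack l)
  have h5 := size_encSymbol_le x
  have hb := ((hhead.pair hctx.fst).call
    (computes_eq_of_injective (self := 2) rfl encSymbol_injective x b)).mono (B₂ := 310) (by omega)
  have hc := ((hhead.pair hctx.snd).call
    (computes_eq_of_injective (self := 2) rfl encSymbol_injective x c)).mono (B₂ := 310) (by omega)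
  refine (hacc.ifNil (fun h => ?_) (fun h => ?_)).mono (B₁ := 1 + 1 + 700 + 1)
    (const_le_pow hm (by norm_num) (by norm_num))
  · have : allowed b c (x :: l) = false := by
      simp only [allowed, List.all_cons, Bool.and_eq_false_iff]
      exact .inr (by simpa [allowed] using h)
    rw [this]
    exact .nil
  have e : allowed b c (x :: l) = (isNonterminal x || x = b || x = c) := by
    unfold allowed at h
    rw [allowed, List.all_cons, h, Bool.and_true]
  rw [e]
  have htag : Runs (withLibrary main) _ _ (if isNonterminal x = true then .tt else .nil) _ :=
    Runs.fst (y := .atom x) hhead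
  refine (htag.ifNil (B₁ := 640) (B₂ := 3) (fun h => ?_) (fun h => ?_)).mono (by norm_num)
  · refine (hb.ifNil (B₁ := 310) (B₂ := 3) (fun h' => ?_) (fun h' => ?_)).mono (by norm_num)
    · have : (isNonterminal x || x = b || x = c) = decide (x = c) := by simp [h, h']
      rw [this]
      simpa only [decide_eq_true_eq] using hc
    · rw [show (isNonterminal x || x = b || x = c) = true by simp [h']]
      exact Runs.nil.pair .nil
  · rw [show (isNonterminal x || x = b || x = c) = true by simp [h]]
    exact Runs.nil.pair .nil

lemma computes_count (hm : 1024 ≤ m) (b : Symbol T N) (i : ℕ) {u : List (Symbol T N)}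
    (hu : u.length ≤ m) :
    Computes (withLibrary main) 10 (.pair (.pair (encSymbol b) (encNat i)) (encStack u))
      (encNat (u.count b + i)) (m ^ 3) := by
  refine Computes.fold_pow hm rfl (fun l => encNat (l.count b + i)) (i := 1)
    (j := 1) (by simpa using hu) ?_ fun x l _ => ?_
  · simpa using runs_baseCtx.snd.mono (const_le_pow hm (j := 1) (by norm_num) (by norm_num))
  have hacc := runs_foldAcc (P := withLibrary main)
    (a := encNat (l.count b + i)) (c := .pair (encSymbol b) (encNat i))
    (h := encSymbol x) (t := encStack l)
  have h5 := size_encSymbol_le x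
  have hb := (((runs_foldHead (P := withLibrary main)
    (a := encNat (l.count b + i)) (c := .pair (encSymbol b) (encNat i))
    (h := encSymbol x) (t := encStack l)).pair runs_foldCtx.fst).call
    (computes_eq_of_injective (self := 2) rfl encSymbol_injective x b)).mono (B₂ := 310) (by omega)
  refine (hb.ifNil (B₁ := 1) (B₂ := 3) (fun h => ?_) (fun h => ?_)).mono
    (const_le_pow hm (by norm_num) (by norm_num))
  · rw [List.count_cons_of_ne h]
    exact hacc
  · subst h
    rw [List.count_cons_self, add_right_comm]
    exact Runs.nil.pair hacc

lemma computes_extendTo (hm : 1024 ≤ m) (e : Entry N T) (p : Production N T)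
    (S : List (Symbol T N)) (hp : p.output.length ≤ m) (hw : e.2.length ≤ m) :
    Computes (withLibrary main) 13 (.pair (encEntry e) (.pair (encProduction p) (encStack S)))
      (encEntry (extendTo e p S)) (m ^ 4) := by
  refine ⟨extendToBody, rfl, ?_⟩
  obtain ⟨⟨b, c, S₀, S₁, x, y⟩, w⟩ := e
  set arg : ATree (Symbol T N) :=
    .pair (encEntry ((b, c, S₀, S₁, x, y), w)) (.pair (encProduction p) (encStack S))
  have he : Runs (withLibrary main) [arg] (.fst (.var 0))
      (.pair (encKey (b, c, S₀, S₁, x, y)) (encWord w)) 2 := (Runs.var rfl).fst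
  have hkey : Runs (withLibrary main) [arg] (.fst (.fst (.var 0)))
      (.pair (encSymbol b) (.pair (encSymbol c) (.pair (encStack S₀) (.pair (encStack S₁)
        (.pair (encNat x) (encNat y)))))) 3 := he.fst
  have hpr : Runs (withLibrary main) [arg] (.fst (.snd (.var 0))) (encProduction p) 3 :=
    (Runs.var rfl).snd.fst
  have hout : Runs (withLibrary main) [arg] (.snd (.fst (.snd (.var 0)))) (encStack p.output) 4 :=
    Runs.snd (x := encSymbol (.nonterminal p.input)) hpr
  have hS : Runs (withLibrary main) [arg] (.snd (.snd (.var 0))) (encStack S) 3 :=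
    (Runs.var rfl).snd.snd
  have hx := ((hkey.fst.pair hkey.snd.snd.snd.snd.fst).pair hout).call
    (computes_count hm b x hp)
  have hy := ((hkey.snd.fst.pair hkey.snd.snd.snd.snd.snd).pair hout).call
    (computes_count hm c y hp)
  have hword := ((hpr.pair .nil).pair he.snd).call
    (computes_append (self := 1) (l₁ := w) (l₂ := [p]) rfl encProduction)
  refine ((hkey.fst.pair (hkey.snd.fst.pair (hkey.snd.snd.fst.pair
    (hS.pair (hx.pair hy))))).pair hword).mono ?_
  have h1 := const_mul_pow_le hm (c := 100) (i := 3) (j := 4) (by norm_num) (by norm_num)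
  have h2 := const_mul_pow_le hm (c := 1024) (i := 1) (j := 3) (by norm_num) (by norm_num)
  rw [pow_one] at h2
  simp only at hw
  omega

lemma computes_extensions (hm : 1024 ≤ m) (e : Entry N T) (p : Production N T)
    (hp : p.output.length ≤ m) (hw : e.2.length ≤ m) :
    Computes (withLibrary main) 14 (.pair (encEntry e) (encProduction p))
      (encList encEntry (extensions e p)) (m ^ 5) := by
  refine ⟨extensionsBody, rfl, ?_⟩
  set arg : ATree (Symbol T N) := .pair (encEntry e) (encProduction p)
  have he : Runs (withLibrary main) [arg] (.fst (.var 0)) (encEntry e) 2 := (Runs.var rfl).fst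
  have hkey : Runs (withLibrary main) [arg] (.fst (.fst (.var 0)))
      (.pair (encSymbol e.1.1) (.pair (encSymbol e.1.2.1) (.pair (encStack e.1.2.2.1)
        (.pair (encStack e.1.2.2.2.1)
          (.pair (encNat e.1.2.2.2.2.1) (encNat e.1.2.2.2.2.2)))))) 3 :=
    Runs.fst (y := encWord e.2) he
  have hpr : Runs (withLibrary main) [arg] (.snd (.var 0)) (encProduction p) 2 :=
    (Runs.var rfl).snd
  have hin : Runs (withLibrary main) [arg] (.fst (.snd (.var 0)))
    (encSymbol (.nonterminal p.input)) 3 := Runs.fst (y := encStack p.output) hpr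
  have hout : Runs (withLibrary main) [arg] (.snd (.snd (.var 0))) (encStack p.output) 3 :=
    Runs.snd (x := encSymbol (.nonterminal p.input)) hpr
  have hS := hkey.snd.snd.snd.fst
  have h1 := const_mul_pow_le hm (c := 100) (i := 4) (j := 5) (by norm_num) (by norm_num)
  have h2 := const_mul_pow_le hm (c := 1024) (i := 3) (j := 4) (by norm_num) (by norm_num)
  have h3 := const_mul_pow_le hm (c := 1024) (i := 1) (j := 3) (by norm_num) (by norm_num)
  rw [pow_one] at h3
  unfold extensions
  split
  · rename_i h
    rw [h] at hS
    exact (hS.ifNil_nil .nil).mono (by omega)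
  · rename_i s S h
    rw [h] at hS
    have hS' : Runs (withLibrary main) [arg] (.fst (.snd (.snd (.snd (.fst (.fst (.var 0)))))))
      (.pair (encSymbol s) (encStack S)) 7 := hS
    have h5 := size_encSymbol_le s
    have hs := ((hS'.fst.pair hin).call (computes_eq_of_injective (self := 2) rfl
      encSymbol_injective s (.nonterminal p.input))).mono (B₂ := 400) (by omega)
    have ha := ((hkey.fst.pair hkey.snd.fst).pair hout).call
      (computes_allowed hm e.1.1 e.1.2.1 hp)
    have hn := (hS'.snd.pair hout).call (computes_nonterminals hm S hp)
    have hr := (hS'.snd.pair ((Runs.nil.pair hout).call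
      (computes_reverseNonterminals hm hp))).call
      (computes_append (self := 1) (l₂ := S) rfl encSymbol)
    have hlen : (nonterminals p.output).reverse.length ≤ m := by
      rw [List.length_reverse]
      exact (List.length_filter_le _ _).trans hp
    have hn' := (he.pair (hpr.pair hn)).call (computes_extendTo hm e p _ hp hw)
    have hr' := (he.pair (hpr.pair hr)).call (computes_extendTo hm e p _ hp hw)
    refine (hS'.ifNil_else (by simp) (hs.ifNil (B₁ := 1) (B₂ := 20 * m ^ 4)
      (fun h => ?_) (fun h => ?_))).mono (by omega)
    · rw [if_neg h]
      exact .nil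
    rw [if_pos h]
    refine (ha.ifNil (B₁ := 1) (B₂ := 10 * m ^ 4) (fun h => ?_) (fun h => ?_)).mono (by omega)
    · rw [if_neg h]
      exact .nil
    · rw [if_pos h]
      exact (hn'.pair (hr'.pair .nil)).mono (by omega)

lemma length_extensions_le (e : Entry N T) (p : Production N T) :
    (extensions e p).length ≤ 2 := by
  unfold extensions
  split
  · simp
  · split_ifs <;> simp

lemma length_flatMap_extensions_le (e : Entry N T) (ps : List (Production N T)) :
    (ps.flatMap (extensions e)).length ≤ 2 * ps.length := by
  induction ps with
  | nil => simp
  | cons p ps ih =>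
    have := length_extensions_le e p
    simp only [List.flatMap_cons, List.length_append, List.length_cons]
    omega

lemma computes_allExtensions (hm : 1024 ≤ m) (e : Entry N T) {ps : List (Production N T)}
    (hps : ps.length ≤ m) (hout : ∀ p ∈ ps, p.output.length < m) (hw : e.2.length ≤ m) :
    Computes (withLibrary main) 15 (.pair (encEntry e) (encList encProduction ps))
      (encList encEntry (ps.flatMap (extensions e))) (m ^ 8) := by
  refine Computes.fold_pow hm rfl (fun l => encList encEntry (l.flatMap (extensions e))) (i := 1)
    (j := 6) (by simpa using hps)
    (Runs.nil.mono (const_le_pow hm (by norm_num) (by norm_num))) fun p l hl => ?_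
  have hp := hout p (hl.subset (by simp))
  refine ((runs_foldAcc.pair ((runs_foldCtx.pair runs_foldHead).call
    (computes_extensions hm e p hp.le hw))).call
    (computes_append (self := 1) rfl encEntry)).mono ?_
  have h1 := length_extensions_le e p
  have h2 := const_mul_pow_le hm (c := 100) (i := 5) (j := 6) (by norm_num) (by norm_num)
  have h3 := const_le_pow hm (c := 1024) (j := 5) (by norm_num) (by norm_num)
  omega

lemma computes_candidates (hm : 1024 ≤ m) {ps : List (Production N T)}
    (hps : 2 * ps.length < m) (hout : ∀ p ∈ ps, p.output.length < m)
    {C : List (Entry N T)} (hC : C.length ≤ m ^ 6) (hw : ∀ e ∈ C, e.2.length ≤ m) :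
    Computes (withLibrary main) 16 (.pair (encList encProduction ps) (encList encEntry C))
      (encList encEntry (candidates ps C)) (m ^ 16) := by
  refine Computes.fold_pow hm rfl (fun l => encList encEntry (candidates ps l)) (i := 6)
    (j := 9) hC (Runs.nil.mono (const_le_pow hm (by norm_num) (by norm_num))) fun e l hl => ?_
  refine ((runs_foldAcc.pair (runs_foldHead.pair ((runs_foldHead.pair runs_foldCtx).call
    (computes_allExtensions hm e (by omega) hout (hw e (hl.subset (by simp))))))).call
    (computes_append (self := 1) (l₁ := e :: ps.flatMap (extensions e)) rfl encEntry)).mono ?_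
  have h1 := length_flatMap_extensions_le e ps
  have h2 := const_mul_pow_le hm (c := 100) (i := 8) (j := 9) (by norm_num) (by norm_num)
  have h3 := const_mul_pow_le hm (c := 100) (i := 1) (j := 8) (by norm_num) (by norm_num)
  rw [pow_one] at h3
  simp only [List.length_cons]
  omega

lemma length_toList_le {β : Type*} (o : Option β) : o.toList.length ≤ 1 := by
  cases o <;> simp

lemma computes_select (hm : 1024 ≤ m) {C : List (Entry N T)} (hC : C.length ≤ m ^ 7)
    {K : List (Key N T)} (hK : K.length ≤ m ^ 6) (hκ : ∀ κ ∈ K, (encKey κ).size ≤ m ^ 2) :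
    Computes (withLibrary main) 17 (.pair (encList encEntry C) (encList encKey K))
      (encList encEntry (select C K)) (m ^ 19) := by
  refine Computes.fold_pow hm rfl (fun l => encList encEntry (select C l)) (i := 6)
    (j := 12) hK (Runs.nil.mono (const_le_pow hm (by norm_num) (by norm_num))) fun κ l hl => ?_
  refine ((runs_foldAcc.pair ((runs_foldHead.pair runs_foldCtx).call
    (computes_find hm (hκ κ (hl.subset (by simp))) hC))).call
    (computes_append (self := 1) rfl encEntry)).mono ?_
  have h1 := length_toList_le (C.find? fun e => e.1 = κ)
  have h2 := const_mul_pow_le hm (c := 100) (i := 11) (j := 12) (by norm_num) (by norm_num)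
  have h3 := const_le_pow hm (c := 1024) (j := 11) (by norm_num) (by norm_num)
  omega

lemma length_select_le (C : List (Entry N T)) (K : List (Key N T)) :
    (select C K).length ≤ K.length := by
  induction K with
  | nil => simp [select]
  | cons κ K ih =>
    have := length_toList_le (C.find? fun e => e.1 = κ)
    simp only [select, List.flatMap_cons, List.length_append, List.length_cons] at ih ⊢
    omega

lemma length_candidates_le (ps : List (Production N T)) (C : List (Entry N T)) :
    (candidates ps C).length ≤ C.length * (2 * ps.length + 1) := by
  induction C with
  | nil => simp [candidates]
  | cons e C ih =>
    have := length_flatMap_extensions_le e ps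
    simp only [candidates, List.flatMap_cons, List.length_append, List.length_cons] at ih ⊢
    rw [add_mul]
    omega

lemma length_word_le_of_mem_table {ps : List (Production N T)} {sy : List (Symbol T N)}
    {st : List (List (Symbol T N))} : ∀ {i : ℕ} {e : Entry N T}, e ∈ table ps sy st i →
      e.2.length ≤ i := by
  intro i
  induction i with
  | zero =>
    intro e he
    simp only [table, initialTable, List.mem_map] at he
    obtain ⟨x, -, rfl⟩ := he
    exact le_rfl
  | succ i ih =>
    intro e he
    have he := (mem_select he).1
    simp only [candidates, List.mem_flatMap, List.mem_cons] at he
    obtain ⟨e₀, he₀, rfl | ⟨p, -, he⟩⟩ := he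
    · exact (ih he₀).trans (Nat.le_succ _)
    · obtain ⟨S', -, -, rfl⟩ := mem_extensions.1 he
      simpa [extendTo] using ih he₀

lemma length_table_le {ps : List (Production N T)} {sy : List (Symbol T N)}
    {st : List (List (Symbol T N))} (hsy : sy.length ≤ m) (hst : st.length ≤ m)
    (hK : (keyList sy st).length ≤ m ^ 6) (hm : 1024 ≤ m) (i : ℕ) :
    (table ps sy st i).length ≤ m ^ 6 := by
  cases i with
  | zero =>
    simp only [table, initialTable, List.length_map, List.length_product]
    calc sy.length * (sy.length * st.length) ≤ m * (m * m) := by gcongr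
      _ = m ^ 3 := by ring
      _ ≤ m ^ 6 := Nat.pow_le_pow_right (by omega) (by norm_num)
  | succ i => exact (length_select_le _ _).trans hK

lemma computes_table (hm : 1024 ≤ m) {ps : List (Production N T)}
    (hps : 2 * ps.length < m) (hout : ∀ p ∈ ps, p.output.length < m)
    {sy : List (Symbol T N)} {st : List (List (Symbol T N))} (hsy : sy.length ≤ m)
    (hst : st.length ≤ m) (hK : (keyList sy st).length ≤ m ^ 6)
    (hκ : ∀ κ ∈ keyList sy st, (encKey κ).size ≤ m ^ 2) :
    Computes (withLibrary main) 18
      (.pair (.pair (encList encProduction ps) (.pair (encList encKey (keyList sy st))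
        (encList encEntry (initialTable sy st)))) (encList encStack st))
      (encList encEntry (table ps sy st st.length)) (m ^ 22) := by
  refine Computes.fold_pow hm rfl
    (fun l : List (List (Symbol T N)) => encList encEntry (table ps sy st l.length)) (i := 1)
    (j := 20) (by simpa using hst)
    (runs_baseCtx.snd.snd.mono (const_le_pow hm (by norm_num) (by norm_num))) fun S l hl => ?_
  have hlen := length_table_le (ps := ps) hsy hst hK hm l.length
  have hl' : l.length ≤ m := by
    have := hl.length_le
    simp only [List.length_cons] at this
    omega
  have hc : (candidates ps (table ps sy st l.length)).length ≤ m ^ 7 :=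
    (length_candidates_le _ _).trans
      ((Nat.mul_le_mul hlen (Nat.succ_le_of_lt hps)).trans (by rw [← pow_succ]))
  refine ((((runs_foldCtx.fst.pair runs_foldAcc).call (computes_candidates hm hps hout hlen
    fun e he => (length_word_le_of_mem_table he).trans hl')).pair runs_foldCtx.snd.fst).call
    (computes_select hm hc hK hκ)).mono ?_
  have h2 := const_mul_pow_le hm (c := 100) (i := 19) (j := 20) (by norm_num) (by norm_num)
  have h3 := const_mul_pow_le hm (c := 100) (i := 16) (j := 19) (by norm_num) (by norm_num)
  have h4 := const_le_pow hm (c := 1024) (j := 16) (by norm_num) (by norm_num)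
  omega

end ProgramCorrectness

/-! ### The bounded expression is computed in polynomial time -/

section ControlWords

variable {N : Type u} {T : Type v} {main : PExpr} {m : ℕ}

lemma length_keyList_le {sy : List (Symbol T N)} {st : List (List (Symbol T N))}
    (hsy : sy.length ≤ m) (hst : 2 * st.length < m) : (keyList sy st).length ≤ m ^ 6 := by
  have h1 : st.length ≤ m := by omega
  have h2 : 2 * st.length + 1 ≤ m := by omega
  rw [length_keyList]
  calc _ ≤ m * (m * (m * (m * (m * m)))) := by gcongr
    _ = m ^ 6 := by ring

lemma size_encKey_le (hm : 1024 ≤ m) {k : ℕ} (hk : k ≤ m) {sy : List (Symbol T N)}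
    (hst : 2 * (stackList sy k).length < m) {κ : Key N T}
    (hκ : κ ∈ keyList sy (stackList sy k)) : (encKey κ).size ≤ m ^ 2 := by
  obtain ⟨b, c, S, S', x, y⟩ := κ
  obtain ⟨-, -, hS, hS', hx, hy⟩ := mem_keyList.1 hκ
  have h1 := size_encSymbol_le b
  have h2 := size_encSymbol_le c
  have h3 := size_encStack_le S
  have h4 := size_encStack_le S'
  have h5 := (mem_stackList.1 hS).2
  have h6 := (mem_stackList.1 hS').2
  have h7 := const_mul_pow_le hm (c := 1024) (i := 1) (j := 2) le_rfl (by norm_num)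
  simp only [encKey, encPair, ATree.size, size_encNat]
  rw [pow_one] at h7
  omega

lemma size_encProduction_le_sq (hm : 1024 ≤ m) {p : Production N T} (hp : p.output.length < m) :
    (encProduction p).size ≤ m ^ 2 := by
  have h1 := size_encProduction_le p
  have h2 := const_mul_pow_le hm (c := 1024) (i := 1) (j := 2) le_rfl (by norm_num)
  rw [pow_one] at h2
  omega

lemma length_blockWords_le (hm : 1024 ≤ m) {ps : List (Production N T)} (hps : 2 * ps.length < m)
    {C : List (Entry N T)} (hC : C.length ≤ m ^ 6) : (blockWords ps C).length ≤ m ^ 7 := by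
  have h1 := List.length_filter_le (fun w => !w.isEmpty) (C.map Prod.snd)
  have h2 := const_mul_pow_le hm (c := 1024) (i := 6) (j := 7) le_rfl (by norm_num)
  have h3 : m ≤ m ^ 6 := Nat.le_self_pow (by norm_num) m
  simp only [blockWords, List.length_append, List.length_map] at h1 ⊢
  omega

lemma Runs.product (hm : 1024 ≤ m) {α : Type*} {β : Type*} {γ : Type*} {f : β → ATree α}
    {g : γ → ATree α} {env : List (ATree α)} {e₁ e₂ : PExpr} {l₁ : List β} {l₂ : List γ}
    {B₁ B₂ : ℕ} (i j : ℕ) (h₁ : Runs (withLibrary main) env e₁ (encList g l₂) B₁)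
    (h₂ : Runs (withLibrary main) env e₂ (encList f l₁) B₂)
    (hi : l₁.length ≤ m ^ i) (hj : l₂.length ≤ m ^ j) :
    Runs (withLibrary main) env (.call 4 (.pair e₁ e₂)) (encList (encPair f g) (l₁ ×ˢ l₂))
      (B₁ + B₂ + m ^ (i + j + 1)) := by
  refine ((h₁.pair h₂).call (computes_product (self := 4) (append := 1) (pairWith := 3)
    rfl rfl rfl f g)).mono ?_
  have h3 : l₁.length * (l₂.length * 37 + 40) ≤ m ^ i * (m ^ j * 37 + 40) := by gcongr
  have h4 := const_mul_pow_le hm (c := 1024) (i := i + j) (j := i + j + 1) le_rfl (by omega)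
  have h5 : m ^ i ≤ m ^ (i + j) := Nat.pow_le_pow_right (by omega) (by omega)
  have h6 : 1 ≤ m ^ (i + j) := Nat.one_le_pow _ _ (by omega)
  have h7 : m ^ i * (m ^ j * 37 + 40) = 37 * m ^ (i + j) + 40 * m ^ i := by ring
  omega

variable [DecidableEq N] [DecidableEq T]

lemma computes_controlWords (hm : 1024 ≤ m) {ps : List (Production N T)}
    (hps : 2 * ps.length < m) (hout : ∀ p ∈ ps, p.output.length < m) (X : N) (a : List T) {k : ℕ}
    (hk : k ≤ m) (hsy : (symbolList ps X).length ≤ m)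
    (hst : ∀ j ≤ k, 2 * (stackList (symbolList ps X) j).length < m) :
    Computes (withLibrary main) 23 (encInput ps X a k) (encBoundedExpr (controlExpr ps X k))
      (m ^ 23) := by
  refine ⟨controlWordsBody, rfl, ?_⟩
  set sy := symbolList ps X
  set st := stackList sy k
  have hV : 2 * st.length < m := hst k le_rfl
  have hK : (keyList sy st).length ≤ m ^ 6 := length_keyList_le hsy hV
  have hκ : ∀ κ ∈ keyList sy st, (encKey κ).size ≤ m ^ 2 := fun κ h => size_encKey_le hm hk hV h
  have hV' : st.length ≤ m := by omega
  have hnm : (numberList st.length).length ≤ m := by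
    rw [length_numberList]
    omega
  have htab := length_table_le (ps := ps) hsy hV' hK hm st.length
  set I : ATree (Symbol T N) := encInput ps X a k
  set nm := numberList st.length
  have r1 : Runs (withLibrary main) [I]
      (.call 5 (.pair (.pair (.fst (.snd (.var 0))) .nil) (.fst (.var 0)))) (encStack sy) _ :=
    Runs.call (((Runs.var rfl).snd.fst.pair .nil).pair (Runs.var rfl).fst)
      (computes_symbols hm X (by omega) hout)
  have r2 : Runs (withLibrary main) [encStack sy, I]
      (.call 6 (.pair (.var 0) (.snd (.snd (.snd (.var 1)))))) (encList encStack st) _ :=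
    Runs.call ((Runs.var rfl).pair (Runs.var rfl).snd.snd.snd)
      (computes_stacks hm hk hsy fun j hj => by have := hst j hj; omega)
  have r3 : Runs (withLibrary main) [encList encStack st, encStack sy, I]
      (.call 7 (.pair .nil (.var 0))) (encList encNat nm) _ :=
    Runs.call (Runs.nil.pair (Runs.var rfl)) (computes_numbers hm hV')
  have r4 : Runs (withLibrary main) [encList encNat nm, encList encStack st, encStack sy, I]
      (.call 4 (.pair (.call 4 (.pair (.call 4 (.pair (.call 4 (.pair (.call 4 (.pair
        (.var 0) (.var 0))) (.var 1))) (.var 1))) (.var 2))) (.var 2)))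
      (encList encKey (keyList sy st)) (6 + m ^ 3 + m ^ 4 + m ^ 5 + m ^ 6 + m ^ 7) := by
    have l1 : nm.length ≤ m ^ 1 := by simpa using hnm
    have l2 : st.length ≤ m ^ 1 := by simpa using hV'
    have l3 : sy.length ≤ m ^ 1 := by simpa using hsy
    have l4 : (nm ×ˢ nm).length ≤ m ^ 2 := by
      rw [List.length_product, sq]
      exact Nat.mul_le_mul hnm hnm
    have l5 : (st ×ˢ (nm ×ˢ nm)).length ≤ m ^ 3 := by
      rw [List.length_product, pow_succ' m 2]
      exact Nat.mul_le_mul hV' l4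
    have l6 : (st ×ˢ (st ×ˢ (nm ×ˢ nm))).length ≤ m ^ 4 := by
      rw [List.length_product, pow_succ' m 3]
      exact Nat.mul_le_mul hV' l5
    have l7 : (sy ×ˢ (st ×ˢ (st ×ˢ (nm ×ˢ nm)))).length ≤ m ^ 5 := by
      rw [List.length_product, pow_succ' m 4]
      exact Nat.mul_le_mul hsy l6
    refine (Runs.product hm 1 5 (.product hm 1 4 (.product hm 1 3 (.product hm 1 2 (.product hm 1 1
      (.var rfl) (.var rfl) l1 l1) (.var rfl) l2 l4) (.var rfl) l2 l5) (.var rfl) l3 l6)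
      (.var rfl) l3 l7).mono (by simp only [Nat.reduceAdd]; omega)
  set D : ATree (Symbol T N) := encList encKey (keyList sy st)
  have r5 : Runs (withLibrary main) [D, encList encNat nm, encList encStack st, encStack sy, I]
      (.call 19 (.pair .nil (.call 4 (.pair (.call 4 (.pair (.var 2) (.var 3))) (.var 3)))))
      (encList encEntry (initialTable sy st)) (6 + m ^ 3 + m ^ 4 + m ^ 5) := by
    have l1 : sy.length ≤ m ^ 1 := by simpa using hsy
    have l2 : st.length ≤ m ^ 1 := by simpa using hV'
    have l3 : (sy ×ˢ st).length ≤ m ^ 2 := by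
      rw [List.length_product, sq]
      exact Nat.mul_le_mul hsy hV'
    refine (Runs.call (Runs.nil.pair (.product hm 1 2 (.product hm 1 1 (.var rfl) (.var rfl) l1 l2)
      (.var rfl) l1 l3)) (computes_initial hm hsy hV')).mono
        (by simp only [Nat.reduceAdd]; omega)
  set E : ATree (Symbol T N) := encList encEntry (initialTable sy st)
  have r6 : Runs (withLibrary main) [E, D, encList encNat nm, encList encStack st, encStack sy, I]
      (.call 18 (.pair (.pair (.fst (.var 5)) (.pair (.var 1) (.var 0))) (.var 3)))
      (encList encEntry (table ps sy st st.length)) _ :=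
    Runs.call (((Runs.var rfl).fst.pair ((Runs.var rfl).pair (Runs.var rfl))).pair (Runs.var rfl))
      (computes_table hm hps hout hsy hV' hK hκ)
  set F : ATree (Symbol T N) := encList encEntry (table ps sy st st.length)
  have r7 : Runs (withLibrary main)
      [F, E, D, encList encNat nm, encList encStack st, encStack sy, I]
      (.call 20 (.pair (.call 21 (.pair .nil (.fst (.var 6)))) (.var 0)))
      (encList encWord (blockWords ps (table ps sy st st.length))) _ :=
    Runs.call (Runs.pair (Runs.call (Runs.nil.pair (Runs.var rfl).fst)
      (computes_singles hm (by omega))) (Runs.var rfl)) (computes_words hm htab)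
  set W : ATree (Symbol T N) := encList encWord (blockWords ps (table ps sy st st.length))
  have r8 : Runs (withLibrary main)
      [W, F, E, D, encList encNat nm, encList encStack st, encStack sy, I]
      (.call 22 (.pair (.var 0) (.var 3))) (encBoundedExpr (controlExpr ps X k)) _ :=
    Runs.call ((Runs.var rfl).pair (Runs.var rfl))
      (computes_repeat hm (length_blockWords_le hm hps htab) hK)
  refine (r1.bind (r2.bind (r3.bind (r4.bind (r5.bind (r6.bind (r7.bind r8))))))).mono ?_
  have b : ∀ j ≤ 15, m ^ j ≤ m ^ 15 := fun j hj => Nat.pow_le_pow_right (by omega) hj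
  have b1 := const_mul_pow_le hm (c := 1024) (i := 15) (j := 22) le_rfl (by norm_num)
  have b2 := const_mul_pow_le hm (c := 1024) (i := 22) (j := 23) le_rfl (by norm_num)
  have b3 : 1 ≤ m ^ 15 := Nat.one_le_pow _ _ (by omega)
  have c3 := b 3 (by norm_num)
  have c4 := b 4 (by norm_num)
  have c5 := b 5 (by norm_num)
  have c6 := b 6 (by norm_num)
  have c7 := b 7 (by norm_num)
  have c8 := b 8 (by norm_num)
  simp only [Nat.reduceAdd]
  omega

lemma size_encBoundedExpr_controlExpr_le (hm : 1024 ≤ m) {ps : List (Production N T)}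
    (hps : 2 * ps.length < m) (hout : ∀ p ∈ ps, p.output.length < m) (X : N) {k : ℕ}
    (hsy : (symbolList ps X).length ≤ m)
    (hst : 2 * (stackList (symbolList ps X) k).length < m) :
    (encBoundedExpr (controlExpr ps X k)).size ≤ m ^ 18 := by
  set sy := symbolList ps X
  set st := stackList sy k
  have hV : st.length ≤ m := by omega
  have hK := length_keyList_le hsy hst
  have hC := length_table_le (ps := ps) hsy hV hK hm st.length
  have hword : ∀ w ∈ controlWords ps X k, (encList encProduction w).size ≤ m ^ 4 := by
    intro w hw
    have hlen : w.length ≤ m := by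
      simp only [controlWords, blockWords, List.mem_flatMap, List.mem_append, List.mem_filter,
        List.mem_map] at hw
      obtain ⟨-, -, ⟨⟨e, he, rfl⟩, -⟩ | ⟨p, -, rfl⟩⟩ := hw
      · exact (length_word_le_of_mem_table he).trans hV
      · simp only [List.length_singleton]
        omega
    have h1 := size_encList_le (f := encProduction) (l := w) (s := m ^ 2) fun p hp =>
      size_encProduction_le_sq hm (hout p (mem_productions_of_mem_controlWords hw p hp))
    have h2 : w.length * (m ^ 2 + 1) ≤ m * (m ^ 2 + 1) := by gcongr
    have h3 : m * (m ^ 2 + 1) = m ^ 3 + m := by ring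
    have h4 := const_mul_pow_le hm (c := 1024) (i := 3) (j := 4) le_rfl (by norm_num)
    have h5 : m ≤ m ^ 3 := Nat.le_self_pow (by norm_num) m
    omega
  have hlen : (controlWords ps X k).length ≤ m ^ 13 := by
    simp only [controlWords, List.length_flatMap, List.map_const', List.sum_replicate, smul_eq_mul]
    calc _ ≤ m ^ 6 * m ^ 7 := Nat.mul_le_mul hK (length_blockWords_le hm hps hC)
      _ = m ^ 13 := by ring
  have h1 := size_encList_le hword
  have h2 : (controlWords ps X k).length * (m ^ 4 + 1) ≤ m ^ 13 * (m ^ 4 + 1) := by gcongr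
  have h3 : m ^ 13 * (m ^ 4 + 1) = m ^ 17 + m ^ 13 := by ring
  have h4 := const_mul_pow_le hm (c := 1024) (i := 17) (j := 18) le_rfl (by norm_num)
  have h5 : m ^ 13 ≤ m ^ 17 := Nat.pow_le_pow_right (by omega) (by norm_num)
  have h6 : 1 ≤ m ^ 13 := Nat.one_le_pow _ _ (by omega)
  exact h1.trans (by omega)

end ControlWords

/-! ### The size of the grammar -/

section GrammarSize

variable {N : Type u} {T : Type v}

lemma length_symbolList (ps : List (Production N T)) (X : N) :
    (symbolList ps X).length = (ps.map fun p => p.output.length + 1).sum + 1 := by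
  simp [symbolList, List.length_flatMap]

lemma Grammar.size_eq_sum {G : Grammar N T} {ps : List (Production N T)} (hnd : ps.Nodup)
    (hps : ∀ p, p ∈ ps ↔ p ∈ G.productions) :
    G.size = (ps.map fun p => p.output.length + 1).sum := by
  classical
  have : G.productions = ps.toFinset := by
    ext p
    rw [List.mem_toFinset, hps]
  rw [Grammar.size, this, List.sum_toFinset _ hnd]

lemma length_le_sum_map (ps : List (Production N T)) :
    ps.length ≤ (ps.map fun p => p.output.length + 1).sum := by
  induction ps with
  | nil => simp
  | cons p ps ih =>
    simp only [List.length_cons, List.map_cons, List.sum_cons]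
    omega

lemma length_output_lt_sum_map {ps : List (Production N T)} {p : Production N T} (hp : p ∈ ps) :
    p.output.length < (ps.map fun p => p.output.length + 1).sum :=
  List.single_le_sum (fun _ _ => Nat.zero_le _) _
    (List.mem_map_of_mem (f := fun p : Production N T => p.output.length + 1) hp)

lemma pow_le_pow_ten_mul {n k : ℕ} (hn : 2 ≤ n) (hk : 0 < k) {i : ℕ} (hi : i ≤ 10) :
    n ^ i ≤ n ^ (10 * k) :=
  Nat.pow_le_pow_right (by omega) (by omega)

/-- The words of length at most `k` over the symbols of a grammar of size at most `n` are few
compared with `n ^ (10 * k)`. -/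
lemma two_mul_length_stackList_lt {n k j : ℕ} (hn : 2 ≤ n) (hk : 0 < k) (hj : j ≤ k)
    {sy : List (Symbol T N)} (hsy : sy.length ≤ n + 1) :
    2 * (stackList sy j).length < n ^ (10 * k) := by
  calc 2 * (stackList sy j).length ≤ n * (n ^ 2) ^ j :=
        Nat.mul_le_mul hn ((length_stackList_le j).trans (Nat.pow_le_pow_left (by nlinarith) j))
    _ = n ^ (2 * j + 1) := by rw [← pow_mul, pow_succ']
    _ < n ^ (10 * k) := Nat.pow_lt_pow_right (by omega) (by omega)

variable [DecidableEq N] [DecidableEq T]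

/-- Time and output size together, in terms of the size of the grammar.  With `n = max 2 G.size`, the
number `m = n ^ (10 * k)` exceeds `1024` and bounds all lists from which the keys are formed, since
there are at most `(n + 2) ^ k ≤ n ^ (2 * k)` stacks; the total is at most `m ^ 24`.  The summand `10`
leaves room for the steps of the main functions. -/
lemma computes_controlExpr {G : Grammar N T} {ps : List (Production N T)} (hnd : ps.Nodup)
    (hps : ∀ p, p ∈ ps ↔ p ∈ G.productions) (X : N) (a : List T) {k : ℕ} (hk : 0 < k)
    (main : PExpr) : ∃ B,
    Computes (withLibrary main) 23 (encInput ps X a k) (encBoundedExpr (controlExpr ps X k)) B ∧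
    B + (encBoundedExpr (controlExpr ps X k)).size + 10 ≤ max 2 G.size ^ (240 * k) := by
  set n := max 2 G.size
  have hn : 2 ≤ n := le_max_left _ _
  have hsum : (ps.map fun p => p.output.length + 1).sum ≤ n :=
    (Grammar.size_eq_sum hnd hps).symm.le.trans (le_max_right _ _)
  have hsy : (symbolList ps X).length ≤ n + 1 := by
    rw [length_symbolList]
    omega
  have hm : 1024 ≤ n ^ (10 * k) :=
    (Nat.pow_le_pow_left hn 10 : 2 ^ 10 ≤ n ^ 10).trans (pow_le_pow_ten_mul hn hk le_rfl)
  have hkm : k ≤ n ^ (10 * k) := Nat.lt_two_pow_self.le.trans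
    ((Nat.pow_le_pow_left hn k).trans (Nat.pow_le_pow_right (by omega) (by omega)))
  have h3 : n ^ 3 ≤ n ^ (10 * k) := pow_le_pow_ten_mul hn hk (by norm_num)
  have h4 : 4 * n ≤ n ^ 3 := by
    rw [pow_succ]
    exact Nat.mul_le_mul_right n (Nat.pow_le_pow_left hn 2)
  have hps' := (length_le_sum_map ps).trans hsum
  have hout : ∀ p ∈ ps, p.output.length < n ^ (10 * k) := fun p hp => by
    have := length_output_lt_sum_map hp
    omega
  have hst := fun j (hj : j ≤ k) => two_mul_length_stackList_lt hn hk hj hsy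
  refine ⟨_, computes_controlWords hm (by omega) hout X a hkm (by omega) hst, ?_⟩
  have h5 := size_encBoundedExpr_controlExpr_le hm (by omega) hout X (by omega) (hst k le_rfl)
  have h6 := const_mul_pow_le hm (c := 1024) (i := 23) (j := 24) le_rfl (by norm_num)
  have h7 : (n ^ (10 * k)) ^ 18 ≤ (n ^ (10 * k)) ^ 23 :=
    Nat.pow_le_pow_right (by omega) (by norm_num)
  have h8 : 1 ≤ (n ^ (10 * k)) ^ 18 := Nat.one_le_pow _ _ (by omega)
  have h9 : n ^ (240 * k) = (n ^ (10 * k)) ^ 24 := by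
    rw [← pow_mul]
    congr 1
    ring
  rw [h9]
  omega

end GrammarSize

/-- A main function that meets the time bound solves the task. -/
lemma Program.OutputsWithin.of_computes {α : Type u} {P : Program} {x y : ATree α} {B C : ℕ}
    (h : Computes P 0 x y B) (hB : B + y.size + 2 ≤ C) : P.OutputsWithin x y C := by
  obtain ⟨t, ht, h⟩ := Runs.call (env := [x]) (e := .var 0) (.var rfl) h
  exact ⟨t, h, by omega⟩

theorem mainTheorem2 :
    ∃ (c : ℕ) (P Q : Program),
      ∀ (N : Type u) (T : Type v) [Finite N] [Finite T] (G : Grammar N T),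
      (∀ p ∈ G.productions, terminalCount p.output ≤ 2 ∧ nonterminalCount p.output ≤ 2) →
      ∀ (X : N) (a : List T), IsMinimalStrict a (G.language X) →
      ∀ k : ℕ, 0 < k →
      ∀ ps : List (Production N T), ps.Nodup → (∀ p, p ∈ ps ↔ p ∈ G.productions) →
      ∃ S : Set (BoundedExpr (Production N T)),
        S.Finite ∧
        (∀ Γ ∈ S, ∀ w ∈ Γ.words, ∀ p ∈ w, p ∈ G.productions) ∧
        G.indexLanguage k X ≤
          G.controlledLanguage X ({γ | ∃ Γ ∈ S, γ ∈ Γ.lang} ∩ G.dfControlSet (k + 1) X) ∧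
        (∃ l : List (BoundedExpr (Production N T)), (∀ Γ, Γ ∈ S ↔ Γ ∈ l) ∧
          P.OutputsWithin (encInput ps X a k) (encList encBoundedExpr l)
            ((max 2 G.size) ^ (c * k + a.length))) ∧
        (∀ σ : List (Production N T), (∀ p ∈ σ, p ∈ G.productions) → σ.length ≤ a.length →
          ∃ Γ ∈ S, Q.OutputsWithin (.pair (encInput ps X a k) (encList encProduction σ))
            (encBoundedExpr Γ) ((max 2 G.size) ^ (c * k))) ∧
        (∀ Γ ∈ S, ∃ σ : List (Production N T),
          (∀ p ∈ σ, p ∈ G.productions) ∧ σ.length ≤ a.length ∧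
          Q.OutputsWithin (.pair (encInput ps X a k) (encList encProduction σ))
            (encBoundedExpr Γ) ((max 2 G.size) ^ (c * k))) := by
  classical
  -- the control expression does not depend on `σ`; `Q` passes the first component of its input on
  refine ⟨240, withLibrary (.pair (.call 23 (.var 0)) .nil), withLibrary (.call 23 (.fst (.var 0))),
    fun N T _ _ G hG X a ha k hk ps hnd hps => ?_⟩
  have hP : (withLibrary (.pair (.call 23 (.var 0)) .nil)).OutputsWithin (encInput ps X a k)
      (encList encBoundedExpr [controlExpr ps X k]) (max 2 G.size ^ (240 * k)) := by
    obtain ⟨B, hB, hle⟩ := computes_controlExpr hnd hps X a hk (.pair (.call 23 (.var 0)) .nil)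
    refine .of_computes ⟨_, rfl, (Runs.call (.var rfl) hB).pair .nil⟩ ?_
    simp only [encList, ATree.size]
    omega
  have hQ : ∀ σ : List (Production N T), (withLibrary (.call 23 (.fst (.var 0)))).OutputsWithin
      (.pair (encInput ps X a k) (encList encProduction σ))
      (encBoundedExpr (controlExpr ps X k)) (max 2 G.size ^ (240 * k)) := by
    intro σ
    obtain ⟨B, hB, hle⟩ := computes_controlExpr hnd hps X a hk (.call 23 (.fst (.var 0)))
    exact .of_computes ⟨_, rfl, Runs.call (Runs.fst (.var rfl)) hB⟩ (by omega)
  refine ⟨{controlExpr ps X k}, Set.finite_singleton _, ?_, ?_,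
    ⟨[controlExpr ps X k], by simp, ?_⟩, fun σ _ _ => ⟨_, rfl, hQ σ⟩, ?_⟩
  · rintro Γ rfl w hw p hp
    exact (hps p).1 (mem_productions_of_mem_controlWords hw p hp)
  · intro w hw
    obtain ⟨s, ⟨hs, hdf⟩, hder⟩ := indexLanguage_le_controlledLanguage hG ha hk hps hw
    exact ⟨s, ⟨⟨_, rfl, hs⟩, Grammar.dfControlSet_mono (Nat.le_succ k) X hdf⟩, hder⟩
  · obtain ⟨t, ht, hle⟩ := hP
    exact ⟨t, ht, hle.trans (Nat.pow_le_pow_right (by omega) (by omega))⟩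
  · rintro Γ rfl
    exact ⟨[], by simp, by simp, hQ []⟩
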